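/- Let $(M,g)$ be a smooth four-dimensional space-time of signature $(-,+,+,+)$, with Weyl tensor $W$, endowed with a smooth $2+2$ almost-product structure, i.e. a smooth field $V$ of time-like $2$-planes together with the field $H=V^{\perp}$ of their space-like orthogonal complements, with orthogonal projectors $v$ and $h$. Denote by $U$ the canonical $2$-form of the structure, i.e. the volume element of $V$ (locally defined up to sign by $U_\alpha{}^{\mu}U_{\mu\beta}=v_{\alpha\beta}$). Assume that the structure is (a) umbilical: both $V$ and $H$ are umbilical, i.e. the symmetric part of the generalized second fundamental form $Q_v(x,y)=h(\nabla_{v(x)}v(y))$ is pure trace, $\frac12\big(Q_v(x,y)+Q_v(y,x)\big)=\frac12\,g(v(x),y)\,\mathrm{tr}\,Q_v$, and likewise with $v$ and $h$ interchanged; (b) Maxwellian: in a neighbourhood of each point there are smooth functions $\phi,\psi$ and a canonical $2$-form $U$ of the structure such that $F=e^{\phi}(\cos\psi\,U+\sin\psi\,{*U})$ solves the source-free Maxwell equations $\delta F=0$, $\delta{*F}=0$. Then, at every point $p$ where $g$ is not conformally flat in the sense that $W_p\neq 0$ (so everywhere, if $W$ vanishes nowhere): (1) the Weyl tensor is of Petrov–Bel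 type D, i.e. as an endomorphism $F_{\alpha\beta}\mapsto\frac12W_{\alpha\beta}{}^{\mu\nu}F_{\mu\nu}$ of the three-dimensional complex space of self-dual bivectors (${*F}=\mathrm{i}F$) it is diagonalizable with a simple eigenvalue $-2\rho$ and a double eigenvalue $\rho\neq0$; (2) the structure is aligned with the Weyl principal structure, i.e. the canonical self-dual bivector $\mathcal U=\frac1{\sqrt2}(U-\mathrm{i}\,{*U})$ is the principal bivector of $W$: $W(\mathcal U)=-2\rho\,\mathcal U$. -/

import Mathlib

open scoped Manifold ContDiff BigOperators

noncomputable section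

namespace SpaceTime

/-- The model space `ℝ⁴`; the standard basis vectors are written `EuclideanSpace.single i 1`. -/
abbrev E4 : Type := EuclideanSpace ℝ (Fin 4)

/-- Real `4 × 4` arrays, used for the components of 2-tensors in a coordinate system. -/
abbrev Mat4 : Type := Matrix (Fin 4) (Fin 4) ℝ

/-- Complex `4 × 4` arrays. -/
abbrev CMat4 : Type := Matrix (Fin 4) (Fin 4) ℂ

/-! ### Algebra at a point

Here `A` is the matrix of components `g_{ab}` of the metric at one point, so `A⁻¹` is `g^{ab}`. -/

/-- The Levi-Civita symbol `ε_{abcd}`, with `ε_{0123} = 1`. -/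
def leviCivita (a b c d : Fin 4) : ℝ :=
  ((1 : Mat4).submatrix ![a, b, c, d] id).det

/-- The metric volume element `η_{abcd} = √(-det g) ε_{abcd}`. -/
def volForm (A : Mat4) (a b c d : Fin 4) : ℝ :=
  Real.sqrt (-A.det) * leviCivita a b c d

/-- The Hodge dual of a real or complex 2-form, `(*F)_{ab} = ½ η_{abcd} F^{cd}`. -/
def hodge {𝕜 : Type*} [AddCommGroup 𝕜] [Module ℝ 𝕜] (A : Mat4)
    (F : Matrix (Fin 4) (Fin 4) 𝕜) : Matrix (Fin 4) (Fin 4) 𝕜 :=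
  fun a b => ∑ c, ∑ d, ∑ e, ∑ f,
    ((1 / 2 : ℝ) * volForm A a b c d * A⁻¹ c e * A⁻¹ d f) • F e f

/-- `F` is a self-dual bivector: a complex 2-form with `*F = i F`. -/
def IsSelfDual (A : Mat4) (F : CMat4) : Prop :=
  F.transpose = -F ∧ hodge A F = Complex.I • F

/-- The action of a double 2-form on 2-forms, `P(F)_{ab} = ½ P_{ab}^{cd} F_{cd}`. -/
def doubleFormApply (A : Mat4) (P : Fin 4 → Fin 4 → Fin 4 → Fin 4 → ℝ) (F : CMat4) : CMat4 :=
  fun a b => ∑ c, ∑ d, ∑ e, ∑ f,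
    ((1 / 2 : ℝ) * P a b c d * A⁻¹ c e * A⁻¹ d f) • F e f

/-- `U` is a volume element of the plane `V` whose orthogonal projector is `P = (v^a_b)`:
`U` is a 2-form with `U² = v`, that is `U_a^c U_{cb} = v_{ab}`.
(For a time-like plane `V` this determines the unitary simple 2-form `U` up to sign.) -/
def IsVolumeElement (A P U : Mat4) : Prop :=
  U.transpose = -U ∧ U * A⁻¹ * U = A * P

/-- The canonical self-dual bivector `𝒰 = (U - i *U) / √2` associated with `U`. -/
def canonicalSD (A U : Mat4) : CMat4 :=
  fun a b => (1 / (Real.sqrt 2 : ℂ)) * (((U a b : ℝ) : ℂ) - Complex.I * ((hodge A U a b : ℝ) : ℂ))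

/-- `B` is a basis of the space of self-dual bivectors made of eigenbivectors of `W`,
with eigenvalues `-2ρ, ρ, ρ`. -/
structure IsTypeDBasis (A : Mat4) (W : Fin 4 → Fin 4 → Fin 4 → Fin 4 → ℝ) (ρ : ℂ)
    (B : Fin 3 → CMat4) : Prop where
  linearIndependent : LinearIndependent ℂ B
  selfDual : ∀ i, IsSelfDual A (B i)
  spans : ∀ F, IsSelfDual A F → F ∈ Submodule.span ℂ (Set.range B)
  simple : doubleFormApply A W (B 0) = (-2 * ρ) • B 0
  double₁ : doubleFormApply A W (B 1) = ρ • B 1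
  double₂ : doubleFormApply A W (B 2) = ρ • B 2

/-- A Weyl tensor `W` is of Petrov-Bel type D if its restriction to the self-dual bivectors
is diagonalizable with one simple eigenvalue `-2ρ` and one double eigenvalue `ρ ≠ 0`. -/
def IsTypeD (A : Mat4) (W : Fin 4 → Fin 4 → Fin 4 → Fin 4 → ℝ) : Prop :=
  ∃ ρ : ℂ, ρ ≠ 0 ∧ ∃ B : Fin 3 → CMat4, IsTypeDBasis A W ρ B

/-- The plane with projector `P` is the time-like principal plane of a type D Weyl tensor `W`:
its canonical self-dual bivector is the principal bivector of `W`,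
i.e. the eigenbivector for the simple eigenvalue. -/
def IsPrincipalPlane (A : Mat4) (W : Fin 4 → Fin 4 → Fin 4 → Fin 4 → ℝ) (P : Mat4) : Prop :=
  ∃ ρ : ℂ, ρ ≠ 0 ∧ ∃ B : Fin 3 → CMat4, IsTypeDBasis A W ρ B ∧
    ∃ U : Mat4, IsVolumeElement A P U ∧ B 0 = canonicalSD A U

/-! ### Tensor calculus in a coordinate system

Here `G x` is the matrix of components of the metric at the point with coordinates `x`. -/

/-- The partial derivative `∂_k f`. -/
def pderiv (k : Fin 4) (f : E4 → ℝ) (x : E4) : ℝ :=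
  fderiv ℝ f x (EuclideanSpace.single k 1)

/-- The Christoffel symbols `Γ^k_{ij}` of the Levi-Civita connection. -/
def christoffel (G : E4 → Mat4) (k i j : Fin 4) (x : E4) : ℝ :=
  (1 / 2) * ∑ l, (G x)⁻¹ k l *
    (pderiv i (fun y => G y j l) x + pderiv j (fun y => G y i l) x
      - pderiv l (fun y => G y i j) x)

/-- The Riemann tensor
`R^l_{kij} = ∂_i Γ^l_{jk} - ∂_j Γ^l_{ik} + Γ^l_{im} Γ^m_{jk} - Γ^l_{jm} Γ^m_{ik}`. -/
def riemannUp (G : E4 → Mat4) (l k i j : Fin 4) (x : E4) : ℝ :=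
  pderiv i (christoffel G l j k) x - pderiv j (christoffel G l i k) x
    + ∑ m, (christoffel G l i m x * christoffel G m j k x
      - christoffel G l j m x * christoffel G m i k x)

/-- `R_{abcd} = g_{al} R^l_{bcd}`. -/
def riemann (G : E4 → Mat4) (x : E4) (a b c d : Fin 4) : ℝ :=
  ∑ l, G x a l * riemannUp G l b c d x

/-- The Ricci tensor `R_{bd} = R^a_{bad}`. -/
def ricci (G : E4 → Mat4) (x : E4) (b d : Fin 4) : ℝ :=
  ∑ a, riemannUp G a b a d x

/-- The scalar curvature. -/
def scalarCurv (G : E4 → Mat4) (x : E4) : ℝ :=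
  ∑ b, ∑ d, (G x)⁻¹ b d * ricci G x b d

/-- The Weyl tensor `W_{abcd}` in dimension four. -/
def weyl (G : E4 → Mat4) (x : E4) (a b c d : Fin 4) : ℝ :=
  riemann G x a b c d
    - (1 / 2) * (G x a c * ricci G x b d + G x b d * ricci G x a c
        - G x a d * ricci G x b c - G x b c * ricci G x a d)
    + (scalarCurv G x / 6) * (G x a c * G x b d - G x a d * G x b c)

/-- `∇_e P^d_b` for a field of endomorphisms `P = (P^d_b)`. -/
def covEnd (G P : E4 → Mat4) (x : E4) (e d b : Fin 4) : ℝ :=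
  pderiv e (fun y => P y d b) x
    + ∑ m, (christoffel G d e m x * P x m b - christoffel G m e b x * P x d m)

/-- `∇_e F_{ab}` for a field of covariant 2-tensors `F`. -/
def covForm (G F : E4 → Mat4) (x : E4) (e a b : Fin 4) : ℝ :=
  pderiv e (fun y => F y a b) x
    - ∑ m, (christoffel G m e a x * F x m b + christoffel G m e b x * F x a m)

/-- The generalized second fundamental form `Q(X, Y) = (1 - P)(∇_{P X} (P Y))` of the distribution
with orthogonal projector `P`; in components `Q^c_{ab} = (1 - P)^c_d P^e_a ∇_e P^d_b`
(the derivative of `Y` is removed by `(1 - P) P = 0`). -/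
def secondFund (G P : E4 → Mat4) (x : E4) (c a b : Fin 4) : ℝ :=
  ∑ d, ∑ e, (1 - P x) c d * P x e a * covEnd G P x e d b

/-- A distribution of 2-planes with orthogonal projector `P` is umbilical at `x` if the symmetric
part of its second fundamental form is pure trace: `Q^c_{(ab)} = ½ P_{ab} g^{mn} Q^c_{mn}`. -/
def UmbilicalPlaneAt (G P : E4 → Mat4) (x : E4) : Prop :=
  ∀ a b c, (1 / 2) * (secondFund G P x c a b + secondFund G P x c b a) =
    (1 / 2) * (G x * P x) a b * ∑ m, ∑ n, (G x)⁻¹ m n * secondFund G P x c m n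

/-- The divergence `∇^a F_{ab}` of a 2-form, which is its codifferential up to sign. -/
def divForm (G F : E4 → Mat4) (x : E4) (b : Fin 4) : ℝ :=
  ∑ e, ∑ a, (G x)⁻¹ e a * covForm G F x e a b

/-- The source-free Maxwell equations `δF = 0`, `δ*F = 0` at `x`. -/
def MaxwellAt (G F : E4 → Mat4) (x : E4) : Prop :=
  ∀ b, divForm G F x b = 0 ∧ divForm G (fun y => hodge (G y) (F y)) x b = 0

/-- Near `x` there is a non-null solution `F = e^φ (cos ψ U + sin ψ *U)` of the source-free
Maxwell equations whose geometry `U` is a volume element of the planes with projector `P`. -/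
def MaxwellianNear (G P : E4 → Mat4) (x : E4) : Prop :=
  ∃ N : Set E4, IsOpen N ∧ x ∈ N ∧ ∃ (U : E4 → Mat4) (φ ψ : E4 → ℝ),
    (∀ a b, ContDiffOn ℝ ∞ (fun y => U y a b) N) ∧
    ContDiffOn ℝ ∞ φ N ∧ ContDiffOn ℝ ∞ ψ N ∧
    ∀ y ∈ N, IsVolumeElement (G y) (P y) (U y) ∧
      MaxwellAt G (fun z => Real.exp (φ z) •
        (Real.cos (ψ z) • U z + Real.sin (ψ z) • hodge (G z) (U z))) y

/-! ### Space-times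

A tensor field on a manifold is handled through its components in all charts of the maximal
smooth atlas. -/

section Manifold

variable {M : Type*} [TopologicalSpace M] [ChartedSpace E4 M]

/-- The coordinate vector field `∂_i` of the chart `c`, at the point with coordinates `x`. -/
def coordVec (c : OpenPartialHomeomorph M E4) (i : Fin 4) (x : E4) :
    TangentSpace (𝓡 4) (c.symm x) :=
  mfderiv (𝓡 4) (𝓡 4) c.symm x (EuclideanSpace.single i 1 : E4)

/-- The components `g_{ij}` of a field of bilinear forms in the chart `c`. -/
def formComp (g : ∀ p : M, LinearMap.BilinForm ℝ (TangentSpace (𝓡 4) p))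
    (c : OpenPartialHomeomorph M E4) (x : E4) : Mat4 :=
  fun i j => g (c.symm x) (coordVec c i x) (coordVec c j x)

/-- The components `P^i_j` of a field of endomorphisms in the chart `c`. -/
def endComp (P : ∀ p : M, TangentSpace (𝓡 4) p →ₗ[ℝ] TangentSpace (𝓡 4) p)
    (c : OpenPartialHomeomorph M E4) (x : E4) : Mat4 :=
  fun i j =>
    (show E4 from mfderiv (𝓡 4) (𝓡 4) c (c.symm x) (P (c.symm x) (coordVec c j x))) i

/-- A frame which is orthonormal for a form of signature `(-,+,+,+)`. -/
def IsLorentzFrame {T : Type*} [AddCommGroup T] [Module ℝ T] (g : LinearMap.BilinForm ℝ T)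
    (e : Fin 4 → T) : Prop :=
  ∀ i j, g (e i) (e j) = if i = j then (if i = 0 then -1 else 1) else 0

end Manifold

/-- A smooth Lorentzian metric of signature `(-,+,+,+)` on a smooth 4-manifold. -/
structure LorentzMetric (M : Type*) [TopologicalSpace M] [ChartedSpace E4 M]
    [IsManifold (𝓡 4) ∞ M] where
  form : ∀ p : M, LinearMap.BilinForm ℝ (TangentSpace (𝓡 4) p)
  symm : ∀ p v w, form p v w = form p w v
  signature : ∀ p, ∃ e, IsLorentzFrame (form p) e
  smooth : ∀ c ∈ IsManifold.maximalAtlas (𝓡 4) ∞ M, ∀ i j,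
    ContDiffOn ℝ ∞ (fun x => formComp form c x i j) c.target

/-- A 2+2 almost-product structure: a smooth field of time-like 2-planes `V`, given by the
orthogonal projectors on `V`. At each point there is an orthonormal frame whose first two vectors
(the first one being time-like) span `V` and whose last two span its orthogonal complement `H`. -/
structure AlmostProduct {M : Type*} [TopologicalSpace M] [ChartedSpace E4 M]
    [IsManifold (𝓡 4) ∞ M] (g : LorentzMetric M) where
  proj : ∀ p : M, TangentSpace (𝓡 4) p →ₗ[ℝ] TangentSpace (𝓡 4) p
  adapted : ∀ p, ∃ e, IsLorentzFrame (g.form p) e ∧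
    proj p (e 0) = e 0 ∧ proj p (e 1) = e 1 ∧ proj p (e 2) = 0 ∧ proj p (e 3) = 0
  smooth : ∀ c ∈ IsManifold.maximalAtlas (𝓡 4) ∞ M, ∀ i j,
    ContDiffOn ℝ ∞ (fun x => endComp proj c x i j) c.target

section Geometry

variable {M : Type*} [TopologicalSpace M] [ChartedSpace E4 M] [IsManifold (𝓡 4) ∞ M]

/-- The Weyl tensor does not vanish at `p` (its components do not all vanish; this does not depend
on the chart). -/
def LorentzMetric.WeylNeZeroAt (g : LorentzMetric M) (p : M) : Prop :=
  ∀ c ∈ IsManifold.maximalAtlas (𝓡 4) ∞ M, p ∈ c.source →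
    weyl (formComp g.form c) (c p) ≠ 0

/-- The Weyl tensor is of Petrov-Bel type D at `p`. (Charts of both orientations are used; a change
of orientation replaces self-dual bivectors and eigenvalues by their complex conjugates.) -/
def LorentzMetric.WeylTypeDAt (g : LorentzMetric M) (p : M) : Prop :=
  ∀ c ∈ IsManifold.maximalAtlas (𝓡 4) ∞ M, p ∈ c.source →
    IsTypeD (formComp g.form c (c p)) (weyl (formComp g.form c) (c p))

/-- The structure is umbilical: both `V` and `H` are umbilical. -/
def AlmostProduct.IsUmbilical {g : LorentzMetric M} (V : AlmostProduct g) : Prop :=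
  ∀ c ∈ IsManifold.maximalAtlas (𝓡 4) ∞ M, ∀ x ∈ c.target,
    UmbilicalPlaneAt (formComp g.form c) (endComp V.proj c) x ∧
    UmbilicalPlaneAt (formComp g.form c) (fun y => 1 - endComp V.proj c y) x

/-- The structure is Maxwellian: it is the geometry of a non-null solution of the source-free
Maxwell equations, defined in a neighbourhood of each point. -/
def AlmostProduct.IsMaxwellian {g : LorentzMetric M} (V : AlmostProduct g) : Prop :=
  ∀ c ∈ IsManifold.maximalAtlas (𝓡 4) ∞ M, ∀ x ∈ c.target,
    MaxwellianNear (formComp g.form c) (endComp V.proj c) x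

/-- The structure is aligned at `p` with the principal structure of a type D Weyl tensor. -/
def AlmostProduct.AlignedWithWeylAt {g : LorentzMetric M} (V : AlmostProduct g) (p : M) : Prop :=
  ∀ c ∈ IsManifold.maximalAtlas (𝓡 4) ∞ M, p ∈ c.source →
    IsPrincipalPlane (formComp g.form c (c p)) (weyl (formComp g.form c) (c p))
      (endComp V.proj c (c p))

end Geometry

end SpaceTime

end

/-! Write the Maxwell field as `F = e^φ (cos ψ U + sin ψ *U)`; its self-dual part is `e^{φ+iψ} 𝒰` up
to a constant. The central object is the 2-form `Y = e^{-φ/2} (cos (ψ/2) U - sin (ψ/2) *U)`, whose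
self-dual part is `e^{-(φ+iψ)/2} 𝒰` up to the same constant. For an umbilical Maxwellian structure,
`Y` is a conformal Killing-Yano form: `∇_a Y_{bc} + ∇_b Y_{ac} = 2 g_{ab} ξ_c - g_{ac} ξ_b - g_{bc}
ξ_a` with `ξ = (1/3) div Y`. Differentiating `U² = v`, `U *U = 0`, `(*U)² = v - 1` shows that `∇U`
has only the sixteen components mixing `V` and `H`, and that they determine `∇*U` and `∇v`.
Umbilicity gives eight linear relations between them, and Maxwell's equations express `dφ`, `dψ`
through the rest; together these are exactly what the Killing-Yano equation requires
(`frame_killingYano`, `killingYanoAt_of_maxwell`).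

Differentiating this equation once more (`killingYano_deriv`) and inserting the Ricci identity gives
linear relations between `∇∇Y`, `∇ξ` and the products of `Y` with the curvature. Eliminating the
first two leaves algebraic conditions on the curvature. In an orthonormal frame adapted to the
structure, `Y = α θ⁰∧θ¹ + β θ²∧θ³`, and the conditions are four complex equations `(α + iβ) z = 0`
(`frame_integrability`). As `Y` does not vanish, the four curvature combinations `z` are zero. They
involve only the Weyl tensor: they are the off-diagonal entries of its self-dual 3×3 matrix and the
difference of the last two diagonal ones. Being trace-free, that matrix is `diag(-2ρ, ρ, ρ)`, with
`𝒰` along the first axis. So `W(𝒰) = -2ρ 𝒰`, and `ρ = 0` would force `W = 0`.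

Derivatives are computed in coordinates, as identities between 4×4 matrices. Frames enter only at a
single point, through an invertible matrix `E`, and are never differentiated. -/

noncomputable section

namespace SpaceTime

open Matrix Filter Topology

section

/-! ### Smoothness and derivatives of matrix-valued functions -/

/-- Smoothness of all entries of a matrix-valued function at a point. -/
def SmoothMat (A : E4 → Mat4) (y : E4) : Prop := ∀ a b, ContDiffAt ℝ ∞ (fun z => A z a b) y

/-- The entrywise partial derivative of a matrix-valued function. -/
def mderiv (k : Fin 4) (A : E4 → Mat4) (x : E4) : Mat4 := fun a b => pderiv k (fun y => A y a b) x

/-- The connection matrices `(Γ_e)^m_a = Γ^m_{ea}`. -/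
def conn (G : E4 → Mat4) (e : Fin 4) (x : E4) : Mat4 := fun m a => christoffel G m e a x

/-- The matrix `∇_e F` of a field of bilinear forms. -/
def covF (G F : E4 → Mat4) (e : Fin 4) (x : E4) : Mat4 := fun a b => covForm G F x e a b

/-- The matrix `∇_e P` of a field of endomorphisms. -/
def covE (G P : E4 → Mat4) (e : Fin 4) (x : E4) : Mat4 := fun a b => covEnd G P x e a b

/-- The curvature matrices `(R_{ij})^l_k = R^l_{kij}`. -/
def curv (G : E4 → Mat4) (i j : Fin 4) (x : E4) : Mat4 := fun l k => riemannUp G l k i j x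

section Deriv

variable {f h : E4 → ℝ} {x : E4} {k : Fin 4}

lemma pderiv_add (hf : DifferentiableAt ℝ f x) (hh : DifferentiableAt ℝ h x) :
    pderiv k (fun y => f y + h y) x = pderiv k f x + pderiv k h x := by
  simp [pderiv, fderiv_fun_add hf hh]

lemma pderiv_sub (hf : DifferentiableAt ℝ f x) (hh : DifferentiableAt ℝ h x) :
    pderiv k (fun y => f y - h y) x = pderiv k f x - pderiv k h x := by
  simp [pderiv, fderiv_fun_sub hf hh]

lemma pderiv_neg : pderiv k (fun y => -f y) x = -pderiv k f x := by
  simp [pderiv, fderiv_fun_neg]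

lemma pderiv_const (c : ℝ) : pderiv k (fun _ => c) x = 0 := by
  simp [pderiv]

lemma pderiv_mul (hf : DifferentiableAt ℝ f x) (hh : DifferentiableAt ℝ h x) :
    pderiv k (fun y => f y * h y) x = pderiv k f x * h x + f x * pderiv k h x := by
  simp [pderiv, fderiv_fun_mul hf hh]; ring

lemma pderiv_sum {ι : Type*} {s : Finset ι} {F : ι → E4 → ℝ}
    (hF : ∀ i ∈ s, DifferentiableAt ℝ (F i) x) :
    pderiv k (fun y => ∑ i ∈ s, F i y) x = ∑ i ∈ s, pderiv k (F i) x := by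
  simp [pderiv, fderiv_fun_sum hF]

lemma pderiv_comp {u : ℝ → ℝ} {u' : ℝ} (hu : HasDerivAt u u' (f x))
    (hf : DifferentiableAt ℝ f x) :
    pderiv k (fun y => u (f y)) x = u' * pderiv k f x := by
  have := hu.comp_hasFDerivAt x hf.hasFDerivAt
  have h2 : fderiv ℝ (fun y => u (f y)) x = u' • fderiv ℝ f x := this.fderiv
  simp [pderiv, h2]

lemma pderiv_congr (hfh : f =ᶠ[𝓝 x] h) : pderiv k f x = pderiv k h x := by
  simp [pderiv, hfh.fderiv_eq]

lemma contDiffAt_pderiv (hf : ContDiffAt ℝ ∞ f x) : ContDiffAt ℝ ∞ (pderiv k f) x :=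
  (hf.fderiv_right (m := ∞) (by simp)).clm_apply contDiffAt_const

lemma pderiv_comm (hf : ContDiffAt ℝ ∞ f x) (i j : Fin 4) :
    pderiv i (pderiv j f) x = pderiv j (pderiv i f) x := by
  have hs : IsSymmSndFDerivAt ℝ f x := hf.isSymmSndFDerivAt (by
    simp only [minSmoothness_of_isRCLikeNormedField]; exact WithTop.coe_le_coe.2 le_top)
  have hd : DifferentiableAt ℝ (fderiv ℝ f) x :=
    (hf.fderiv_right (m := ∞) (by simp)).differentiableAt (by simp)
  have key : ∀ a b : Fin 4, pderiv a (pderiv b f) x =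
      fderiv ℝ (fderiv ℝ f) x (EuclideanSpace.single a 1) (EuclideanSpace.single b 1) := by
    intro a b
    unfold pderiv
    rw [fderiv_clm_apply hd (differentiableAt_const _)]
    simp
  rw [key, key]
  exact hs _ _

end Deriv

section MDeriv

variable {A B : E4 → Mat4} {x : E4}

lemma SmoothMat.diff (hA : SmoothMat A x) (a b : Fin 4) :
    DifferentiableAt ℝ (fun z => A z a b) x := (hA a b).differentiableAt (by simp)

lemma SmoothMat.mul (hA : SmoothMat A x) (hB : SmoothMat B x) :
    SmoothMat (fun z => A z * B z) x := by
  intro a b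
  simp only [Matrix.mul_apply]
  exact ContDiffAt.sum fun i _ => (hA a i).mul (hB i b)

lemma SmoothMat.sub (hA : SmoothMat A x) (hB : SmoothMat B x) :
    SmoothMat (fun z => A z - B z) x := fun a b => (hA a b).sub (hB a b)

lemma SmoothMat.add (hA : SmoothMat A x) (hB : SmoothMat B x) :
    SmoothMat (fun z => A z + B z) x := fun a b => (hA a b).add (hB a b)

lemma SmoothMat.smul {f : E4 → ℝ} (hf : ContDiffAt ℝ ∞ f x) (hB : SmoothMat B x) :
    SmoothMat (fun z => f z • B z) x := fun a b => hf.mul (hB a b)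

lemma SmoothMat.transpose (hA : SmoothMat A x) : SmoothMat (fun z => (A z)ᵀ) x :=
  fun a b => hA b a

lemma SmoothMat.mderiv (hA : SmoothMat A x) (k : Fin 4) : SmoothMat (mderiv k A) x :=
  fun a b => contDiffAt_pderiv (hA a b)

lemma SmoothMat.det (hA : SmoothMat A x) : ContDiffAt ℝ ∞ (fun z => (A z).det) x := by
  simp only [Matrix.det_apply, Units.smul_def, zsmul_eq_mul]
  exact ContDiffAt.sum fun σ _ => contDiffAt_const.mul (contDiffAt_prod fun i _ => hA _ _)

lemma SmoothMat.inv (hA : SmoothMat A x) (hdet : (A x).det ≠ 0) :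
    SmoothMat (fun z => (A z)⁻¹) x := by
  intro a b
  simp only [Matrix.inv_def, Matrix.smul_apply, smul_eq_mul, Ring.inverse_eq_inv,
    Matrix.adjugate_apply]
  refine (hA.det.inv hdet).mul (SmoothMat.det (A := fun z => (A z).updateRow b (Pi.single a 1)) ?_)
  intro c d
  by_cases hc : c = b
  · subst hc; simpa using contDiffAt_const
  · simpa [Matrix.updateRow_apply, hc] using hA c d

lemma mderiv_mul (hA : SmoothMat A x) (hB : SmoothMat B x) (k : Fin 4) :
    mderiv k (fun z => A z * B z) x = mderiv k A x * B x + A x * mderiv k B x := by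
  ext a b
  simp only [mderiv, Matrix.mul_apply, Matrix.add_apply]
  rw [pderiv_sum fun i _ => (hA.diff a i).fun_mul (hB.diff i b), ← Finset.sum_add_distrib]
  exact Finset.sum_congr rfl fun i _ => pderiv_mul (hA.diff a i) (hB.diff i b)

lemma mderiv_sub (hA : SmoothMat A x) (hB : SmoothMat B x) (k : Fin 4) :
    mderiv k (fun z => A z - B z) x = mderiv k A x - mderiv k B x := by
  ext a b
  exact pderiv_sub (hA.diff a b) (hB.diff a b)

lemma mderiv_add (hA : SmoothMat A x) (hB : SmoothMat B x) (k : Fin 4) :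
    mderiv k (fun z => A z + B z) x = mderiv k A x + mderiv k B x := by
  ext a b
  exact pderiv_add (hA.diff a b) (hB.diff a b)

lemma mderiv_smul {f : E4 → ℝ} (hf : ContDiffAt ℝ ∞ f x) (hB : SmoothMat B x) (k : Fin 4) :
    mderiv k (fun z => f z • B z) x = pderiv k f x • B x + f x • mderiv k B x := by
  ext a b
  exact pderiv_mul (hf.differentiableAt (by simp)) (hB.diff a b)

lemma mderiv_transpose (k : Fin 4) : mderiv k (fun z => (A z)ᵀ) x = (mderiv k A x)ᵀ := rfl

lemma mderiv_const (C : Mat4) (k : Fin 4) : mderiv k (fun _ => C) x = 0 := by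
  ext a b; exact pderiv_const _

lemma mderiv_congr (h : A =ᶠ[𝓝 x] B) (k : Fin 4) : mderiv k A x = mderiv k B x := by
  ext a b
  exact pderiv_congr (h.mono fun y hy => by simp [hy])

lemma mderiv_comm (hA : SmoothMat A x) (i j : Fin 4) :
    mderiv i (mderiv j A) x = mderiv j (mderiv i A) x := by
  ext a b
  exact pderiv_comm (hA a b) i j

end MDeriv

/-! ### Covariant derivatives -/

section Cov

variable {G : E4 → Mat4} {x : E4}

/-- With the connection written as matrices, as here and in `covE_eq` and `curv_eq`, Leibniz rules
and the Ricci identity become identities in a noncommutative ring. -/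
lemma covF_eq (F : E4 → Mat4) (e : Fin 4) :
    covF G F e x = mderiv e F x - (conn G e x)ᵀ * F x - F x * conn G e x := by
  ext a b
  simp only [covF, covForm, Finset.sum_add_distrib, Matrix.sub_apply, Matrix.mul_apply, mderiv,
    Matrix.transpose_apply, conn, mul_comm (F x a _)]
  ring

lemma covE_eq (P : E4 → Mat4) (e : Fin 4) :
    covE G P e x = mderiv e P x + conn G e x * P x - P x * conn G e x := by
  ext a b
  simp only [covE, covEnd, Finset.sum_sub_distrib, Matrix.sub_apply, Matrix.add_apply,
    Matrix.mul_apply, mderiv, conn, mul_comm (P x a _)]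
  ring

lemma covF_congr {A B : E4 → Mat4} (h : A =ᶠ[𝓝 x] B) (e : Fin 4) :
    covF G A e x = covF G B e x := by
  rw [covF_eq, covF_eq, mderiv_congr h, h.eq_of_nhds]

lemma covE_congr {A B : E4 → Mat4} (h : A =ᶠ[𝓝 x] B) (e : Fin 4) :
    covE G A e x = covE G B e x := by
  rw [covE_eq, covE_eq, mderiv_congr h, h.eq_of_nhds]

lemma covF_mul {F P : E4 → Mat4} (hF : SmoothMat F x) (hP : SmoothMat P x) (e : Fin 4) :
    covF G (fun z => F z * P z) e x = covF G F e x * P x + F x * covE G P e x := by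
  rw [covF_eq, covF_eq, covE_eq, mderiv_mul hF hP]
  noncomm_ring

lemma covE_mul {F P : E4 → Mat4} (hF : SmoothMat F x) (hP : SmoothMat P x) (e : Fin 4) :
    covE G (fun z => F z * P z) e x = covE G F e x * P x + F x * covE G P e x := by
  rw [covE_eq, covE_eq, covE_eq, mderiv_mul hF hP]
  noncomm_ring

lemma covE_sub {F P : E4 → Mat4} (hF : SmoothMat F x) (hP : SmoothMat P x) (e : Fin 4) :
    covE G (fun z => F z - P z) e x = covE G F e x - covE G P e x := by
  rw [covE_eq, covE_eq, covE_eq, mderiv_sub hF hP]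
  noncomm_ring

lemma covE_const_one (e : Fin 4) : covE G (fun _ => 1) e x = 0 := by
  rw [covE_eq, mderiv_const]; simp

lemma covE_zero (e : Fin 4) : covE G (fun _ => 0) e x = 0 := by
  rw [covE_eq, mderiv_const]; simp

lemma covF_add {A B : E4 → Mat4} (hA : SmoothMat A x) (hB : SmoothMat B x) (e : Fin 4) :
    covF G (fun z => A z + B z) e x = covF G A e x + covF G B e x := by
  rw [covF_eq, covF_eq, covF_eq, mderiv_add hA hB]
  noncomm_ring

lemma covF_sub {A B : E4 → Mat4} (hA : SmoothMat A x) (hB : SmoothMat B x) (e : Fin 4) :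
    covF G (fun z => A z - B z) e x = covF G A e x - covF G B e x := by
  rw [covF_eq, covF_eq, covF_eq, mderiv_sub hA hB]
  noncomm_ring

lemma covF_smul {f : E4 → ℝ} {B : E4 → Mat4} (hf : ContDiffAt ℝ ∞ f x) (hB : SmoothMat B x)
    (e : Fin 4) :
    covF G (fun z => f z • B z) e x = pderiv e f x • B x + f x • covF G B e x := by
  rw [covF_eq, covF_eq, mderiv_smul hf hB]
  simp only [Matrix.mul_smul, Matrix.smul_mul, smul_sub]
  abel

lemma covF_antisymm {F : E4 → Mat4} (hF : ∀ᶠ y in 𝓝 x, (F y)ᵀ = -F y) (e : Fin 4) :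
    (covF G F e x)ᵀ = -covF G F e x := by
  have h1 : (mderiv e F x)ᵀ = -mderiv e F x := by
    rw [← mderiv_transpose, mderiv_congr hF]
    ext a b
    exact pderiv_neg
  rw [covF_eq]
  simp only [Matrix.transpose_sub, Matrix.transpose_mul, Matrix.transpose_transpose, h1,
    hF.self_of_nhds]
  noncomm_ring

lemma smoothMat_conn (hG : SmoothMat G x) (hdet : (G x).det ≠ 0) (e : Fin 4) :
    SmoothMat (conn G e) x := by
  intro m a
  unfold conn christoffel
  refine contDiffAt_const.mul (ContDiffAt.sum fun l _ => (hG.inv hdet m l).mul ?_)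
  exact ((contDiffAt_pderiv (hG a l)).add (contDiffAt_pderiv (hG e l))).sub
    (contDiffAt_pderiv (hG e a))

lemma smoothMat_covF {F : E4 → Mat4} (hG : SmoothMat G x) (hdet : (G x).det ≠ 0)
    (hF : SmoothMat F x) (e : Fin 4) : SmoothMat (covF G F e) x := by
  have : covF G F e = fun y => mderiv e F y - (conn G e y)ᵀ * F y - F y * conn G e y := by
    funext y; exact covF_eq F e
  rw [this]
  have hc := smoothMat_conn hG hdet e
  exact ((hF.mderiv e).sub (hc.transpose.mul hF)).sub (hF.mul hc)

lemma mderiv_symm (hs : ∀ᶠ y in 𝓝 x, (G y)ᵀ = G y) (e a b : Fin 4) :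
    pderiv e (fun y => G y a b) x = pderiv e (fun y => G y b a) x :=
  pderiv_congr (hs.mono fun y hy => by
    have := congrFun (congrFun hy b) a
    simpa using this)

/-- Lowering the upper index cancels the inverse metric and leaves the Christoffel symbols of the
first kind. -/
lemma metric_mul_conn (hdet : (G x).det ≠ 0) (e a b : Fin 4) :
    (G x * conn G e x) a b = (1 / 2) * (pderiv e (fun y => G y b a) x
      + pderiv b (fun y => G y e a) x - pderiv a (fun y => G y e b) x) := by
  have hinv : G x * (G x)⁻¹ = 1 := Matrix.mul_nonsing_inv _ (isUnit_iff_ne_zero.mpr hdet)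
  set v : Fin 4 → ℝ := fun l => pderiv e (fun y => G y b l) x
      + pderiv b (fun y => G y e l) x - pderiv l (fun y => G y e b) x with hv
  have : (G x * conn G e x) a b = (1 / 2) * ((G x * (G x)⁻¹) *ᵥ v) a := by
    rw [← Matrix.mulVec_mulVec]
    simp only [Matrix.mul_apply, conn, christoffel, Matrix.mulVec, dotProduct, Finset.mul_sum, hv]
    refine Finset.sum_congr rfl fun i _ => Finset.sum_congr rfl fun j _ => ?_
    ring
  rw [this, hinv, Matrix.one_mulVec]

lemma covF_metric (hs : ∀ᶠ y in 𝓝 x, (G y)ᵀ = G y) (hdet : (G x).det ≠ 0) (e : Fin 4) :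
    covF G G e x = 0 := by
  have h : (conn G e x)ᵀ * G x = (G x * conn G e x)ᵀ := by
    rw [Matrix.transpose_mul, hs.self_of_nhds]
  rw [covF_eq, h]
  ext a b
  simp only [Matrix.sub_apply, Matrix.transpose_apply, metric_mul_conn hdet, mderiv,
    Matrix.zero_apply]
  rw [mderiv_symm hs e b a]
  ring

lemma christoffel_symm (hs : ∀ᶠ y in 𝓝 x, (G y)ᵀ = G y) (m i j : Fin 4) :
    christoffel G m i j x = christoffel G m j i x := by
  unfold christoffel
  congr 1
  refine Finset.sum_congr rfl fun l _ => ?_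
  rw [mderiv_symm hs l i j]
  ring

/-! ### Second covariant derivatives and the Ricci identity -/

/-- The second covariant derivative `∇_d ∇_a F`. -/
def covF2 (G F : E4 → Mat4) (d a : Fin 4) (x : E4) : Mat4 :=
  covF G (covF G F a) d x - ∑ m, christoffel G m d a x • covF G F m x

lemma curv_eq (i j : Fin 4) :
    curv G i j x = mderiv i (conn G j) x - mderiv j (conn G i) x
      + conn G i x * conn G j x - conn G j x * conn G i x := by
  ext l k
  simp only [curv, riemannUp, mderiv, conn, Matrix.sub_apply, Matrix.add_apply, Matrix.mul_apply,
    Finset.sum_sub_distrib]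
  ring

/-- Second partial derivatives commute, and the `Γ^m_{da}` corrections agree because the connection
is torsion-free. What survives is `dΓ + Γ∧Γ`, acting once on each index of `F`. -/
lemma ricci_identity (hG : SmoothMat G x) (hdet : (G x).det ≠ 0)
    (hs : ∀ᶠ y in 𝓝 x, (G y)ᵀ = G y) {F : E4 → Mat4} (hF : SmoothMat F x) (d a : Fin 4) :
    covF2 G F d a x - covF2 G F a d x = -((curv G d a x)ᵀ * F x) - F x * curv G d a x := by
  have hsum : ∑ m, christoffel G m d a x • covF G F m x
      = ∑ m, christoffel G m a d x • covF G F m x :=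
    Finset.sum_congr rfl fun m _ => by rw [christoffel_symm hs]
  have hc := fun e => smoothMat_conn hG hdet e
  have key : ∀ d a : Fin 4, mderiv d (covF G F a) x = mderiv d (mderiv a F) x
      - ((mderiv d (conn G a) x)ᵀ * F x + (conn G a x)ᵀ * mderiv d F x)
      - (mderiv d F x * conn G a x + F x * mderiv d (conn G a) x) := by
    intro d a
    have : covF G F a = fun y => mderiv a F y - (conn G a y)ᵀ * F y - F y * conn G a y := by
      funext y; exact covF_eq F a
    rw [this, mderiv_sub ((hF.mderiv a).sub ((hc a).transpose.mul hF)) (hF.mul (hc a)),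
      mderiv_sub (hF.mderiv a) ((hc a).transpose.mul hF), mderiv_mul (hc a).transpose hF,
      mderiv_mul hF (hc a), mderiv_transpose]
  rw [covF2, covF2, hsum, covF_eq (covF G F a), covF_eq (covF G F d), key, key, covF_eq F a,
    covF_eq F d, curv_eq, mderiv_comm hF d a]
  simp only [Matrix.transpose_add, Matrix.transpose_sub, Matrix.transpose_mul]
  noncomm_ring

lemma covF2_antisymm {F : E4 → Mat4} (hF : ∀ᶠ y in 𝓝 x, (F y)ᵀ = -F y) (d a : Fin 4) :
    (covF2 G F d a x)ᵀ = -covF2 G F d a x := by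
  have h1 : ∀ᶠ y in 𝓝 x, (covF G F a y)ᵀ = -covF G F a y :=
    hF.eventually_nhds.mono fun y hy => covF_antisymm hy a
  rw [covF2, Matrix.transpose_sub, covF_antisymm h1, Matrix.transpose_sum]
  simp only [Matrix.transpose_smul, covF_antisymm hF, smul_neg, Finset.sum_neg_distrib]
  abel

/-! ### Symmetries of the Riemann tensor -/

lemma riemann_eq (a b c d : Fin 4) : riemann G x a b c d = (G x * curv G c d x) a b := rfl

lemma riemann_antisymm_right (a b c d : Fin 4) :
    riemann G x a b c d = -riemann G x a b d c := by
  rw [riemann_eq, riemann_eq, ← Matrix.neg_apply, ← Matrix.mul_neg]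
  have h : curv G c d x = -curv G d c x := by
    rw [curv_eq, curv_eq]
    abel
  rw [h]

/-- This is the Ricci identity applied to the metric itself: `∇g` vanishes on a neighbourhood, so
both second derivatives vanish and the curvature acts trivially on `g`. -/
lemma riemann_antisymm_left (hG : SmoothMat G x)
    (hs : ∀ᶠ y in 𝓝 x, (G y)ᵀ = G y) (hdet : ∀ᶠ y in 𝓝 x, (G y).det ≠ 0) (a b c d : Fin 4) :
    riemann G x a b c d = -riemann G x b a c d := by
  have h0 : ∀ e, covF G G e =ᶠ[𝓝 x] fun _ => 0 := fun e =>
    (hs.eventually_nhds.and hdet).mono fun y hy => covF_metric hy.1 hy.2 e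
  have h2 : ∀ d a, covF2 G G d a x = 0 := by
    intro d a
    rw [covF2, covF_congr (h0 a)]
    simp [(h0 _).eq_of_nhds, covF_eq, mderiv_const]
  have h := ricci_identity hG hdet.self_of_nhds hs hG c d
  rw [h2, h2, sub_zero] at h
  have h3 : (curv G c d x)ᵀ * G x = (G x * curv G c d x)ᵀ := by
    rw [Matrix.transpose_mul, hs.self_of_nhds]
  rw [h3] at h
  have h4 := congrFun (congrFun h a) b
  simp only [Matrix.sub_apply, Matrix.neg_apply, Matrix.transpose_apply, Matrix.zero_apply] at h4
  rw [riemann_eq, riemann_eq]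
  linarith

/-- By symmetry of `Γ` in its lower indices, derivative terms and quadratic terms each cancel in the
cyclic sum, already before the first index is lowered. -/
lemma riemann_bianchi (hs : ∀ᶠ y in 𝓝 x, (G y)ᵀ = G y) (a b c d : Fin 4) :
    riemann G x a b c d + riemann G x a c d b + riemann G x a d b c = 0 := by
  have h : ∀ l i j k, pderiv k (christoffel G l i j) x = pderiv k (christoffel G l j i) x :=
    fun l i j k => pderiv_congr (hs.eventually_nhds.mono fun y hy => christoffel_symm hy l i j)
  simp only [riemann, ← Finset.sum_add_distrib, ← mul_add]
  refine Finset.sum_eq_zero fun l _ => ?_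
  have : riemannUp G l b c d x + riemannUp G l c d b x + riemannUp G l d b c x = 0 := by
    simp only [riemannUp, Finset.sum_sub_distrib]
    rw [h l d b, h l d c b, h l b c d]
    have e1 : ∀ m, christoffel G m d b x = christoffel G m b d x :=
      fun m => christoffel_symm hs m d b
    have e2 : ∀ m, christoffel G m d c x = christoffel G m c d x :=
      fun m => christoffel_symm hs m d c
    have e3 : ∀ m, christoffel G m c b x = christoffel G m b c x :=
      fun m => christoffel_symm hs m c b
    simp only [e1, e2, e3]
    ring
  rw [this, mul_zero]

end Cov

end

section

/-! ### Differentiating the conformal Killing-Yano equation -/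

/-- The covariant derivative `∇_d T_{abc}` of a field of covariant 3-tensors. -/
def cov3 (G : E4 → Mat4) (T : Fin 4 → Fin 4 → Fin 4 → E4 → ℝ) (x : E4) (d a b c : Fin 4) : ℝ :=
  pderiv d (T a b c) x - ∑ m, christoffel G m d a x * T m b c x
    - ∑ m, christoffel G m d b x * T a m c x - ∑ m, christoffel G m d c x * T a b m x

/-- The covariant derivative `∇_d ξ_c` of a field of covectors. -/
def cov1 (G : E4 → Mat4) (ξ : Fin 4 → E4 → ℝ) (x : E4) (d c : Fin 4) : ℝ :=
  pderiv d (ξ c) x - ∑ m, christoffel G m d c x * ξ m x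

/-- The conformal Killing-Yano equation at a point, with associated covector `ξ`. -/
def KillingYanoAt (G Y : E4 → Mat4) (ξ : Fin 4 → E4 → ℝ) (y : E4) : Prop :=
  ∀ a b c, covF G Y a y b c + covF G Y b y a c =
    2 * G y a b * ξ c y - G y a c * ξ b y - G y b c * ξ a y

variable {G : E4 → Mat4} {x : E4}

lemma cov3_swap (T : Fin 4 → Fin 4 → Fin 4 → E4 → ℝ) (d a b c : Fin 4) :
    cov3 G (fun i j k => T j i k) x d a b c = cov3 G T x d b a c := by
  unfold cov3; ring

lemma cov3_covF (F : E4 → Mat4) (d a b c : Fin 4) :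
    cov3 G (fun i j k y => covF G F i y j k) x d a b c = covF2 G F d a x b c := by
  simp only [cov3, covF2, covF_eq (covF G F a), Matrix.sub_apply, Matrix.mul_apply,
    Matrix.transpose_apply, Matrix.sum_apply, Matrix.smul_apply, mderiv, conn, smul_eq_mul,
    mul_comm (covF G F a x b _)]
  ring

lemma cov3_metric_mul (hG : SmoothMat G x) (hdet : (G x).det ≠ 0)
    (hs : ∀ᶠ y in 𝓝 x, (G y)ᵀ = G y) {ξ : Fin 4 → E4 → ℝ}
    (hξ : ∀ c, DifferentiableAt ℝ (ξ c) x) (d a b c : Fin 4) :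
    cov3 G (fun i j k y => G y i j * ξ k y) x d a b c = G x a b * cov1 G ξ x d c := by
  have h := congrFun (congrFun (covF_metric hs hdet d) a) b
  simp only [covF, covForm, Matrix.zero_apply, Finset.sum_add_distrib] at h
  simp only [cov3, cov1]
  rw [pderiv_mul (hG.diff a b) (hξ c)]
  simp only [← mul_assoc, ← Finset.sum_mul]
  have e : ∑ m, christoffel G m d c x * G x a b * ξ m x
      = G x a b * ∑ m, christoffel G m d c x * ξ m x := by
    rw [Finset.mul_sum]
    exact Finset.sum_congr rfl fun m _ => by ring
  rw [e]
  linear_combination ξ c x * h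

lemma cov3_add {S T : Fin 4 → Fin 4 → Fin 4 → E4 → ℝ}
    (hS : ∀ a b c, DifferentiableAt ℝ (S a b c) x) (hT : ∀ a b c, DifferentiableAt ℝ (T a b c) x)
    (d a b c : Fin 4) :
    cov3 G (fun i j k y => S i j k y + T i j k y) x d a b c
      = cov3 G S x d a b c + cov3 G T x d a b c := by
  simp only [cov3]
  rw [pderiv_add (hS a b c) (hT a b c)]
  simp only [mul_add, Finset.sum_add_distrib]
  ring

lemma cov3_sub {S T : Fin 4 → Fin 4 → Fin 4 → E4 → ℝ}
    (hS : ∀ a b c, DifferentiableAt ℝ (S a b c) x) (hT : ∀ a b c, DifferentiableAt ℝ (T a b c) x)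
    (d a b c : Fin 4) :
    cov3 G (fun i j k y => S i j k y - T i j k y) x d a b c
      = cov3 G S x d a b c - cov3 G T x d a b c := by
  simp only [cov3]
  rw [pderiv_sub (hS a b c) (hT a b c)]
  simp only [mul_sub, Finset.sum_sub_distrib]
  ring

lemma cov3_congr {S T : Fin 4 → Fin 4 → Fin 4 → E4 → ℝ}
    (h : ∀ᶠ y in 𝓝 x, ∀ a b c, S a b c y = T a b c y) (d a b c : Fin 4) :
    cov3 G S x d a b c = cov3 G T x d a b c := by
  have h1 : pderiv d (S a b c) x = pderiv d (T a b c) x :=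
    pderiv_congr (h.mono fun y hy => hy a b c)
  simp only [cov3, h1, h.self_of_nhds]

/-- The Killing-Yano equation is an identity of 3-tensors near `x`, so it may be differentiated
covariantly; since `∇g = 0`, the derivative falls only on `ξ`. -/
lemma killingYano_deriv (hG : SmoothMat G x) (hdet : (G x).det ≠ 0)
    (hs : ∀ᶠ y in 𝓝 x, (G y)ᵀ = G y) {Y : E4 → Mat4} (hY : SmoothMat Y x)
    {ξ : Fin 4 → E4 → ℝ} (hξ : ∀ c, DifferentiableAt ℝ (ξ c) x)
    (hK : ∀ᶠ y in 𝓝 x, KillingYanoAt G Y ξ y) (d a b c : Fin 4) :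
    covF2 G Y d a x b c + covF2 G Y d b x a c =
      2 * G x a b * cov1 G ξ x d c - G x a c * cov1 G ξ x d b - G x b c * cov1 G ξ x d a := by
  have hS : ∀ a b c, DifferentiableAt ℝ (fun y => covF G Y a y b c) x := fun a b c =>
    (smoothMat_covF hG hdet hY a).diff b c
  have hg : ∀ a b c, DifferentiableAt ℝ (fun y => G y a b * ξ c y) x := fun a b c =>
    (hG.diff a b).mul (hξ c)
  have h := cov3_congr (G := G) (x := x)
    (S := fun i j k y => covF G Y i y j k + covF G Y j y i k)
    -- The factor `2` is written as a sum so that additivity of `cov3` suffices.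
    (T := fun i j k y => (G y i j * ξ k y + G y i j * ξ k y) - G y i k * ξ j y - G y j k * ξ i y)
    (hK.mono fun y hy a b c => by rw [hy a b c]; ring) d a b c
  rw [cov3_add hS (fun a b c => hS b a c),
    cov3_swap (fun i j k y => covF G Y i y j k), cov3_covF, cov3_covF,
    cov3_sub (fun a b c => ((hg a b c).fun_add (hg a b c)).fun_sub (hg a c b)) (fun a b c => hg b c a),
    cov3_sub (fun a b c => (hg a b c).fun_add (hg a b c)) (fun a b c => hg a c b),
    cov3_add hg hg, cov3_metric_mul hG hdet hs hξ] at h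
  have e1 : cov3 G (fun i j k y => G y i k * ξ j y) x d a b c = G x a c * cov1 G ξ x d b := by
    rw [← cov3_metric_mul hG hdet hs hξ]; simp only [cov3]; ring
  have e2 : cov3 G (fun i j k y => G y j k * ξ i y) x d a b c = G x b c * cov1 G ξ x d a := by
    rw [← cov3_metric_mul hG hdet hs hξ]; simp only [cov3]; ring
  rw [e1, e2] at h
  rw [h]; ring

end

/-! ### Linear algebra in an adapted orthonormal frame -/

/-- The Minkowski metric. -/
def minkowski : Mat4 := Matrix.diagonal ![-1, 1, 1, 1]

/-- The orthogonal projector on the time-like coordinate plane. -/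
def planeProj : Mat4 := Matrix.diagonal ![1, 1, 0, 0]

/-- The 2-form `α θ⁰ ∧ θ¹ + β θ² ∧ θ³`. -/
def adaptedForm (α β : ℝ) : Mat4 := !![0, α, 0, 0; -α, 0, 0, 0; 0, 0, 0, β; 0, 0, -β, 0]

/-- The conformal Killing-Yano condition for the components of `∇Y` in an orthonormal frame. -/
def FrameKillingYano (S : Fin 4 → Mat4) : Prop :=
  ∀ a b c, S a b c + S b a c =
    2 * minkowski a b * ((1 / 3) * ∑ m, minkowski m m * S m m c)
      - minkowski a c * ((1 / 3) * ∑ m, minkowski m m * S m m b)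
      - minkowski b c * ((1 / 3) * ∑ m, minkowski m m * S m m a)

/-- The umbilicity condition for the components of `∇P` in an orthonormal frame adapted to `P`. -/
def FrameUmbilical (P : Mat4) (Q : Fin 4 → Mat4) : Prop :=
  ∀ i j c, (1 / 2) * ((1 - P) c c * P i i * Q i c j + (1 - P) c c * P j j * Q j c i) =
    (1 / 2) * (minkowski * P) i j * ∑ m, minkowski m m * ((1 - P) c c * P m m * Q m c m)

lemma mul_minkowski_mul (A B : Mat4) (a b : Fin 4) : (A * minkowski * B) a b =
    -(A a 0 * B 0 b) + A a 1 * B 1 b + A a 2 * B 2 b + A a 3 * B 3 b := by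
  simp only [Matrix.mul_apply, Fin.sum_univ_four, minkowski, Matrix.diagonal_apply]
  simp

/-- The 2-forms with given components. -/
def twoForm (u p q r s v : ℝ) : Mat4 :=
  !![0, u, p, q; -u, 0, r, s; -p, -r, 0, v; -q, -s, -v, 0]

lemma adaptedForm_eq (α β : ℝ) : adaptedForm α β = twoForm α 0 0 0 0 β := by
  simp [adaptedForm, twoForm]

lemma eq_twoForm {T : Mat4} (hT : Tᵀ = -T) :
    T = twoForm (T 0 1) (T 0 2) (T 0 3) (T 1 2) (T 1 3) (T 2 3) := by
  have T' : ∀ a b, T b a = -T a b := fun a b => congrFun (congrFun hT a) b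
  have T0 : ∀ a, T a a = 0 := fun a => by linarith [T' a a]
  ext a b
  fin_cases a <;> fin_cases b <;>
    simp [twoForm, T0, T' 0 1, T' 0 2, T' 0 3, T' 1 2, T' 1 3, T' 2 3]

/-- Here `T`, `W`, `Q` stand for `∇_i U`, `∇_i *U`, `∇_i P` at a fixed `i`, and the hypotheses are
the derivatives of `U² = P`, `U *U = 0`, `(*U)² = P - 1`. Within the two planes nothing can vary, so
the four mixed components `p, q, r, s` of `∇_i U` carry all the information. -/
lemma eq_mixedForm {σ : ℝ} (hσ : σ ^ 2 = 1) {T W Q : Mat4} (hT : Tᵀ = -T) (hW : Wᵀ = -W)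
    (h1 : T * minkowski * adaptedForm σ 0 + adaptedForm σ 0 * minkowski * T = minkowski * Q)
    (h2 : T * minkowski * adaptedForm 0 (-σ) + adaptedForm σ 0 * minkowski * W = 0)
    (h3 : W * minkowski * adaptedForm 0 (-σ) + adaptedForm 0 (-σ) * minkowski * W
      = minkowski * Q) :
    ∃ p q r s : ℝ, T = twoForm 0 p q r s 0 ∧ W = twoForm 0 (-s) r (-q) p 0 ∧
      Q 0 2 = -(σ * r) ∧ Q 0 3 = -(σ * s) ∧ Q 1 2 = σ * p ∧ Q 1 3 = σ * q ∧
      Q 2 0 = σ * r ∧ Q 2 1 = σ * p ∧ Q 3 0 = σ * s ∧ Q 3 1 = σ * q := by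
  have hσ0 : σ ≠ 0 := by rintro rfl; norm_num at hσ
  have eT := eq_twoForm hT
  have eW := eq_twoForm hW
  generalize T 0 1 = t1 at eT; generalize T 0 2 = t2 at eT; generalize T 0 3 = t3 at eT
  generalize T 1 2 = t4 at eT; generalize T 1 3 = t5 at eT; generalize T 2 3 = t6 at eT
  generalize W 0 1 = w1 at eW; generalize W 0 2 = w2 at eW; generalize W 0 3 = w3 at eW
  generalize W 1 2 = w4 at eW; generalize W 1 3 = w5 at eW; generalize W 2 3 = w6 at eW
  have hQ : ∀ a b, (minkowski * Q) a b = (if a = 0 then -1 else 1) * Q a b := by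
    intro a b
    fin_cases a <;> simp [minkowski]
  have E1 := fun a b => congrFun (congrFun h1 a) b
  have E2 := fun a b => congrFun (congrFun h2 a) b
  have E3 := fun a b => congrFun (congrFun h3 a) b
  simp only [Matrix.add_apply, mul_minkowski_mul, Matrix.zero_apply, adaptedForm_eq, hQ, eT, eW]
    at E1 E2 E3
  clear h1 h2 h3 hT hW hQ
  have a1 := E2 2 2
  have a2 := E2 0 0
  have a3 := E2 0 2
  have a4 := E2 0 3
  have a5 := E2 1 2
  have a6 := E2 1 3
  have b1 := E1 0 0
  have b2 := E3 0 0
  have b3 := E1 2 2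
  have b4 := E3 2 2
  have c1 := E1 0 2
  have c2 := E1 0 3
  have c3 := E1 1 2
  have c4 := E1 1 3
  have c5 := E1 2 0
  have c6 := E1 2 1
  have c7 := E1 3 0
  have c8 := E1 3 1
  clear E1 E2 E3
  simp [twoForm, hσ0] at a1 a2 a3 a4 a5 a6 b1 b2 b3 b4 c1 c2 c3 c4 c5 c6 c7 c8
  have t1 : t1 = 0 := mul_left_cancel₀ hσ0 (by linarith)
  have w6 : w6 = 0 := mul_left_cancel₀ hσ0 (by linarith)
  have w2 : w2 = -t5 := mul_left_cancel₀ hσ0 (by linarith)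
  have w3 : w3 = t4 := mul_left_cancel₀ hσ0 (by linarith)
  have w4 : w4 = -t3 := mul_left_cancel₀ hσ0 (by linarith)
  have w5 : w5 = t2 := mul_left_cancel₀ hσ0 (by linarith)
  refine ⟨t2, t3, t4, t5, ?_, ?_, ?_, ?_, ?_, ?_, ?_, ?_, ?_, ?_⟩
  · rw [eT, t1, a1]
  · rw [eW, a2, w2, w3, w4, w5, w6]
  all_goals linarith

/-- Here `u, v` are the components in the two planes and `p, q, r, s` the mixed ones, each indexed
by the direction of derivation. `h1`-`h8` involve the mixed components only and will come from
umbilicity; the equations for `u` and `v` will come from Maxwell's equations. -/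
lemma frameKillingYano_twoForm {u p q r s v : Fin 4 → ℝ}
    (h1 : r 0 = -p 1) (h2 : s 0 = -q 1) (h3 : p 0 = -r 1) (h4 : q 0 = -s 1) (h5 : r 2 = s 3)
    (h6 : p 2 = q 3) (h7 : s 2 = -r 3) (h8 : q 2 = -p 3)
    (hu0 : u 0 = s 3) (hu1 : u 1 = q 3) (hu2 : u 2 = -p 1) (hu3 : u 3 = -q 1)
    (hv0 : v 0 = p 3) (hv1 : v 1 = r 3) (hv2 : v 2 = s 1) (hv3 : v 3 = -r 1) :
    FrameKillingYano (fun i => twoForm (u i) (p i) (q i) (r i) (s i) (v i)) := by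
  set S : Fin 4 → Mat4 := fun i => twoForm (u i) (p i) (q i) (r i) (s i) (v i) with hS
  have f00 : ∀ i, S i 0 0 = 0 := fun i => rfl
  have f11 : ∀ i, S i 1 1 = 0 := fun i => rfl
  have f22 : ∀ i, S i 2 2 = 0 := fun i => rfl
  have f33 : ∀ i, S i 3 3 = 0 := fun i => rfl
  have f01 : ∀ i, S i 0 1 = u i := fun i => rfl
  have f02 : ∀ i, S i 0 2 = p i := fun i => rfl
  have f03 : ∀ i, S i 0 3 = q i := fun i => rfl
  have f12 : ∀ i, S i 1 2 = r i := fun i => rfl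
  have f13 : ∀ i, S i 1 3 = s i := fun i => rfl
  have f23 : ∀ i, S i 2 3 = v i := fun i => rfl
  have f10 : ∀ i, S i 1 0 = -u i := fun i => rfl
  have f20 : ∀ i, S i 2 0 = -p i := fun i => rfl
  have f30 : ∀ i, S i 3 0 = -q i := fun i => rfl
  have f21 : ∀ i, S i 2 1 = -r i := fun i => rfl
  have f31 : ∀ i, S i 3 1 = -s i := fun i => rfl
  have f32 : ∀ i, S i 3 2 = -v i := fun i => rfl
  clear_value S
  intro a b c
  fin_cases a <;> fin_cases b <;> fin_cases c <;>
  simp [minkowski, Fin.sum_univ_four, f00, f11, f22, f33, f01, f02, f03, f12, f13, f23, f10, f20,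
    f30, f21, f31, f32, h1, h2, h3, h4, h5, h6, h7, h8, hu0, hu1, hu2, hu3, hv0, hv1, hv2, hv3]
  all_goals ring

/-- The two conclusions are the Killing-Yano conditions for the two terms, proportional to `e^{-φ/2}
cos (ψ/2)` and to `-e^{-φ/2} sin (ψ/2)`, into which `∇Y` splits. The weight `-1/2` is forced: with
umbilicity, each Maxwell equation says that twice a mixed component equals, up to sign, `σ` times a
derivative of `φ` or `ψ`, whereas the Killing-Yano condition compares that component with the
coefficient of `U` or `*U` itself. -/
lemma frame_killingYano {σ : ℝ} (hσ : σ ^ 2 = 1) {T W Q : Fin 4 → Mat4} {φ ψ : Fin 4 → ℝ}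
    (hT : ∀ i, (T i)ᵀ = -T i) (hW : ∀ i, (W i)ᵀ = -W i)
    (h1 : ∀ i, T i * minkowski * adaptedForm σ 0 + adaptedForm σ 0 * minkowski * T i
      = minkowski * Q i)
    (h2 : ∀ i, T i * minkowski * adaptedForm 0 (-σ) + adaptedForm σ 0 * minkowski * W i = 0)
    (h3 : ∀ i, W i * minkowski * adaptedForm 0 (-σ) + adaptedForm 0 (-σ) * minkowski * W i
      = minkowski * Q i)
    (hu : FrameUmbilical planeProj Q) (hu' : FrameUmbilical (1 - planeProj) (fun i => -Q i))
    (hm : ∀ b, ∑ a, minkowski a a * (T a + φ a • adaptedForm σ 0 + ψ a • adaptedForm 0 (-σ)) a b = 0)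
    (hm' : ∀ b, ∑ a, minkowski a a * (W a + φ a • adaptedForm 0 (-σ) - ψ a • adaptedForm σ 0) a b = 0) :
    FrameKillingYano (fun i => T i - (φ i / 2) • adaptedForm σ 0 - (ψ i / 2) • adaptedForm 0 (-σ)) ∧
    FrameKillingYano (fun i => W i - (φ i / 2) • adaptedForm 0 (-σ) + (ψ i / 2) • adaptedForm σ 0) := by
  choose p q r s eT eW q02 q03 q12 q13 q20 q21 q30 q31 using
    fun i => eq_mixedForm hσ (hT i) (hW i) (h1 i) (h2 i) (h3 i)
  have hσ0 : σ ≠ 0 := by rintro rfl; norm_num at hσ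
  clear h1 h2 h3 hT hW
  -- Trace-freeness in `V` and in `H` is tested on a diagonal and an off-diagonal pair, for each of
  -- the two normal directions.
  have u1 := hu 0 0 2
  have u2 := hu 0 0 3
  have u3 := hu 0 1 2
  have u4 := hu 0 1 3
  have u5 := hu' 2 2 0
  have u6 := hu' 2 2 1
  have u7 := hu' 2 3 0
  have u8 := hu' 2 3 1
  clear hu hu'
  simp [q02, q03, q12, q13, q20, q21, q30, q31, planeProj, minkowski, Fin.sum_univ_four, hσ0]
    at u1 u2 u3 u4 u5 u6 u7 u8
  simp only [adaptedForm_eq, Fin.sum_univ_four, eT, eW] at hm hm' ⊢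
  have m0 := hm 0
  have m1 := hm 1
  have m2 := hm 2
  have m3 := hm 3
  have n0 := hm' 0
  have n1 := hm' 1
  have n2 := hm' 2
  have n3 := hm' 3
  clear hm hm' q02 q03 q12 q13 q20 q21 q30 q31
  simp [twoForm, minkowski] at m0 m1 m2 m3 n0 n1 n2 n3
  have v1 : r 0 = -p 1 := mul_left_cancel₀ hσ0 (by linarith)
  have v2 : s 0 = -q 1 := mul_left_cancel₀ hσ0 (by linarith)
  have v3 : p 0 = -r 1 := mul_left_cancel₀ hσ0 (by linarith)
  have v4 : q 0 = -s 1 := mul_left_cancel₀ hσ0 (by linarith)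
  have v7 : s 2 = -r 3 := mul_left_cancel₀ hσ0 (by linarith)
  have v8 : q 2 = -p 3 := mul_left_cancel₀ hσ0 (by linarith)
  clear u1 u2 u3 u4 u7 u8 hσ hσ0
  constructor
  · have e : ∀ i, twoForm 0 (p i) (q i) (r i) (s i) 0 - (φ i / 2) • twoForm σ 0 0 0 0 0
        - (ψ i / 2) • twoForm 0 0 0 0 0 (-σ)
        = twoForm (-(φ i * σ) / 2) (p i) (q i) (r i) (s i) (ψ i * σ / 2) := by
      intro i
      ext a b
      fin_cases a <;> fin_cases b <;> simp [twoForm] <;> ring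
    simp only [e]
    apply frameKillingYano_twoForm <;> linarith
  · have e : ∀ i, twoForm 0 (-s i) (r i) (-q i) (p i) 0 - (φ i / 2) • twoForm 0 0 0 0 0 (-σ)
        + (ψ i / 2) • twoForm σ 0 0 0 0 0
        = twoForm (ψ i * σ / 2) (-s i) (r i) (-q i) (p i) (φ i * σ / 2) := by
      intro i
      ext a b
      fin_cases a <;> fin_cases b <;> simp [twoForm] <;> ring
    simp only [e]
    apply frameKillingYano_twoForm <;> linarith

/-! ### Integrability conditions in an adapted orthonormal frame -/

/-- The algebraic symmetries of the Riemann tensor. -/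
def IsCurvatureLike (R : Fin 4 → Fin 4 → Fin 4 → Fin 4 → ℝ) : Prop :=
  (∀ a b c d, R a b c d = -R b a c d) ∧ (∀ a b c d, R a b c d = -R a b d c) ∧
    (∀ a b c d, R a b c d = R c d a b) ∧
    ∀ a b c d, R a b c d + R a c d b + R a d b c = 0

/-- The hypotheses are the imaginary and real parts of `(α + iβ)(p + iq) = 0`. -/
lemma eq_zero_of_rotation {α β p q : ℝ} (h : α ^ 2 + β ^ 2 ≠ 0) (h1 : β * p + α * q = 0)
    (h2 : α * p - β * q = 0) : p = 0 ∧ q = 0 :=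
  ⟨(mul_eq_zero.mp (show (α ^ 2 + β ^ 2) * p = 0 by linear_combination β * h1 + α * h2)).resolve_left h,
    (mul_eq_zero.mp (show (α ^ 2 + β ^ 2) * q = 0 by linear_combination α * h1 - β * h2)).resolve_left h⟩

/-- `H` stands for `∇∇Y`, `X` for `∇ξ`, and `α, β` are the components of `Y`. `hZ` is the
differentiated Killing-Yano equation and `hC` the Ricci identity. The eight conclusions are the real
and imaginary parts of four complex Weyl components. -/
lemma frame_integrability {α β : ℝ} (hαβ : α ^ 2 + β ^ 2 ≠ 0)
    {R : Fin 4 → Fin 4 → Fin 4 → Fin 4 → ℝ} (hR : IsCurvatureLike R)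
    {H : Fin 4 → Fin 4 → Mat4} {X : Mat4} (hH : ∀ d a, (H d a)ᵀ = -H d a)
    (hZ : ∀ d a b c, H d a b c + H d b a c =
      2 * minkowski a b * X d c - minkowski a c * X d b - minkowski b c * X d a)
    (hC : ∀ d a, H d a - H a d =
      Matrix.of (fun b c => R b c d a) * minkowski * adaptedForm α β
        - adaptedForm α β * minkowski * Matrix.of (fun b c => R b c d a)) :
    (R 0 1 0 2 + R 1 3 2 3 = 0) ∧
    (-R 0 1 1 3 + R 0 2 2 3 = 0) ∧
    (R 0 1 0 3 - R 1 2 2 3 = 0) ∧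
    (R 0 1 1 2 + R 0 3 2 3 = 0) ∧
    (R 0 2 0 3 + R 1 2 1 3 = 0) ∧
    (R 0 2 1 2 - R 0 3 1 3 = 0) ∧
    (R 1 2 1 2 - R 0 3 0 3 + R 0 2 0 2 - R 1 3 1 3 = 0) ∧
    (-4 * R 0 2 1 3 + 2 * R 0 1 2 3 = 0) := by
  have D1 : ∀ a c d, R a a c d = 0 := fun a c d => by linarith [hR.1 a a c d]
  have L10 : ∀ c d, R 1 0 c d = -R 0 1 c d := hR.1 1 0
  have L20 : ∀ c d, R 2 0 c d = -R 0 2 c d := hR.1 2 0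
  have L21 : ∀ c d, R 2 1 c d = -R 1 2 c d := hR.1 2 1
  have L31 : ∀ c d, R 3 1 c d = -R 1 3 c d := hR.1 3 1
  have L32 : ∀ c d, R 3 2 c d = -R 2 3 c d := hR.1 3 2
  have P0201 : R 0 2 0 1 = R 0 1 0 2 := hR.2.2.1 _ _ _ _
  have P0301 : R 0 3 0 1 = R 0 1 0 3 := hR.2.2.1 _ _ _ _
  have P0302 : R 0 3 0 2 = R 0 2 0 3 := hR.2.2.1 _ _ _ _
  have P1201 : R 1 2 0 1 = R 0 1 1 2 := hR.2.2.1 _ _ _ _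
  have P1202 : R 1 2 0 2 = R 0 2 1 2 := hR.2.2.1 _ _ _ _
  -- The cyclic identity is needed only here and in the next line; the other rewrites put index
  -- pairs into a fixed order.
  have P1203 : R 1 2 0 3 = R 0 2 1 3 - R 0 1 2 3 := by
    linarith [hR.2.2.2 0 1 2 3, hR.2.2.1 1 2 0 3, hR.2.1 0 2 3 1]
  have Q0312 : R 0 3 1 2 = R 0 2 1 3 - R 0 1 2 3 := by
    linarith [hR.2.2.2 0 1 2 3, hR.2.1 0 2 3 1]
  have P1301 : R 1 3 0 1 = R 0 1 1 3 := hR.2.2.1 _ _ _ _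
  have P1302 : R 1 3 0 2 = R 0 2 1 3 := hR.2.2.1 _ _ _ _
  have P1303 : R 1 3 0 3 = R 0 3 1 3 := hR.2.2.1 _ _ _ _
  have P1312 : R 1 3 1 2 = R 1 2 1 3 := hR.2.2.1 _ _ _ _
  have P2301 : R 2 3 0 1 = R 0 1 2 3 := hR.2.2.1 _ _ _ _
  have P2302 : R 2 3 0 2 = R 0 2 2 3 := hR.2.2.1 _ _ _ _
  have P2303 : R 2 3 0 3 = R 0 3 2 3 := hR.2.2.1 _ _ _ _
  have P2312 : R 2 3 1 2 = R 1 2 2 3 := hR.2.2.1 _ _ _ _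
  have P2313 : R 2 3 1 3 = R 1 3 2 3 := hR.2.2.1 _ _ _ _
  have H0 : ∀ d a b, H d a b b = 0 := fun d a b => by
    have := congrFun (congrFun (hH d a) b) b
    simp only [Matrix.transpose_apply, Matrix.neg_apply] at this
    linarith
  have H21 : ∀ d a, H d a 2 1 = -H d a 1 2 := fun d a =>
    congrFun (congrFun (hH d a) 1) 2
  have H31 : ∀ d a, H d a 3 1 = -H d a 1 3 := fun d a =>
    congrFun (congrFun (hH d a) 1) 3
  have H32 : ∀ d a, H d a 3 2 = -H d a 2 3 := fun d a =>
    congrFun (congrFun (hH d a) 2) 3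
  have hC' := fun d a b c =>
    congrFun (congrFun (hC d a) b) c
  simp only [Matrix.sub_apply, mul_minkowski_mul, Matrix.of_apply] at hC'
  -- Each pair `a1`, `a2` to `d1`, `d2` gives the imaginary and real parts of one product `(α + iβ)
  -- z`. The listed instances of `hZ` and `hC` are those whose linear combination eliminates every
  -- entry of `H` and `X`.
  have a1 : β * (R 0 1 0 2 + R 1 3 2 3) + α * (-R 0 1 1 3 + R 0 2 2 3) = 0 := by
    have g0 := hC' 2 3 1 2
    have g1 := hC' 1 2 2 3
    have g2 := hZ 1 2 2 3
    have g3 := hZ 2 1 3 2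
    have g4 := hC' 0 3 0 1
    have g5 := hC' 0 1 0 3
    have g6 := hZ 0 0 3 1
    have g7 := hZ 0 0 1 3
    have g8 := hZ 1 0 0 3
    have g9 := hZ 3 0 0 1
    have g10 := hZ 3 1 2 2
    simp [adaptedForm, minkowski, H0, H31, H32, D1, L10, L20, L21, L31, L32, P0201, P0301, P1203,
      Q0312, P1301, P1303, P1312, P2301, P2312]
      at g0 g1 g2 g3 g4 g5 g6 g7 g8 g9 g10
    linarith
  have a2 : α * (R 0 1 0 2 + R 1 3 2 3) - β * (-R 0 1 1 3 + R 0 2 2 3) = 0 := by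
    have g0 := hC' 2 3 0 3
    have g1 := hZ 2 0 3 3
    have g2 := hZ 3 0 2 3
    have g3 := hC' 0 3 2 3
    have g4 := hZ 0 2 3 3
    have g5 := hC' 1 2 0 1
    have g6 := hC' 0 1 1 2
    have g7 := hZ 0 1 1 2
    have g8 := hZ 1 0 2 1
    have g9 := hZ 2 0 1 1
    simp [adaptedForm, minkowski, H0, H21, D1, L10, L20, L21, L31, L32, P0201, P1201, P1203,
      Q0312, P1301, P1303, P1312, P2301, P2303]
      at g0 g1 g2 g3 g4 g5 g6 g7 g8 g9
    linarith
  have b1 : β * (R 0 1 0 3 - R 1 2 2 3) + α * (R 0 1 1 2 + R 0 3 2 3) = 0 := by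
    have g0 := hC' 2 3 1 3
    have g1 := hZ 2 1 3 3
    have g2 := hZ 3 1 2 3
    have g3 := hC' 1 3 2 3
    have g4 := hZ 1 2 3 3
    have g5 := hC' 0 2 0 1
    have g6 := hC' 0 1 0 2
    have g7 := hZ 0 0 2 1
    have g8 := hZ 0 0 1 2
    have g9 := hZ 1 0 0 2
    have g10 := hZ 2 0 0 1
    simp [adaptedForm, minkowski, H0, H21, D1, L10, L20, L21, L31, L32, P0201, P0301, P0302,
      P1201, P1202, P1302, P2301, P2313]
      at g0 g1 g2 g3 g4 g5 g6 g7 g8 g9 g10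
    linarith
  have b2 : α * (R 0 1 0 3 - R 1 2 2 3) - β * (R 0 1 1 2 + R 0 3 2 3) = 0 := by
    have g0 := hC' 2 3 0 2
    have g1 := hC' 0 2 2 3
    have g2 := hZ 0 2 2 3
    have g3 := hZ 2 0 3 2
    have g4 := hZ 3 0 2 2
    have g5 := hC' 1 3 0 1
    have g6 := hC' 0 1 1 3
    have g7 := hZ 0 1 1 3
    have g8 := hZ 1 0 3 1
    have g9 := hZ 3 0 1 1
    simp [adaptedForm, minkowski, H0, H31, H32, D1, L10, L20, L21, L31, L32, P0301, P0302, P1201,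
      P1202, P1301, P1302, P2301, P2302]
      at g0 g1 g2 g3 g4 g5 g6 g7 g8 g9
    linarith
  have c1 : β * (R 0 2 0 3 + R 1 2 1 3) + α * (R 0 2 1 2 - R 0 3 1 3) = 0 := by
    have g0 := hC' 1 3 1 3
    have g1 := hZ 1 1 3 3
    have g2 := hZ 3 1 1 3
    have g3 := hC' 0 3 0 3
    have g4 := hZ 0 0 3 3
    have g5 := hZ 3 0 0 3
    have g6 := hC' 1 2 1 2
    have g7 := hZ 1 1 2 2
    have g8 := hZ 2 1 1 2
    have g9 := hC' 0 2 0 2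
    have g10 := hZ 0 0 2 2
    have g11 := hZ 2 0 0 2
    simp [adaptedForm, minkowski, H0, D1, L10, L32, P0302, P1202, P1303, P1312, P2302, P2303,
      P2312, P2313]
      at g0 g1 g2 g3 g4 g5 g6 g7 g8 g9 g10 g11
    linarith
  have c2 : α * (R 0 2 0 3 + R 1 2 1 3) - β * (R 0 2 1 2 - R 0 3 1 3) = 0 := by
    have g0 := hC' 1 3 0 2
    have g1 := hZ 1 0 3 2
    have g2 := hC' 0 3 1 2
    have g3 := hZ 0 1 3 2
    have g4 := hZ 3 0 1 2
    have g5 := hC' 1 2 0 3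
    have g6 := hZ 1 0 2 3
    have g7 := hC' 0 2 1 3
    have g8 := hZ 0 1 2 3
    have g9 := hZ 2 0 1 3
    simp [adaptedForm, minkowski, H32, D1, L10, L32, P0302, P1202, P1203, Q0312, P1302, P1303,
      P1312, P2302, P2303, P2312, P2313]
      at g0 g1 g2 g3 g4 g5 g6 g7 g8 g9
    linarith
  have d1 : β * (R 1 2 1 2 - R 0 3 0 3 + R 0 2 0 2 - R 1 3 1 3) + α * (-4 * R 0 2 1 3 + 2 * R 0 1 2 3) = 0 := by
    have g0 := hC' 1 3 1 2
    have g1 := hC' 1 2 1 3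
    have g2 := hZ 1 1 3 2
    have g3 := hZ 1 1 2 3
    have g4 := hZ 2 1 1 3
    have g5 := hC' 0 3 0 2
    have g6 := hC' 0 2 0 3
    have g7 := hZ 0 0 3 2
    have g8 := hZ 0 0 2 3
    have g9 := hZ 2 0 0 3
    have g10 := hZ 3 0 0 2
    have g11 := hZ 3 1 1 2
    simp [adaptedForm, minkowski, H32, D1, L10, L32, P0302, P1203, Q0312, P1302, P1312, P2302,
      P2303, P2312, P2313]
      at g0 g1 g2 g3 g4 g5 g6 g7 g8 g9 g10 g11
    linarith
  have d2 : α * (R 1 2 1 2 - R 0 3 0 3 + R 0 2 0 2 - R 1 3 1 3) - β * (-4 * R 0 2 1 3 + 2 * R 0 1 2 3) = 0 := by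
    have g0 := hC' 1 3 0 3
    have g1 := hZ 1 0 3 3
    have g2 := hZ 3 0 1 3
    have g3 := hC' 0 3 1 3
    have g4 := hZ 0 1 3 3
    have g5 := hC' 1 2 0 2
    have g6 := hZ 1 0 2 2
    have g7 := hZ 2 0 1 2
    have g8 := hC' 0 2 1 2
    have g9 := hZ 0 1 2 2
    simp [adaptedForm, minkowski, H0, D1, L10, L32, P1202, P1203, Q0312, P1302, P1303, P2302,
      P2303, P2312, P2313]
      at g0 g1 g2 g3 g4 g5 g6 g7 g8 g9
    linarith
  obtain ⟨a3, a4⟩ := eq_zero_of_rotation hαβ a1 a2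
  obtain ⟨b3, b4⟩ := eq_zero_of_rotation hαβ b1 b2
  obtain ⟨c3, c4⟩ := eq_zero_of_rotation hαβ c1 c2
  obtain ⟨d3, d4⟩ := eq_zero_of_rotation hαβ d1 d2
  exact ⟨a3, a4, b3, b4, c3, c4, d3, d4⟩

/-! ### Weyl part of a curvature tensor and its type D components -/

/-- The Ricci contraction of a covariant 4-tensor. -/
def ricciOf (A : Mat4) (R : Fin 4 → Fin 4 → Fin 4 → Fin 4 → ℝ) : Mat4 :=
  fun b d => ∑ c, ∑ a, A⁻¹ c a * R a b c d

/-- The scalar contraction of a covariant 4-tensor. -/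
def scalarOf (A : Mat4) (R : Fin 4 → Fin 4 → Fin 4 → Fin 4 → ℝ) : ℝ :=
  ∑ b, ∑ d, A⁻¹ b d * ricciOf A R b d

/-- The Weyl part of a covariant 4-tensor. -/
def weylOf (A : Mat4) (R : Fin 4 → Fin 4 → Fin 4 → Fin 4 → ℝ) (a b c d : Fin 4) : ℝ :=
  R a b c d
    - (1 / 2) * (A a c * ricciOf A R b d + A b d * ricciOf A R a c
        - A a d * ricciOf A R b c - A b c * ricciOf A R a d)
    + (scalarOf A R / 6) * (A a c * A b d - A a d * A b c)

lemma minkowski_inv : minkowski⁻¹ = minkowski := by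
  refine Matrix.inv_eq_left_inv ?_
  rw [minkowski, Matrix.diagonal_mul_diagonal, ← Matrix.diagonal_one]
  congr 1
  ext i
  fin_cases i <;> simp

lemma ricciOf_minkowski (R : Fin 4 → Fin 4 → Fin 4 → Fin 4 → ℝ) (b d : Fin 4) :
    ricciOf minkowski R b d = -R 0 b 0 d + R 1 b 1 d + R 2 b 2 d + R 3 b 3 d := by
  rw [ricciOf, minkowski_inv]
  simp only [Fin.sum_univ_four, minkowski]
  simp

lemma scalarOf_minkowski (R : Fin 4 → Fin 4 → Fin 4 → Fin 4 → ℝ) :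
    scalarOf minkowski R = -ricciOf minkowski R 0 0 + ricciOf minkowski R 1 1
      + ricciOf minkowski R 2 2 + ricciOf minkowski R 3 3 := by
  rw [scalarOf, minkowski_inv]
  simp only [Fin.sum_univ_four, minkowski]
  simp

/-- The components of a double 2-form of type D in an orthonormal frame adapted to its principal
planes. -/
structure TypeDComponents (W : Fin 4 → Fin 4 → Fin 4 → Fin 4 → ℝ) (x y : ℝ) : Prop where
  antisymm_left : ∀ a b c d, W a b c d = -W b a c d
  antisymm_right : ∀ a b c d, W a b c d = -W a b d c
  pair_symm : ∀ a b c d, W a b c d = W c d a b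
  w0101 : W 0 1 0 1 = x
  w0102 : W 0 1 0 2 = 0
  w0103 : W 0 1 0 3 = 0
  w0112 : W 0 1 1 2 = 0
  w0113 : W 0 1 1 3 = 0
  w0123 : W 0 1 2 3 = y
  w0202 : W 0 2 0 2 = -(x / 2)
  w0203 : W 0 2 0 3 = 0
  w0212 : W 0 2 1 2 = 0
  w0213 : W 0 2 1 3 = y / 2
  w0223 : W 0 2 2 3 = 0
  w0303 : W 0 3 0 3 = -(x / 2)
  w0312 : W 0 3 1 2 = -(y / 2)
  w0313 : W 0 3 1 3 = 0
  w0323 : W 0 3 2 3 = 0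
  w1212 : W 1 2 1 2 = x / 2
  w1213 : W 1 2 1 3 = 0
  w1223 : W 1 2 2 3 = 0
  w1313 : W 1 3 1 3 = x / 2
  w1323 : W 1 3 2 3 = 0
  w2323 : W 2 3 2 3 = -x

lemma ricciOf_symm {R : Fin 4 → Fin 4 → Fin 4 → Fin 4 → ℝ} (hR : IsCurvatureLike R)
    (b d : Fin 4) : ricciOf minkowski R b d = ricciOf minkowski R d b := by
  simp only [ricciOf_minkowski]
  rw [hR.2.2.1 0 b 0 d, hR.2.2.1 1 b 1 d, hR.2.2.1 2 b 2 d, hR.2.2.1 3 b 3 d]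

lemma minkowski_symm (a b : Fin 4) : minkowski a b = minkowski b a :=
  congrFun (congrFun (show minkowski = minkowskiᵀ by simp [minkowski]) a) b

/-- The Ricci terms cancel in the eight combinations, so these also vanish for the Weyl part. The
latter is trace-free, and this leaves only two free components: `W 0 1 0 1` and `W 0 1 2 3`. -/
lemma typeDComponents_of_integrability {R : Fin 4 → Fin 4 → Fin 4 → Fin 4 → ℝ}
    (hR : IsCurvatureLike R)
    (hI : (R 0 1 0 2 + R 1 3 2 3 = 0) ∧
    (-R 0 1 1 3 + R 0 2 2 3 = 0) ∧
    (R 0 1 0 3 - R 1 2 2 3 = 0) ∧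
    (R 0 1 1 2 + R 0 3 2 3 = 0) ∧
    (R 0 2 0 3 + R 1 2 1 3 = 0) ∧
    (R 0 2 1 2 - R 0 3 1 3 = 0) ∧
    (R 1 2 1 2 - R 0 3 0 3 + R 0 2 0 2 - R 1 3 1 3 = 0) ∧
    (-4 * R 0 2 1 3 + 2 * R 0 1 2 3 = 0)) :
    ∃ x y, TypeDComponents (weylOf minkowski R) x y := by
  have D1 : ∀ a c d, R a a c d = 0 := fun a c d => by linarith [hR.1 a a c d]
  have D2 : ∀ a b c, R a b c c = 0 := fun a b c => by linarith [hR.2.1 a b c c]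
  have L10 : ∀ c d, R 1 0 c d = -R 0 1 c d := hR.1 1 0
  have L20 : ∀ c d, R 2 0 c d = -R 0 2 c d := hR.1 2 0
  have L30 : ∀ c d, R 3 0 c d = -R 0 3 c d := hR.1 3 0
  have L21 : ∀ c d, R 2 1 c d = -R 1 2 c d := hR.1 2 1
  have L31 : ∀ c d, R 3 1 c d = -R 1 3 c d := hR.1 3 1
  have L32 : ∀ c d, R 3 2 c d = -R 2 3 c d := hR.1 3 2
  have M10 : ∀ c d, R c d 1 0 = -R c d 0 1 := fun c d => hR.2.1 c d 1 0
  have M20 : ∀ c d, R c d 2 0 = -R c d 0 2 := fun c d => hR.2.1 c d 2 0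
  have M30 : ∀ c d, R c d 3 0 = -R c d 0 3 := fun c d => hR.2.1 c d 3 0
  have M21 : ∀ c d, R c d 2 1 = -R c d 1 2 := fun c d => hR.2.1 c d 2 1
  have M31 : ∀ c d, R c d 3 1 = -R c d 1 3 := fun c d => hR.2.1 c d 3 1
  have M32 : ∀ c d, R c d 3 2 = -R c d 2 3 := fun c d => hR.2.1 c d 3 2
  have P0201 : R 0 2 0 1 = R 0 1 0 2 := hR.2.2.1 _ _ _ _
  have P0301 : R 0 3 0 1 = R 0 1 0 3 := hR.2.2.1 _ _ _ _
  have P0302 : R 0 3 0 2 = R 0 2 0 3 := hR.2.2.1 _ _ _ _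
  have P1201 : R 1 2 0 1 = R 0 1 1 2 := hR.2.2.1 _ _ _ _
  have P1202 : R 1 2 0 2 = R 0 2 1 2 := hR.2.2.1 _ _ _ _
  have Q0312 : R 0 3 1 2 = R 0 2 1 3 - R 0 1 2 3 := by
    linarith [hR.2.2.2 0 1 2 3, hR.2.1 0 2 3 1]
  have P1301 : R 1 3 0 1 = R 0 1 1 3 := hR.2.2.1 _ _ _ _
  have P1303 : R 1 3 0 3 = R 0 3 1 3 := hR.2.2.1 _ _ _ _
  have P1312 : R 1 3 1 2 = R 1 2 1 3 := hR.2.2.1 _ _ _ _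
  have P2302 : R 2 3 0 2 = R 0 2 2 3 := hR.2.2.1 _ _ _ _
  have P2303 : R 2 3 0 3 = R 0 3 2 3 := hR.2.2.1 _ _ _ _
  have P2312 : R 2 3 1 2 = R 1 2 2 3 := hR.2.2.1 _ _ _ _
  have P2313 : R 2 3 1 3 = R 1 3 2 3 := hR.2.2.1 _ _ _ _
  obtain ⟨i1, i2, i3, i4, i5, i6, i7, i8⟩ := hI
  refine ⟨weylOf minkowski R 0 1 0 1, weylOf minkowski R 0 1 2 3, ?_, ?_, ?_, ?_, ?_, ?_, ?_, ?_, ?_, ?_, ?_, ?_, ?_, ?_, ?_, ?_, ?_, ?_, ?_, ?_, ?_, ?_, ?_, ?_⟩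
  · intro a b c d
    simp only [weylOf]
    linear_combination hR.1 a b c d
  · intro a b c d
    simp only [weylOf]
    linear_combination hR.2.1 a b c d
  · intro a b c d
    simp only [weylOf]
    rw [ricciOf_symm hR d b, ricciOf_symm hR c a, ricciOf_symm hR d a, ricciOf_symm hR c b,
      minkowski_symm c a, minkowski_symm d b, minkowski_symm c b, minkowski_symm d a]
    linear_combination hR.2.2.1 a b c d
  all_goals
    simp only [weylOf, scalarOf_minkowski, ricciOf_minkowski]
  all_goals
    simp [minkowski, D1, D2, L10, L20, L30, L21, L31, L32, M10, M20, M30, M21, M31, M32, P0201,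
      P0301, P0302, P1201, P1202, Q0312, P1301, P1303, P1312, P2302, P2303, P2312, P2313]
    try linarith

lemma TypeDComponents.eq_zero {W : Fin 4 → Fin 4 → Fin 4 → Fin 4 → ℝ}
    (hW : TypeDComponents W 0 0) : W = 0 := by
  have D1 : ∀ a c d, W a a c d = 0 := fun a c d => by linarith [hW.antisymm_left a a c d]
  have D2 : ∀ a b c, W a b c c = 0 := fun a b c => by linarith [hW.antisymm_right a b c c]
  have L10 : ∀ c d, W 1 0 c d = -W 0 1 c d := hW.antisymm_left 1 0
  have L20 : ∀ c d, W 2 0 c d = -W 0 2 c d := hW.antisymm_left 2 0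
  have L30 : ∀ c d, W 3 0 c d = -W 0 3 c d := hW.antisymm_left 3 0
  have L21 : ∀ c d, W 2 1 c d = -W 1 2 c d := hW.antisymm_left 2 1
  have L31 : ∀ c d, W 3 1 c d = -W 1 3 c d := hW.antisymm_left 3 1
  have L32 : ∀ c d, W 3 2 c d = -W 2 3 c d := hW.antisymm_left 3 2
  have M10 : ∀ c d, W c d 1 0 = -W c d 0 1 := fun c d => hW.antisymm_right c d 1 0
  have M20 : ∀ c d, W c d 2 0 = -W c d 0 2 := fun c d => hW.antisymm_right c d 2 0
  have M30 : ∀ c d, W c d 3 0 = -W c d 0 3 := fun c d => hW.antisymm_right c d 3 0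
  have M21 : ∀ c d, W c d 2 1 = -W c d 1 2 := fun c d => hW.antisymm_right c d 2 1
  have M31 : ∀ c d, W c d 3 1 = -W c d 1 3 := fun c d => hW.antisymm_right c d 3 1
  have M32 : ∀ c d, W c d 3 2 = -W c d 2 3 := fun c d => hW.antisymm_right c d 3 2
  have P0201 : W 0 2 0 1 = W 0 1 0 2 := hW.pair_symm _ _ _ _
  have P0301 : W 0 3 0 1 = W 0 1 0 3 := hW.pair_symm _ _ _ _
  have P0302 : W 0 3 0 2 = W 0 2 0 3 := hW.pair_symm _ _ _ _
  have P1201 : W 1 2 0 1 = W 0 1 1 2 := hW.pair_symm _ _ _ _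
  have P1202 : W 1 2 0 2 = W 0 2 1 2 := hW.pair_symm _ _ _ _
  have P1203 : W 1 2 0 3 = W 0 3 1 2 := hW.pair_symm _ _ _ _
  have P1301 : W 1 3 0 1 = W 0 1 1 3 := hW.pair_symm _ _ _ _
  have P1302 : W 1 3 0 2 = W 0 2 1 3 := hW.pair_symm _ _ _ _
  have P1303 : W 1 3 0 3 = W 0 3 1 3 := hW.pair_symm _ _ _ _
  have P1312 : W 1 3 1 2 = W 1 2 1 3 := hW.pair_symm _ _ _ _
  have P2301 : W 2 3 0 1 = W 0 1 2 3 := hW.pair_symm _ _ _ _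
  have P2302 : W 2 3 0 2 = W 0 2 2 3 := hW.pair_symm _ _ _ _
  have P2303 : W 2 3 0 3 = W 0 3 2 3 := hW.pair_symm _ _ _ _
  have P2312 : W 2 3 1 2 = W 1 2 2 3 := hW.pair_symm _ _ _ _
  have P2313 : W 2 3 1 3 = W 1 3 2 3 := hW.pair_symm _ _ _ _
  have key : ∀ a b, (a = b ∨ W a b = 0) := by
    intro a b
    rw [or_iff_not_imp_left]
    intro hab
    ext c d
    fin_cases a <;> fin_cases b <;> first | exact absurd rfl hab | skip
    all_goals fin_cases c <;> fin_cases d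
    all_goals
      simp [D2, L10, L20, L30, L21, L31, L32, M10, M20, M30, M21, M31, M32, P0201, P0301, P0302,
        P1201, P1202, P1203, P1301, P1302, P1303, P1312, P2301, P2302, P2303, P2312, P2313,
        hW.w0101, hW.w0102, hW.w0103, hW.w0112, hW.w0113, hW.w0123, hW.w0202, hW.w0203, hW.w0212,
        hW.w0213, hW.w0223, hW.w0303, hW.w0312, hW.w0313, hW.w0323, hW.w1212, hW.w1213, hW.w1223,
        hW.w1313, hW.w1323, hW.w2323]
  ext a b c d
  rcases key a b with rfl | h
  · exact D1 a c d
  · rw [h]; rfl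

/-! ### Action of the type D components on self-dual bivectors -/

/-- The self-dual bivectors of Minkowski space. -/
def sdForm (u v w : ℂ) : CMat4 :=
  !![0, u, v, w; -u, 0, Complex.I * w, -(Complex.I * v);
    -v, -(Complex.I * w), 0, Complex.I * u; -w, Complex.I * v, -(Complex.I * u), 0]

lemma doubleFormApply_minkowski (P : Fin 4 → Fin 4 → Fin 4 → Fin 4 → ℝ) (F : CMat4)
    (a b : Fin 4) : doubleFormApply minkowski P F a b = ∑ c, ∑ d,
      ((1 / 2 : ℝ) * P a b c d * minkowski c c * minkowski d d) • F c d := by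
  unfold doubleFormApply
  rw [minkowski_inv]
  refine Finset.sum_congr rfl fun c _ => Finset.sum_congr rfl fun d _ => ?_
  rw [Finset.sum_eq_single c, Finset.sum_eq_single d]
  · intro f _ hf; simp [minkowski, Matrix.diagonal_apply_ne' _ hf]
  · simp
  · intro e _ he; simp [minkowski, Matrix.diagonal_apply_ne' _ he]
  · simp

/-- In the coordinates `u, v, w` the Weyl action is diagonal, with `ρ = (x - iy)/2`; the simple
eigenvalue belongs to the direction `θ⁰∧θ¹ + i θ²∧θ³`. -/
lemma TypeDComponents.apply_sdForm {W : Fin 4 → Fin 4 → Fin 4 → Fin 4 → ℝ} {x y : ℝ}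
    (hW : TypeDComponents W x y) (u v w : ℂ) : doubleFormApply minkowski W (sdForm u v w) =
      sdForm (-2 * ((x - Complex.I * y) / 2) * u) ((x - Complex.I * y) / 2 * v)
        ((x - Complex.I * y) / 2 * w) := by
  have D1 : ∀ a c d, W a a c d = 0 := fun a c d => by linarith [hW.antisymm_left a a c d]
  have D2 : ∀ a b c, W a b c c = 0 := fun a b c => by linarith [hW.antisymm_right a b c c]
  have L10 : ∀ c d, W 1 0 c d = -W 0 1 c d := hW.antisymm_left 1 0
  have L20 : ∀ c d, W 2 0 c d = -W 0 2 c d := hW.antisymm_left 2 0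
  have L30 : ∀ c d, W 3 0 c d = -W 0 3 c d := hW.antisymm_left 3 0
  have L21 : ∀ c d, W 2 1 c d = -W 1 2 c d := hW.antisymm_left 2 1
  have L31 : ∀ c d, W 3 1 c d = -W 1 3 c d := hW.antisymm_left 3 1
  have L32 : ∀ c d, W 3 2 c d = -W 2 3 c d := hW.antisymm_left 3 2
  have M10 : ∀ c d, W c d 1 0 = -W c d 0 1 := fun c d => hW.antisymm_right c d 1 0
  have M20 : ∀ c d, W c d 2 0 = -W c d 0 2 := fun c d => hW.antisymm_right c d 2 0
  have M30 : ∀ c d, W c d 3 0 = -W c d 0 3 := fun c d => hW.antisymm_right c d 3 0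
  have M21 : ∀ c d, W c d 2 1 = -W c d 1 2 := fun c d => hW.antisymm_right c d 2 1
  have M31 : ∀ c d, W c d 3 1 = -W c d 1 3 := fun c d => hW.antisymm_right c d 3 1
  have M32 : ∀ c d, W c d 3 2 = -W c d 2 3 := fun c d => hW.antisymm_right c d 3 2
  have P0201 : W 0 2 0 1 = W 0 1 0 2 := hW.pair_symm _ _ _ _
  have P0301 : W 0 3 0 1 = W 0 1 0 3 := hW.pair_symm _ _ _ _
  have P0302 : W 0 3 0 2 = W 0 2 0 3 := hW.pair_symm _ _ _ _
  have P1201 : W 1 2 0 1 = W 0 1 1 2 := hW.pair_symm _ _ _ _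
  have P1202 : W 1 2 0 2 = W 0 2 1 2 := hW.pair_symm _ _ _ _
  have P1203 : W 1 2 0 3 = W 0 3 1 2 := hW.pair_symm _ _ _ _
  have P1301 : W 1 3 0 1 = W 0 1 1 3 := hW.pair_symm _ _ _ _
  have P1302 : W 1 3 0 2 = W 0 2 1 3 := hW.pair_symm _ _ _ _
  have P1303 : W 1 3 0 3 = W 0 3 1 3 := hW.pair_symm _ _ _ _
  have P1312 : W 1 3 1 2 = W 1 2 1 3 := hW.pair_symm _ _ _ _
  have P2301 : W 2 3 0 1 = W 0 1 2 3 := hW.pair_symm _ _ _ _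
  have P2302 : W 2 3 0 2 = W 0 2 2 3 := hW.pair_symm _ _ _ _
  have P2303 : W 2 3 0 3 = W 0 3 2 3 := hW.pair_symm _ _ _ _
  have P2312 : W 2 3 1 2 = W 1 2 2 3 := hW.pair_symm _ _ _ _
  have P2313 : W 2 3 1 3 = W 1 3 2 3 := hW.pair_symm _ _ _ _
  ext a b
  rw [doubleFormApply_minkowski]
  fin_cases a <;> fin_cases b
  all_goals
    simp [sdForm, minkowski, Fin.sum_univ_four, D1, D2, L10, L20, L30, L21, L31, L32, M10, M20,
      M30, M21, M31, M32, P0201, P0301, P0302, P1201, P1202, P1203, P1301, P1302, P1303, P1312,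
      P2301, P2302, P2303, P2312, P2313, hW.w0101, hW.w0102, hW.w0103, hW.w0112, hW.w0113,
      hW.w0123, hW.w0202, hW.w0203, hW.w0212, hW.w0213, hW.w0223, hW.w0303, hW.w0312, hW.w0313,
      hW.w0323, hW.w1212, hW.w1213, hW.w1223, hW.w1313, hW.w1323, hW.w2323]
  all_goals ring_nf
  all_goals try (simp only [Complex.I_sq]; ring)

section

/-! ### Change of frame -/

/-- The components of a covariant 4-tensor in the frame whose vectors are the columns of `E`. -/
def frame4 (E : Mat4) (T : Fin 4 → Fin 4 → Fin 4 → Fin 4 → ℝ)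
    (i j k l : Fin 4) : ℝ :=
  (∑ a, E a i • ∑ b, E b j • (Eᵀ * Matrix.of (T a b) * E)) k l

/-- The components of a covariant 3-tensor in the frame whose vectors are the columns of `E`. -/
def frame3 (E : Mat4) (T : Fin 4 → Mat4) (i : Fin 4) : Mat4 :=
  ∑ a, E a i • (Eᵀ * T a * E)

lemma frame4_apply (E : Mat4) (T : Fin 4 → Fin 4 → Fin 4 → Fin 4 → ℝ) (i j k l : Fin 4) :
    frame4 E T i j k l = ∑ a, ∑ b, ∑ c, ∑ d, E a i * E b j * E c k * E d l * T a b c d := by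
  simp only [frame4, Matrix.sum_apply, Matrix.smul_apply, smul_eq_mul, Matrix.mul_apply,
    Matrix.of_apply, Matrix.transpose_apply]
  refine Finset.sum_congr rfl fun a _ => ?_
  rw [Finset.mul_sum]
  refine Finset.sum_congr rfl fun b _ => ?_
  simp only [Fin.sum_univ_four]
  ring

lemma frame3_apply (E : Mat4) (T : Fin 4 → Mat4) (i j k : Fin 4) :
    frame3 E T i j k = ∑ a, ∑ b, ∑ c, E a i * E b j * E c k * T a b c := by
  simp only [frame3, Matrix.sum_apply, Matrix.smul_apply, smul_eq_mul, Matrix.mul_apply,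
    Matrix.transpose_apply]
  refine Finset.sum_congr rfl fun a _ => ?_
  simp only [Fin.sum_univ_four]
  ring

lemma frame4_swap12 (E : Mat4) (T : Fin 4 → Fin 4 → Fin 4 → Fin 4 → ℝ) (i j k l : Fin 4) :
    frame4 E (fun a b c d => T b a c d) i j k l = frame4 E T j i k l := by
  rw [frame4_apply, frame4_apply, Finset.sum_comm]
  refine Finset.sum_congr rfl fun a _ => Finset.sum_congr rfl fun b _ => Finset.sum_congr rfl
    fun c _ => Finset.sum_congr rfl fun d _ => by ring

lemma frame4_swap23 (E : Mat4) (T : Fin 4 → Fin 4 → Fin 4 → Fin 4 → ℝ) (i j k l : Fin 4) :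
    frame4 E (fun a b c d => T a c b d) i j k l = frame4 E T i k j l := by
  rw [frame4_apply, frame4_apply]
  refine Finset.sum_congr rfl fun a _ => ?_
  rw [Finset.sum_comm]
  refine Finset.sum_congr rfl fun b _ => Finset.sum_congr rfl
    fun c _ => Finset.sum_congr rfl fun d _ => by ring

lemma frame4_swap34 (E : Mat4) (T : Fin 4 → Fin 4 → Fin 4 → Fin 4 → ℝ) (i j k l : Fin 4) :
    frame4 E (fun a b c d => T a b d c) i j k l = frame4 E T i j l k := by
  rw [frame4_apply, frame4_apply]
  refine Finset.sum_congr rfl fun a _ => Finset.sum_congr rfl fun b _ => ?_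
  rw [Finset.sum_comm]
  refine Finset.sum_congr rfl fun c _ => Finset.sum_congr rfl fun d _ => by ring

lemma frame4_add (E : Mat4) (S T : Fin 4 → Fin 4 → Fin 4 → Fin 4 → ℝ) (i j k l : Fin 4) :
    frame4 E (fun a b c d => S a b c d + T a b c d) i j k l
      = frame4 E S i j k l + frame4 E T i j k l := by
  simp only [frame4_apply, mul_add, Finset.sum_add_distrib]

lemma frame4_smul (E : Mat4) (r : ℝ) (T : Fin 4 → Fin 4 → Fin 4 → Fin 4 → ℝ) (i j k l : Fin 4) :
    frame4 E (fun a b c d => r * T a b c d) i j k l = r * frame4 E T i j k l := by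
  simp only [frame4_apply, Finset.mul_sum]
  refine Finset.sum_congr rfl fun a _ => Finset.sum_congr rfl fun b _ => Finset.sum_congr rfl
    fun c _ => Finset.sum_congr rfl fun d _ => by ring

lemma frame4_neg (E : Mat4) (T : Fin 4 → Fin 4 → Fin 4 → Fin 4 → ℝ) (i j k l : Fin 4) :
    frame4 E (fun a b c d => -T a b c d) i j k l = -frame4 E T i j k l := by
  simpa using frame4_smul E (-1) T i j k l

lemma frame4_sub (E : Mat4) (S T : Fin 4 → Fin 4 → Fin 4 → Fin 4 → ℝ) (i j k l : Fin 4) :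
    frame4 E (fun a b c d => S a b c d - T a b c d) i j k l
      = frame4 E S i j k l - frame4 E T i j k l := by
  simp only [sub_eq_add_neg, frame4_add, frame4_neg]

lemma frame4_mul12 (E A B : Mat4) (i j k l : Fin 4) :
    frame4 E (fun a b c d => A a b * B c d) i j k l = (Eᵀ * A * E) i j * (Eᵀ * B * E) k l := by
  have h : ∀ a b : Fin 4, Matrix.of (fun c d => A a b * B c d) = A a b • B := fun a b => rfl
  simp only [frame4, h, Matrix.mul_smul, Matrix.smul_mul, Matrix.sum_apply, Matrix.smul_apply,
    smul_eq_mul]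
  simp only [← mul_assoc, ← Finset.sum_mul]
  congr 1
  simp only [Matrix.mul_apply, Matrix.transpose_apply, Fin.sum_univ_four]
  ring

lemma frame4_mul13 (E A B : Mat4) (i j k l : Fin 4) :
    frame4 E (fun a b c d => A a c * B b d) i j k l = (Eᵀ * A * E) i k * (Eᵀ * B * E) j l := by
  rw [frame4_swap23 E (fun a b c d => A a b * B c d), frame4_mul12]

lemma frame4_mul14 (E A B : Mat4) (i j k l : Fin 4) :
    frame4 E (fun a b c d => A a d * B b c) i j k l = (Eᵀ * A * E) i l * (Eᵀ * B * E) j k := by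
  rw [frame4_swap34 E (fun a b c d => A a c * B b d), frame4_mul13]

lemma IsCurvatureLike.frame {R : Fin 4 → Fin 4 → Fin 4 → Fin 4 → ℝ} (hR : IsCurvatureLike R)
    (E : Mat4) : IsCurvatureLike (frame4 E R) := by
  refine ⟨fun i j k l => ?_, fun i j k l => ?_, fun i j k l => ?_, fun i j k l => ?_⟩
  · rw [← frame4_swap12, ← frame4_neg]
    congr 2
    funext a b c d
    exact hR.1 b a c d
  · rw [← frame4_swap34, ← frame4_neg]
    congr 2
    funext a b c d
    exact hR.2.1 a b d c
  · rw [← frame4_swap23, ← frame4_swap34, ← frame4_swap12, ← frame4_swap23]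
    congr 2
    funext a b c d
    exact hR.2.2.1 c d a b
  · rw [← frame4_swap34 E R i k j l, ← frame4_swap23 E (fun a b c d => R a b d c) i j k l,
      ← frame4_swap23 E R i j l k, ← frame4_swap34 E (fun a b c d => R a c b d) i j k l,
      ← frame4_add, ← frame4_add]
    have : (fun a b c d => R a b c d + R a c d b + R a d b c) = fun a b c d => 0 * R a b c d := by
      funext a b c d
      rw [hR.2.2.2, zero_mul]
    rw [this, frame4_smul, zero_mul]

/-! ### Contractions and the Weyl part in an orthonormal frame -/

/-- The columns of `E` are a positively oriented orthonormal frame of the metric `A`. -/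
structure IsOrientedFrame (A E : Mat4) : Prop where
  orthonormal : Eᵀ * A * E = minkowski
  det_pos : 0 < E.det

lemma det_minkowski : minkowski.det = -1 := by
  simp [minkowski, Matrix.det_diagonal, Fin.prod_univ_four]

lemma minkowski_mul_self : minkowski * minkowski = 1 := by
  have h := Matrix.nonsing_inv_mul minkowski (by rw [det_minkowski]; norm_num)
  rwa [minkowski_inv] at h

namespace IsOrientedFrame

variable {A E : Mat4}

lemma isUnit_det (h : IsOrientedFrame A E) : IsUnit E.det := isUnit_iff_ne_zero.mpr h.det_pos.ne'

lemma det_mul (h : IsOrientedFrame A E) : A.det * E.det ^ 2 = -1 := by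
  rw [← det_minkowski, ← h.orthonormal, Matrix.det_mul, Matrix.det_mul, Matrix.det_transpose]
  ring

lemma det_ne_zero (h : IsOrientedFrame A E) : A.det ≠ 0 := fun h0 => by
  have := h.det_mul
  rw [h0] at this
  norm_num at this

lemma det_neg (h : IsOrientedFrame A E) : 0 < -A.det := by
  have := h.det_mul
  have hE := pow_pos h.det_pos 2
  by_contra hA
  nlinarith

lemma inv_eq (h : IsOrientedFrame A E) : A⁻¹ = E * minkowski * Eᵀ := by
  refine Matrix.inv_eq_right_inv ?_
  have h1 : Eᵀ * (A * (E * minkowski * Eᵀ)) = Eᵀ * 1 := by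
    calc Eᵀ * (A * (E * minkowski * Eᵀ)) = (Eᵀ * A * E) * minkowski * Eᵀ := by noncomm_ring
      _ = Eᵀ * 1 := by rw [h.orthonormal, minkowski_mul_self, Matrix.one_mul, Matrix.mul_one]
  have hu : IsUnit (Eᵀ) := by
    rw [Matrix.isUnit_iff_isUnit_det, Matrix.det_transpose]; exact h.isUnit_det
  exact hu.mul_left_cancel h1

lemma mul_inv (h : IsOrientedFrame A E) : E * E⁻¹ = 1 := Matrix.mul_nonsing_inv _ h.isUnit_det

lemma inv_mul (h : IsOrientedFrame A E) : E⁻¹ * E = 1 := Matrix.nonsing_inv_mul _ h.isUnit_det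

/-- By `A⁻¹ = E η Eᵀ` and cyclicity of the trace, a metric contraction is a signed sum over the
frame. -/
lemma contract (h : IsOrientedFrame A E) (M : Mat4) :
    ∑ c, ∑ a, A⁻¹ c a * M a c = ∑ m, minkowski m m * (Eᵀ * M * E) m m := by
  have h1 : ∑ c, ∑ a, A⁻¹ c a * M a c = (A⁻¹ * M).trace := by
    simp [Matrix.trace, Matrix.mul_apply]
  have h2 : ∑ m, minkowski m m * (Eᵀ * M * E) m m = (minkowski * (Eᵀ * M * E)).trace := by
    simp [Matrix.trace, minkowski]
  rw [h1, h2, h.inv_eq, show E * minkowski * Eᵀ * M = E * (minkowski * Eᵀ * M) by noncomm_ring,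
    Matrix.trace_mul_comm]
  congr 1
  noncomm_ring

lemma frame_ricciOf (h : IsOrientedFrame A E) (R : Fin 4 → Fin 4 → Fin 4 → Fin 4 → ℝ) :
    Eᵀ * ricciOf A R * E = ricciOf minkowski (frame4 E R) := by
  ext j l
  have h1 : (Eᵀ * ricciOf A R * E) j l
      = ∑ c, ∑ a, A⁻¹ c a * (∑ b, ∑ d, E b j * E d l * R a b c d) := by
    simp only [Matrix.mul_apply, Matrix.transpose_apply, ricciOf, Fin.sum_univ_four]
    ring
  rw [h1]
  refine (h.contract (Matrix.of fun a c => ∑ b, ∑ d, E b j * E d l * R a b c d)).trans ?_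
  have h2 : ∀ m, (Eᵀ * (Matrix.of fun a c => ∑ b, ∑ d, E b j * E d l * R a b c d) * E) m m
      = frame4 E R m j m l := by
    intro m
    rw [frame4_apply]
    simp only [Matrix.mul_apply, Matrix.transpose_apply, Matrix.of_apply, Fin.sum_univ_four]
    ring
  simp only [h2]
  rw [ricciOf_minkowski]
  simp [Fin.sum_univ_four, minkowski]

lemma frame_scalarOf (h : IsOrientedFrame A E) (R : Fin 4 → Fin 4 → Fin 4 → Fin 4 → ℝ) :
    scalarOf A R = scalarOf minkowski (frame4 E R) := by
  rw [scalarOf_minkowski, ← h.frame_ricciOf]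
  have h1 := h.contract (ricciOf A R)ᵀ
  have h2 : Eᵀ * (ricciOf A R)ᵀ * E = (Eᵀ * ricciOf A R * E)ᵀ := by
    simp [Matrix.mul_assoc]
  rw [h2] at h1
  simp only [Matrix.transpose_apply] at h1
  rw [scalarOf, h1]
  simp [Fin.sum_univ_four, minkowski]

lemma frame_weylOf (h : IsOrientedFrame A E) (R : Fin 4 → Fin 4 → Fin 4 → Fin 4 → ℝ)
    (i j k l : Fin 4) :
    frame4 E (weylOf A R) i j k l = weylOf minkowski (frame4 E R) i j k l := by
  -- The factors are reordered so that the one carrying index `a` comes first, as `frame4_mul13` and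
  -- `frame4_mul14` expect.
  have e : weylOf A R = fun a b c d => R a b c d - (1 / 2) * (A a c * ricciOf A R b d
      + ricciOf A R a c * A b d - A a d * ricciOf A R b c - ricciOf A R a d * A b c)
      + (scalarOf A R / 6) * (A a c * A b d - A a d * A b c) := by
    funext a b c d
    rw [weylOf]; ring
  rw [e]
  simp only [frame4_add, frame4_sub, frame4_smul, frame4_mul13, frame4_mul14]
  rw [h.orthonormal, h.frame_ricciOf, h.frame_scalarOf, weylOf]
  ring

end IsOrientedFrame

lemma eq_zero_of_sum_smul_eq_zero {E : Mat4} (hE : IsUnit E.det) {f : Fin 4 → Mat4}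
    (hf : ∀ i, ∑ a, E a i • f a = 0) (a : Fin 4) : f a = 0 := by
  have hδ : ∀ a b : Fin 4, ∑ i, E a i * E⁻¹ i b = if a = b then 1 else 0 := by
    intro a b
    rw [← Matrix.mul_apply, Matrix.mul_nonsing_inv _ hE, Matrix.one_apply]
  have : ∑ i, E⁻¹ i a • ∑ b, E b i • f b = f a := by
    simp only [Finset.smul_sum, smul_smul]
    rw [Finset.sum_comm]
    simp only [← Finset.sum_smul]
    rw [Finset.sum_eq_single a]
    · rw [Finset.sum_congr rfl fun i _ => mul_comm _ _, hδ, if_pos rfl, one_smul]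
    · intro b _ hb
      rw [Finset.sum_congr rfl fun i _ => mul_comm _ _, hδ, if_neg hb, zero_smul]
    · simp
  rw [← this]
  simp [hf]

lemma conj_injective {E X Y : Mat4} (hE : IsUnit E.det) (h : Eᵀ * X * E = Eᵀ * Y * E) : X = Y := by
  have hE' : IsUnit E := (Matrix.isUnit_iff_isUnit_det _).mpr hE
  have hEt : IsUnit Eᵀ := by rw [Matrix.isUnit_iff_isUnit_det, Matrix.det_transpose]; exact hE
  exact hEt.mul_left_cancel (hE'.mul_right_cancel h)

lemma frame3_eq_zero {E : Mat4} (hE : IsUnit E.det) {T : Fin 4 → Mat4}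
    (h : ∀ i, frame3 E T i = 0) (a : Fin 4) : T a = 0 :=
  conj_injective hE (by
    rw [eq_zero_of_sum_smul_eq_zero hE (f := fun a => Eᵀ * T a * E) h a]; simp)

lemma frame4_eq_zero {E : Mat4} (hE : IsUnit E.det) {T : Fin 4 → Fin 4 → Fin 4 → Fin 4 → ℝ}
    (h : frame4 E T = 0) : T = 0 := by
  have h1 : ∀ a j, ∑ b, E b j • (Eᵀ * Matrix.of (T a b) * E) = 0 := fun a j =>
    eq_zero_of_sum_smul_eq_zero hE (f := fun a => ∑ b, E b j • (Eᵀ * Matrix.of (T a b) * E))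
      (fun i => by
        ext k l
        exact congrFun (congrFun (congrFun (congrFun h i) j) k) l) a
  funext a b
  have h5 : Matrix.of (T a b) = 0 := conj_injective hE (by
    rw [eq_zero_of_sum_smul_eq_zero hE (h1 a) b]; simp)
  exact h5

end

/-! ### The Levi-Civita symbol -/

/-- The determinant of four row vectors. -/
def det4 (v0 v1 v2 v3 : Fin 4 → ℝ) : ℝ := (Matrix.of ![v0, v1, v2, v3]).det

lemma det4_eq (v0 v1 v2 v3 : Fin 4 → ℝ) : det4 v0 v1 v2 v3 =
    v0 0 * v1 1 * v2 2 * v3 3 - v0 0 * v1 1 * v2 3 * v3 2 - v0 0 * v1 2 * v2 1 * v3 3 + v0 0 * v1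
      2 * v2 3 * v3 1 + v0 0 * v1 3 * v2 1 * v3 2 - v0 0 * v1 3 * v2 2 * v3 1 - v0 1 * v1 0 * v2 2
      * v3 3 + v0 1 * v1 0 * v2 3 * v3 2 + v0 1 * v1 2 * v2 0 * v3 3 - v0 1 * v1 2 * v2 3 * v3 0 -
      v0 1 * v1 3 * v2 0 * v3 2 + v0 1 * v1 3 * v2 2 * v3 0 + v0 2 * v1 0 * v2 1 * v3 3 - v0 2 *
      v1 0 * v2 3 * v3 1 - v0 2 * v1 1 * v2 0 * v3 3 + v0 2 * v1 1 * v2 3 * v3 0 + v0 2 * v1 3 *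
      v2 0 * v3 1 - v0 2 * v1 3 * v2 1 * v3 0 - v0 3 * v1 0 * v2 1 * v3 2 + v0 3 * v1 0 * v2 2 *
      v3 1 + v0 3 * v1 1 * v2 0 * v3 2 - v0 3 * v1 1 * v2 2 * v3 0 - v0 3 * v1 2 * v2 0 * v3 1 +
      v0 3 * v1 2 * v2 1 * v3 0 := by
  simp [det4, Matrix.det_succ_row_zero, Fin.sum_univ_succ, Matrix.submatrix_apply, Fin.succAbove]
  ring

lemma leviCivita_eq_det4 (a b c d : Fin 4) :
    leviCivita a b c d = det4 ((1 : Mat4) a) ((1 : Mat4) b) ((1 : Mat4) c) ((1 : Mat4) d) := by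
  unfold leviCivita det4
  congr 1
  ext i j
  fin_cases i <;> rfl

lemma leviCivita_swap12 (a b c d : Fin 4) : leviCivita a b c d = -leviCivita b a c d := by
  rw [leviCivita_eq_det4, leviCivita_eq_det4, det4_eq, det4_eq]; ring

lemma leviCivita_swap34 (a b c d : Fin 4) : leviCivita a b c d = -leviCivita a b d c := by
  rw [leviCivita_eq_det4, leviCivita_eq_det4, det4_eq, det4_eq]; ring

/-- The symbol is a determinant of rows of the identity. Multilinearity replaces these rows one at a
time by columns of `E`, and multiplicativity of the determinant extracts `E.det`. -/
lemma frame4_leviCivita (E : Mat4) (i j k l : Fin 4) :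
    frame4 E leviCivita i j k l = E.det * leviCivita i j k l := by
  have s0 : ∀ w v1 v2 v3 : Fin 4 → ℝ,
      ∑ a, w a * det4 ((1 : Mat4) a) v1 v2 v3 = det4 w v1 v2 v3 := by
    intro w v1 v2 v3
    simp only [det4_eq, Fin.sum_univ_four, Matrix.one_apply]
    simp
    ring
  have s1 : ∀ w v0 v2 v3 : Fin 4 → ℝ,
      ∑ a, w a * det4 v0 ((1 : Mat4) a) v2 v3 = det4 v0 w v2 v3 := by
    intro w v0 v2 v3
    simp only [det4_eq, Fin.sum_univ_four, Matrix.one_apply]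
    simp
    ring
  have s2 : ∀ w v0 v1 v3 : Fin 4 → ℝ,
      ∑ a, w a * det4 v0 v1 ((1 : Mat4) a) v3 = det4 v0 v1 w v3 := by
    intro w v0 v1 v3
    simp only [det4_eq, Fin.sum_univ_four, Matrix.one_apply]
    simp
    ring
  have s3 : ∀ w v0 v1 v2 : Fin 4 → ℝ,
      ∑ a, w a * det4 v0 v1 v2 ((1 : Mat4) a) = det4 v0 v1 v2 w := by
    intro w v0 v1 v2
    simp only [det4_eq, Fin.sum_univ_four, Matrix.one_apply]
    simp
    ring
  have h1 : frame4 E leviCivita i j k l = det4 (Eᵀ i) (Eᵀ j) (Eᵀ k) (Eᵀ l) := by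
    rw [frame4_apply]
    simp only [leviCivita_eq_det4, mul_assoc, ← Finset.mul_sum]
    have t3 : ∀ a b c, ∑ d, E d l * det4 ((1 : Mat4) a) ((1 : Mat4) b) ((1 : Mat4) c)
        ((1 : Mat4) d) = det4 ((1 : Mat4) a) ((1 : Mat4) b) ((1 : Mat4) c) (Eᵀ l) :=
      fun a b c => s3 (Eᵀ l) _ _ _
    have t2 : ∀ a b, ∑ c, E c k * det4 ((1 : Mat4) a) ((1 : Mat4) b) ((1 : Mat4) c) (Eᵀ l)
        = det4 ((1 : Mat4) a) ((1 : Mat4) b) (Eᵀ k) (Eᵀ l) := fun a b => s2 (Eᵀ k) _ _ _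
    have t1 : ∀ a, ∑ b, E b j * det4 ((1 : Mat4) a) ((1 : Mat4) b) (Eᵀ k) (Eᵀ l)
        = det4 ((1 : Mat4) a) (Eᵀ j) (Eᵀ k) (Eᵀ l) := fun a => s1 (Eᵀ j) _ _ _
    simp only [t3, t2, t1]
    exact s0 (Eᵀ i) _ _ _
  have h2 : Matrix.of ![Eᵀ i, Eᵀ j, Eᵀ k, Eᵀ l]
      = ((1 : Mat4).submatrix ![i, j, k, l] id) * Eᵀ := by
    have : ((1 : Mat4).submatrix ![i, j, k, l] id) * Eᵀ = (1 * Eᵀ).submatrix ![i, j, k, l] id := rfl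
    rw [this, Matrix.one_mul]
    ext m n
    fin_cases m <;> rfl
  rw [h1, det4, h2, Matrix.det_mul, Matrix.det_transpose, leviCivita, mul_comm]

lemma volForm_minkowski : volForm minkowski = leviCivita := by
  funext a b c d
  simp [volForm, det_minkowski]

/-- From `det A (det E)² = -1` one gets `√(-det A) · det E = 1`. Here the sign of `det E` matters: a
negatively oriented frame would reverse the Hodge dual. -/
lemma IsOrientedFrame.frame_volForm {A E : Mat4} (h : IsOrientedFrame A E) :
    frame4 E (volForm A) = volForm minkowski := by
  rw [volForm_minkowski]
  funext i j k l
  have : volForm A = fun a b c d => Real.sqrt (-A.det) * leviCivita a b c d := rfl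
  rw [this, frame4_smul, frame4_leviCivita, ← mul_assoc]
  have h1 : Real.sqrt (-A.det) * E.det = 1 := by
    rw [← Real.sqrt_sq h.det_pos.le, ← Real.sqrt_mul h.det_neg.le, neg_mul, h.det_mul, neg_neg,
      Real.sqrt_one]
  rw [h1, one_mul]

lemma hodge_minkowski {𝕜 : Type*} [AddCommGroup 𝕜] [Module ℝ 𝕜] (F : Matrix (Fin 4) (Fin 4) 𝕜)
    (a b : Fin 4) : hodge minkowski F a b = ∑ c, ∑ d,
      ((1 / 2 : ℝ) * leviCivita a b c d * minkowski c c * minkowski d d) • F c d := by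
  unfold hodge
  rw [minkowski_inv, volForm_minkowski]
  refine Finset.sum_congr rfl fun c _ => Finset.sum_congr rfl fun d _ => ?_
  rw [Finset.sum_eq_single c, Finset.sum_eq_single d]
  · intro f _ hf; simp [minkowski, Matrix.diagonal_apply_ne' _ hf]
  · simp
  · intro e _ he; simp [minkowski, Matrix.diagonal_apply_ne' _ he]
  · simp

lemma hodge_adaptedForm (α β : ℝ) :
    hodge minkowski (adaptedForm α β) = adaptedForm β (-α) := by
  have D1 : ∀ a c d, leviCivita a a c d = 0 := fun a c d => by linarith [leviCivita_swap12 a a c d]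
  have D2 : ∀ a b c, leviCivita a b c c = 0 := fun a b c => by linarith [leviCivita_swap34 a b c c]
  have L10 : ∀ c d, leviCivita 1 0 c d = -leviCivita 0 1 c d := leviCivita_swap12 1 0
  have L20 : ∀ c d, leviCivita 2 0 c d = -leviCivita 0 2 c d := leviCivita_swap12 2 0
  have L30 : ∀ c d, leviCivita 3 0 c d = -leviCivita 0 3 c d := leviCivita_swap12 3 0
  have L21 : ∀ c d, leviCivita 2 1 c d = -leviCivita 1 2 c d := leviCivita_swap12 2 1
  have L31 : ∀ c d, leviCivita 3 1 c d = -leviCivita 1 3 c d := leviCivita_swap12 3 1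
  have L32 : ∀ c d, leviCivita 3 2 c d = -leviCivita 2 3 c d := leviCivita_swap12 3 2
  have M10 : ∀ c d, leviCivita c d 1 0 = -leviCivita c d 0 1 := fun c d => leviCivita_swap34 c d 1 0
  have M20 : ∀ c d, leviCivita c d 2 0 = -leviCivita c d 0 2 := fun c d => leviCivita_swap34 c d 2 0
  have M30 : ∀ c d, leviCivita c d 3 0 = -leviCivita c d 0 3 := fun c d => leviCivita_swap34 c d 3 0
  have M21 : ∀ c d, leviCivita c d 2 1 = -leviCivita c d 1 2 := fun c d => leviCivita_swap34 c d 2 1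
  have M31 : ∀ c d, leviCivita c d 3 1 = -leviCivita c d 1 3 := fun c d => leviCivita_swap34 c d 3 1
  have M32 : ∀ c d, leviCivita c d 3 2 = -leviCivita c d 2 3 := fun c d => leviCivita_swap34 c d 3 2
  have w0101 : leviCivita 0 1 0 1 = 0 := by
    rw [leviCivita_eq_det4, det4_eq]; simp
  have w0102 : leviCivita 0 1 0 2 = 0 := by
    rw [leviCivita_eq_det4, det4_eq]; simp
  have w0103 : leviCivita 0 1 0 3 = 0 := by
    rw [leviCivita_eq_det4, det4_eq]; simp
  have w0112 : leviCivita 0 1 1 2 = 0 := by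
    rw [leviCivita_eq_det4, det4_eq]; simp
  have w0113 : leviCivita 0 1 1 3 = 0 := by
    rw [leviCivita_eq_det4, det4_eq]; simp
  have w0123 : leviCivita 0 1 2 3 = 1 := by
    rw [leviCivita_eq_det4, det4_eq]; simp
  have w0201 : leviCivita 0 2 0 1 = 0 := by
    rw [leviCivita_eq_det4, det4_eq]; simp
  have w0202 : leviCivita 0 2 0 2 = 0 := by
    rw [leviCivita_eq_det4, det4_eq]; simp
  have w0203 : leviCivita 0 2 0 3 = 0 := by
    rw [leviCivita_eq_det4, det4_eq]; simp
  have w0212 : leviCivita 0 2 1 2 = 0 := by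
    rw [leviCivita_eq_det4, det4_eq]; simp
  have w0213 : leviCivita 0 2 1 3 = -1 := by
    rw [leviCivita_eq_det4, det4_eq]; simp
  have w0223 : leviCivita 0 2 2 3 = 0 := by
    rw [leviCivita_eq_det4, det4_eq]; simp
  have w0301 : leviCivita 0 3 0 1 = 0 := by
    rw [leviCivita_eq_det4, det4_eq]; simp
  have w0302 : leviCivita 0 3 0 2 = 0 := by
    rw [leviCivita_eq_det4, det4_eq]; simp
  have w0303 : leviCivita 0 3 0 3 = 0 := by
    rw [leviCivita_eq_det4, det4_eq]; simp
  have w0312 : leviCivita 0 3 1 2 = 1 := by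
    rw [leviCivita_eq_det4, det4_eq]; simp
  have w0313 : leviCivita 0 3 1 3 = 0 := by
    rw [leviCivita_eq_det4, det4_eq]; simp
  have w0323 : leviCivita 0 3 2 3 = 0 := by
    rw [leviCivita_eq_det4, det4_eq]; simp
  have w1201 : leviCivita 1 2 0 1 = 0 := by
    rw [leviCivita_eq_det4, det4_eq]; simp
  have w1202 : leviCivita 1 2 0 2 = 0 := by
    rw [leviCivita_eq_det4, det4_eq]; simp
  have w1203 : leviCivita 1 2 0 3 = 1 := by
    rw [leviCivita_eq_det4, det4_eq]; simp
  have w1212 : leviCivita 1 2 1 2 = 0 := by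
    rw [leviCivita_eq_det4, det4_eq]; simp
  have w1213 : leviCivita 1 2 1 3 = 0 := by
    rw [leviCivita_eq_det4, det4_eq]; simp
  have w1223 : leviCivita 1 2 2 3 = 0 := by
    rw [leviCivita_eq_det4, det4_eq]; simp
  have w1301 : leviCivita 1 3 0 1 = 0 := by
    rw [leviCivita_eq_det4, det4_eq]; simp
  have w1302 : leviCivita 1 3 0 2 = -1 := by
    rw [leviCivita_eq_det4, det4_eq]; simp
  have w1303 : leviCivita 1 3 0 3 = 0 := by
    rw [leviCivita_eq_det4, det4_eq]; simp
  have w1312 : leviCivita 1 3 1 2 = 0 := by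
    rw [leviCivita_eq_det4, det4_eq]; simp
  have w1313 : leviCivita 1 3 1 3 = 0 := by
    rw [leviCivita_eq_det4, det4_eq]; simp
  have w1323 : leviCivita 1 3 2 3 = 0 := by
    rw [leviCivita_eq_det4, det4_eq]; simp
  have w2301 : leviCivita 2 3 0 1 = 1 := by
    rw [leviCivita_eq_det4, det4_eq]; simp
  have w2302 : leviCivita 2 3 0 2 = 0 := by
    rw [leviCivita_eq_det4, det4_eq]; simp
  have w2303 : leviCivita 2 3 0 3 = 0 := by
    rw [leviCivita_eq_det4, det4_eq]; simp
  have w2312 : leviCivita 2 3 1 2 = 0 := by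
    rw [leviCivita_eq_det4, det4_eq]; simp
  have w2313 : leviCivita 2 3 1 3 = 0 := by
    rw [leviCivita_eq_det4, det4_eq]; simp
  have w2323 : leviCivita 2 3 2 3 = 0 := by
    rw [leviCivita_eq_det4, det4_eq]; simp
  ext a b
  rw [hodge_minkowski]
  fin_cases a <;> fin_cases b
  all_goals
    simp [adaptedForm, minkowski, Fin.sum_univ_four, D1, D2, L10, L20, L30, L21, L31, L32, M10,
      M20, M30, M21, M31, M32, w0101, w0102, w0103, w0112, w0113, w0123, w0201, w0202, w0203,
      w0212, w0213, w0223, w0301, w0302, w0303, w0312, w0313, w0323, w1201, w1202, w1203, w1212,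
      w1213, w1223, w1301, w1302, w1303, w1312, w1313, w1323, w2301, w2302, w2303, w2312, w2313,
      w2323]
  all_goals ring

lemma isSelfDual_minkowski_iff (F : CMat4) :
    IsSelfDual minkowski F ↔ F = sdForm (F 0 1) (F 0 2) (F 0 3) := by
  have D1 : ∀ a c d, leviCivita a a c d = 0 := fun a c d => by linarith [leviCivita_swap12 a a c d]
  have D2 : ∀ a b c, leviCivita a b c c = 0 := fun a b c => by linarith [leviCivita_swap34 a b c c]
  have L10 : ∀ c d, leviCivita 1 0 c d = -leviCivita 0 1 c d := leviCivita_swap12 1 0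
  have L20 : ∀ c d, leviCivita 2 0 c d = -leviCivita 0 2 c d := leviCivita_swap12 2 0
  have L30 : ∀ c d, leviCivita 3 0 c d = -leviCivita 0 3 c d := leviCivita_swap12 3 0
  have L21 : ∀ c d, leviCivita 2 1 c d = -leviCivita 1 2 c d := leviCivita_swap12 2 1
  have L31 : ∀ c d, leviCivita 3 1 c d = -leviCivita 1 3 c d := leviCivita_swap12 3 1
  have L32 : ∀ c d, leviCivita 3 2 c d = -leviCivita 2 3 c d := leviCivita_swap12 3 2
  have M10 : ∀ c d, leviCivita c d 1 0 = -leviCivita c d 0 1 := fun c d => leviCivita_swap34 c d 1 0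
  have M20 : ∀ c d, leviCivita c d 2 0 = -leviCivita c d 0 2 := fun c d => leviCivita_swap34 c d 2 0
  have M30 : ∀ c d, leviCivita c d 3 0 = -leviCivita c d 0 3 := fun c d => leviCivita_swap34 c d 3 0
  have M21 : ∀ c d, leviCivita c d 2 1 = -leviCivita c d 1 2 := fun c d => leviCivita_swap34 c d 2 1
  have M31 : ∀ c d, leviCivita c d 3 1 = -leviCivita c d 1 3 := fun c d => leviCivita_swap34 c d 3 1
  have M32 : ∀ c d, leviCivita c d 3 2 = -leviCivita c d 2 3 := fun c d => leviCivita_swap34 c d 3 2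
  have w0101 : leviCivita 0 1 0 1 = 0 := by
    rw [leviCivita_eq_det4, det4_eq]; simp
  have w0102 : leviCivita 0 1 0 2 = 0 := by
    rw [leviCivita_eq_det4, det4_eq]; simp
  have w0103 : leviCivita 0 1 0 3 = 0 := by
    rw [leviCivita_eq_det4, det4_eq]; simp
  have w0112 : leviCivita 0 1 1 2 = 0 := by
    rw [leviCivita_eq_det4, det4_eq]; simp
  have w0113 : leviCivita 0 1 1 3 = 0 := by
    rw [leviCivita_eq_det4, det4_eq]; simp
  have w0123 : leviCivita 0 1 2 3 = 1 := by
    rw [leviCivita_eq_det4, det4_eq]; simp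
  have w0201 : leviCivita 0 2 0 1 = 0 := by
    rw [leviCivita_eq_det4, det4_eq]; simp
  have w0202 : leviCivita 0 2 0 2 = 0 := by
    rw [leviCivita_eq_det4, det4_eq]; simp
  have w0203 : leviCivita 0 2 0 3 = 0 := by
    rw [leviCivita_eq_det4, det4_eq]; simp
  have w0212 : leviCivita 0 2 1 2 = 0 := by
    rw [leviCivita_eq_det4, det4_eq]; simp
  have w0213 : leviCivita 0 2 1 3 = -1 := by
    rw [leviCivita_eq_det4, det4_eq]; simp
  have w0223 : leviCivita 0 2 2 3 = 0 := by
    rw [leviCivita_eq_det4, det4_eq]; simp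
  have w0301 : leviCivita 0 3 0 1 = 0 := by
    rw [leviCivita_eq_det4, det4_eq]; simp
  have w0302 : leviCivita 0 3 0 2 = 0 := by
    rw [leviCivita_eq_det4, det4_eq]; simp
  have w0303 : leviCivita 0 3 0 3 = 0 := by
    rw [leviCivita_eq_det4, det4_eq]; simp
  have w0312 : leviCivita 0 3 1 2 = 1 := by
    rw [leviCivita_eq_det4, det4_eq]; simp
  have w0313 : leviCivita 0 3 1 3 = 0 := by
    rw [leviCivita_eq_det4, det4_eq]; simp
  have w0323 : leviCivita 0 3 2 3 = 0 := by
    rw [leviCivita_eq_det4, det4_eq]; simp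
  have w1201 : leviCivita 1 2 0 1 = 0 := by
    rw [leviCivita_eq_det4, det4_eq]; simp
  have w1202 : leviCivita 1 2 0 2 = 0 := by
    rw [leviCivita_eq_det4, det4_eq]; simp
  have w1203 : leviCivita 1 2 0 3 = 1 := by
    rw [leviCivita_eq_det4, det4_eq]; simp
  have w1212 : leviCivita 1 2 1 2 = 0 := by
    rw [leviCivita_eq_det4, det4_eq]; simp
  have w1213 : leviCivita 1 2 1 3 = 0 := by
    rw [leviCivita_eq_det4, det4_eq]; simp
  have w1223 : leviCivita 1 2 2 3 = 0 := by
    rw [leviCivita_eq_det4, det4_eq]; simp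
  have w1301 : leviCivita 1 3 0 1 = 0 := by
    rw [leviCivita_eq_det4, det4_eq]; simp
  have w1302 : leviCivita 1 3 0 2 = -1 := by
    rw [leviCivita_eq_det4, det4_eq]; simp
  have w1303 : leviCivita 1 3 0 3 = 0 := by
    rw [leviCivita_eq_det4, det4_eq]; simp
  have w1312 : leviCivita 1 3 1 2 = 0 := by
    rw [leviCivita_eq_det4, det4_eq]; simp
  have w1313 : leviCivita 1 3 1 3 = 0 := by
    rw [leviCivita_eq_det4, det4_eq]; simp
  have w1323 : leviCivita 1 3 2 3 = 0 := by
    rw [leviCivita_eq_det4, det4_eq]; simp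
  have w2301 : leviCivita 2 3 0 1 = 1 := by
    rw [leviCivita_eq_det4, det4_eq]; simp
  have w2302 : leviCivita 2 3 0 2 = 0 := by
    rw [leviCivita_eq_det4, det4_eq]; simp
  have w2303 : leviCivita 2 3 0 3 = 0 := by
    rw [leviCivita_eq_det4, det4_eq]; simp
  have w2312 : leviCivita 2 3 1 2 = 0 := by
    rw [leviCivita_eq_det4, det4_eq]; simp
  have w2313 : leviCivita 2 3 1 3 = 0 := by
    rw [leviCivita_eq_det4, det4_eq]; simp
  have w2323 : leviCivita 2 3 2 3 = 0 := by
    rw [leviCivita_eq_det4, det4_eq]; simp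
  have hI := Complex.I_mul_I
  constructor
  · rintro ⟨h1, h2⟩
    have T' : ∀ a b, F b a = -F a b := fun a b => congrFun (congrFun h1 a) b
    have T0 : ∀ a, F a a = 0 := fun a => by
      have := T' a a
      linear_combination (1 / 2) * this
    have g := fun a b => congrFun (congrFun h2 a) b
    have g1 := g 2 3
    have g2 := g 1 3
    have g3 := g 1 2
    rw [hodge_minkowski] at g1 g2 g3
    simp [minkowski, Fin.sum_univ_four, T0, T' 0 1, T' 0 2, T' 0 3, T' 1 2, T' 1 3, T' 2 3, D2,
      M10, M20, M30, M21, M31, M32, w1201, w1202, w1203, w1212, w1213, w1223, w1301, w1302, w1303,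
      w1312, w1313, w1323, w2301, w2302, w2303, w2312, w2313, w2323]
      at g1 g2 g3
    have f1 : F 2 3 = Complex.I * F 0 1 := by linear_combination Complex.I * g1 + F 2 3 * hI
    have f2 : F 1 3 = -(Complex.I * F 0 2) := by
      linear_combination Complex.I * g2 + F 1 3 * hI
    have f3 : F 1 2 = Complex.I * F 0 3 := by linear_combination Complex.I * g3 + F 1 2 * hI
    ext a b
    fin_cases a <;> fin_cases b <;>
      simp [sdForm, T0, T' 0 1, T' 0 2, T' 0 3, T' 1 2, T' 1 3, T' 2 3, f1, f2, f3]
  · intro h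
    rw [h]
    generalize F 0 1 = u; generalize F 0 2 = v; generalize F 0 3 = w
    constructor
    · ext a b
      fin_cases a <;> fin_cases b <;> simp [sdForm]
    · ext a b
      rw [hodge_minkowski]
      fin_cases a <;> fin_cases b
      all_goals
        simp [sdForm, minkowski, Fin.sum_univ_four, D1, D2, L10, L20, L30, L21, L31, L32, M10,
          M20, M30, M21, M31, M32, w0101, w0102, w0103, w0112, w0113, w0123, w0201, w0202, w0203,
          w0212, w0213, w0223, w0301, w0302, w0303, w0312, w0313, w0323, w1201, w1202, w1203,
          w1212, w1213, w1223, w1301, w1302, w1303, w1312, w1313, w1323, w2301, w2302, w2303,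
          w2312, w2313, w2323]
      all_goals ring_nf
      all_goals try (simp only [Complex.I_sq]; ring)

section

/-! ### Transport of bivectors to an orthonormal frame -/

/-- The entrywise inclusion of real arrays in complex arrays. -/
def toC (A : Mat4) : CMat4 := A.map ((↑) : ℝ → ℂ)

lemma toC_mul (A B : Mat4) : toC (A * B) = toC A * toC B := by
  ext i j
  simp [toC, Matrix.mul_apply]

lemma toC_transpose (A : Mat4) : toC Aᵀ = (toC A)ᵀ := rfl

lemma toC_apply (A : Mat4) (i j : Fin 4) : toC A i j = (A i j : ℂ) := rfl

lemma toC_one : toC 1 = 1 := by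
  simp [toC]

lemma toC_injective : Function.Injective toC := by
  intro A B h
  ext i j
  have := congrFun (congrFun h i) j
  simpa [toC] using this

/-- The components of a complex bilinear form in the frame whose vectors are the columns of `E`. -/
def frameC (E : Mat4) : CMat4 →ₗ[ℂ] CMat4 where
  toFun F := (toC E)ᵀ * F * toC E
  map_add' F G := by rw [Matrix.mul_add, Matrix.add_mul]
  map_smul' c F := by simp

lemma frameC_apply (E : Mat4) (F : CMat4) : frameC E F = (toC E)ᵀ * F * toC E := rfl

lemma frameC_toC (E F : Mat4) : frameC E (toC F) = toC (Eᵀ * F * E) := by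
  rw [toC_mul, toC_mul, toC_transpose, frameC_apply]

lemma frameC_frameC (E N : Mat4) (F : CMat4) : frameC E (frameC N F) = frameC (N * E) F := by
  simp only [frameC_apply, toC_mul, Matrix.transpose_mul, Matrix.mul_assoc]

lemma frameC_one (F : CMat4) : frameC 1 F = F := by
  simp [frameC_apply, toC_one]

lemma frameC_transpose (E : Mat4) (F : CMat4) : (frameC E F)ᵀ = frameC E Fᵀ := by
  simp [frameC_apply, Matrix.mul_assoc]

namespace IsOrientedFrame

variable {A E : Mat4}

lemma frameC_inv (h : IsOrientedFrame A E) (F : CMat4) : frameC E (frameC E⁻¹ F) = F := by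
  rw [frameC_frameC, h.inv_mul, frameC_one]

lemma frameC_injective (h : IsOrientedFrame A E) : Function.Injective (frameC E) := by
  intro F F' hF
  have := congrArg (frameC E⁻¹) hF
  simpa only [frameC_frameC, h.mul_inv, frameC_one] using this

lemma doubleFormApply_eq (P : Fin 4 → Fin 4 → Fin 4 → Fin 4 → ℝ) (F : CMat4) (a b : Fin 4) :
    doubleFormApply A P F a b
      = (1 / 2) * ∑ c, ∑ d, (P a b c d : ℂ) * (toC A⁻¹ * F * (toC A⁻¹)ᵀ) c d := by
  rw [doubleFormApply, Finset.mul_sum]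
  refine Finset.sum_congr rfl fun c _ => ?_
  rw [Finset.mul_sum]
  refine Finset.sum_congr rfl fun d _ => ?_
  simp only [Matrix.mul_apply, Matrix.transpose_apply, toC_apply, Fin.sum_univ_four,
    Complex.real_smul]
  push_cast
  ring

lemma sum_mul_eq_trace (M X : CMat4) : ∑ c, ∑ d, M c d * X c d = (Mᵀ * X).trace := by
  rw [Finset.sum_comm]
  simp [Matrix.trace, Matrix.mul_apply]

lemma sum_mul_congr (M : Mat4) (E : Mat4) (Z : CMat4) :
    ∑ c, ∑ d, (M c d : ℂ) * (toC E * Z * (toC E)ᵀ) c d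
      = ∑ k, ∑ l, (toC (Eᵀ * M * E)) k l * Z k l := by
  have h : ∑ c, ∑ d, (M c d : ℂ) * (toC E * Z * (toC E)ᵀ) c d
      = ((toC M)ᵀ * (toC E * Z * (toC E)ᵀ)).trace := sum_mul_eq_trace (toC M) _
  rw [h, sum_mul_eq_trace, ← mul_assoc, Matrix.trace_mul_comm]
  congr 1
  simp only [toC_mul, toC_transpose, Matrix.transpose_mul, Matrix.transpose_transpose,
    Matrix.mul_assoc]

lemma sum_comm_pairs (f : Fin 4 → Fin 4 → Fin 4 → Fin 4 → ℂ) :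
    ∑ a, ∑ b, ∑ k, ∑ l, f a b k l = ∑ k, ∑ l, ∑ a, ∑ b, f a b k l := by
  calc ∑ a, ∑ b, ∑ k, ∑ l, f a b k l = ∑ a, ∑ k, ∑ b, ∑ l, f a b k l :=
        Finset.sum_congr rfl fun a _ => Finset.sum_comm
    _ = ∑ k, ∑ a, ∑ b, ∑ l, f a b k l := Finset.sum_comm
    _ = ∑ k, ∑ a, ∑ l, ∑ b, f a b k l :=
        Finset.sum_congr rfl fun k _ => Finset.sum_congr rfl fun a _ => Finset.sum_comm
    _ = ∑ k, ∑ l, ∑ a, ∑ b, f a b k l := Finset.sum_congr rfl fun k _ => Finset.sum_comm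

/-- Substituting `A⁻¹ = E η Eᵀ` moves the factors `E` from the contracted indices of `F` onto the
last two indices of `P`. The same lemma gives the covariance of the Hodge dual, which is the action
of `volForm`. -/
lemma frame_doubleFormApply (h : IsOrientedFrame A E)
    (P : Fin 4 → Fin 4 → Fin 4 → Fin 4 → ℝ) (F : CMat4) :
    frameC E (doubleFormApply A P F) = doubleFormApply minkowski (frame4 E P) (frameC E F) := by
  set Z : CMat4 := toC minkowski * frameC E F * (toC minkowski)ᵀ with hZ
  have h1 : toC A⁻¹ * F * (toC A⁻¹)ᵀ = toC E * Z * (toC E)ᵀ := by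
    rw [h.inv_eq, hZ, frameC_apply]
    simp only [toC_mul, toC_transpose, Matrix.transpose_mul, Matrix.transpose_transpose]
    simp only [Matrix.mul_assoc]
  have h2 : ∀ a b, doubleFormApply A P F a b
      = (1 / 2) * ∑ k, ∑ l, toC (Eᵀ * Matrix.of (P a b) * E) k l * Z k l := by
    intro a b
    rw [doubleFormApply_eq, h1, ← sum_mul_congr]
    rfl
  ext i j
  rw [doubleFormApply_eq, minkowski_inv, ← hZ, frameC_apply]
  have h3 : ∀ k l, (frame4 E P i j k l : ℂ)
      = ∑ a, (E a i : ℂ) * ∑ b, (E b j : ℂ) * toC (Eᵀ * Matrix.of (P a b) * E) k l := by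
    intro k l
    simp only [frame4, Matrix.sum_apply, Matrix.smul_apply, smul_eq_mul, toC_apply]
    push_cast
    rfl
  simp only [h3, Matrix.mul_apply (M := (toC E)ᵀ * _), Matrix.mul_apply (M := (toC E)ᵀ), h2,
    Matrix.transpose_apply]
  simp only [toC_apply E]
  simp only [Finset.mul_sum, Finset.sum_mul]
  rw [Finset.sum_comm, sum_comm_pairs]
  refine Finset.sum_congr rfl fun k _ => Finset.sum_congr rfl fun l _ => Finset.sum_congr rfl
    fun a _ => Finset.sum_congr rfl fun b _ => by ring

lemma frame_isSelfDual (h : IsOrientedFrame A E) (F : CMat4) :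
    IsSelfDual A F ↔ IsSelfDual minkowski (frameC E F) := by
  have e : ∀ F : CMat4, frameC E (hodge A F) = hodge minkowski (frameC E F) := by
    intro F
    have := h.frame_doubleFormApply (volForm A) F
    rw [h.frame_volForm] at this
    -- `hodge` on complex forms unfolds to `doubleFormApply` with the volume form.
    exact this
  unfold IsSelfDual
  rw [frameC_transpose, ← e, ← map_neg, ← map_smul, h.frameC_injective.eq_iff,
    h.frameC_injective.eq_iff]

lemma toC_hodge (A F : Mat4) : toC (hodge A F) = hodge A (toC F) := by
  ext a b
  simp [toC, hodge]

lemma frame_hodge (h : IsOrientedFrame A E) (F : Mat4) :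
    Eᵀ * hodge A F * E = hodge minkowski (Eᵀ * F * E) := by
  apply toC_injective
  rw [← frameC_toC, toC_hodge, toC_hodge, ← frameC_toC]
  have := h.frame_doubleFormApply (volForm A) (toC F)
  rw [h.frame_volForm] at this
  exact this

end IsOrientedFrame

/-! ### Adapted frames and the eigenbivectors of the Weyl tensor -/

/-- An oriented orthonormal frame whose first two vectors span the plane with projector `P`. -/
structure IsAdaptedFrame (A P E : Mat4) : Prop extends IsOrientedFrame A E where
  proj : P * E = E * planeProj

lemma eq_adaptedForm {U : Mat4} (hU : Uᵀ = -U) (h : U * minkowski * U = minkowski * planeProj) :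
    ∃ σ : ℝ, σ ^ 2 = 1 ∧ U = adaptedForm σ 0 := by
  have eU := eq_twoForm hU
  generalize U 0 1 = u at eU; generalize U 0 2 = p at eU; generalize U 0 3 = q at eU
  generalize U 1 2 = r at eU; generalize U 1 3 = s at eU; generalize U 2 3 = v at eU
  have g := fun a => congrFun (congrFun h a) a
  simp only [mul_minkowski_mul] at g
  have g0 := g 0
  have g1 := g 1
  have g2 := g 2
  simp [eU, twoForm, minkowski, planeProj] at g0 g1 g2
  -- The first two diagonal entries read `u² + p² + q² = 1` and `u² - r² - s² = 1`, so `p² + q² + r²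
  -- + s² = 0`. The third one, `p² = r² + v²`, then kills `v`.
  have hp : p = 0 := by nlinarith [sq_nonneg p, sq_nonneg q, sq_nonneg r, sq_nonneg s]
  have hq : q = 0 := by nlinarith [sq_nonneg p, sq_nonneg q, sq_nonneg r, sq_nonneg s]
  have hr : r = 0 := by nlinarith [sq_nonneg p, sq_nonneg q, sq_nonneg r, sq_nonneg s]
  have hs : s = 0 := by nlinarith [sq_nonneg p, sq_nonneg q, sq_nonneg r, sq_nonneg s]
  subst hp hq hr hs
  have hv : v = 0 := by nlinarith [sq_nonneg v]
  refine ⟨u, by nlinarith, ?_⟩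
  rw [eU, adaptedForm_eq, hv]

lemma IsAdaptedFrame.volumeElement {A P E U : Mat4} (h : IsAdaptedFrame A P E)
    (hU : IsVolumeElement A P U) : ∃ σ : ℝ, σ ^ 2 = 1 ∧ Eᵀ * U * E = adaptedForm σ 0 := by
  apply eq_adaptedForm
  · rw [Matrix.transpose_mul, Matrix.transpose_mul, Matrix.transpose_transpose, hU.1]
    noncomm_ring
  · calc Eᵀ * U * E * minkowski * (Eᵀ * U * E)
        = Eᵀ * (U * (E * minkowski * Eᵀ) * U) * E := by noncomm_ring
      _ = Eᵀ * A * (P * E) := by rw [← h.inv_eq, hU.2]; noncomm_ring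
      _ = minkowski * planeProj := by rw [h.proj, ← mul_assoc, h.orthonormal]

lemma smul_sdForm (c u v w : ℂ) : c • sdForm u v w = sdForm (c * u) (c * v) (c * w) := by
  ext a b
  fin_cases a <;> fin_cases b <;> simp [sdForm] <;> ring

lemma sdForm_add (u v w u' v' w' : ℂ) :
    sdForm u v w + sdForm u' v' w' = sdForm (u + u') (v + v') (w + w') := by
  ext a b
  fin_cases a <;> fin_cases b <;> simp [sdForm] <;> ring

lemma isSelfDual_sdForm (u v w : ℂ) : IsSelfDual minkowski (sdForm u v w) :=
  (isSelfDual_minkowski_iff _).mpr rfl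

/-- The eigenbasis is the standard basis of self-dual bivectors of Minkowski space, transported back
by `E⁻¹`. If `ρ = (x - iy)/2` vanished, so would `x` and `y`, hence all of `W`. -/
lemma isPrincipalPlane_of_components {A P E U : Mat4} (h : IsAdaptedFrame A P E)
    (hU : IsVolumeElement A P U) {W : Fin 4 → Fin 4 → Fin 4 → Fin 4 → ℝ} (hW0 : W ≠ 0) {x y : ℝ}
    (hW : TypeDComponents (frame4 E W) x y) : IsPrincipalPlane A W P := by
  obtain ⟨σ, hσ, hσU⟩ := h.volumeElement hU
  set ρ : ℂ := (x - Complex.I * y) / 2 with hρ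
  have hρ0 : ρ ≠ 0 := by
    intro h0
    have h1 : (x : ℂ) - Complex.I * y = 0 := by
      rw [hρ] at h0; simpa using h0
    have hx : x = 0 := by simpa using congrArg Complex.re h1
    have hy : y = 0 := by simpa using congrArg Complex.im h1
    subst hx hy
    exact hW0 (frame4_eq_zero h.isUnit_det hW.eq_zero)
  have hs2 : (Real.sqrt 2 : ℂ) ≠ 0 := by simp
  have hσ0 : (σ : ℂ) ≠ 0 := by
    intro h0
    have : σ = 0 := by exact_mod_cast h0
    rw [this] at hσ; norm_num at hσ
  set s : ℂ := 1 / (Real.sqrt 2 : ℂ) * σ with hs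
  -- The first basis vector is scaled by `s = σ/√2` because the frame components of `canonicalSD A
  -- U` are exactly `sdForm s 0 0`.
  have hs0 : s ≠ 0 := mul_ne_zero (one_div_ne_zero hs2) hσ0
  set B' : Fin 3 → CMat4 := ![sdForm s 0 0, sdForm 0 1 0, sdForm 0 0 1] with hB'
  set B : Fin 3 → CMat4 := fun i => frameC E⁻¹ (B' i) with hB
  have hBB' : ∀ i, frameC E (B i) = B' i := fun i => h.frameC_inv _
  have happ : ∀ u v w, frameC E (doubleFormApply A W (frameC E⁻¹ (sdForm u v w))) =
      sdForm (-2 * ρ * u) (ρ * v) (ρ * w) := by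
    intro u v w
    rw [h.frame_doubleFormApply, h.frameC_inv, hW.apply_sdForm]
  have hlin : LinearIndependent ℂ B' := by
    rw [Fintype.linearIndependent_iff]
    intro g hg
    rw [Fin.sum_univ_three] at hg
    have g0 := congrFun (congrFun hg 0) 1
    have g1 := congrFun (congrFun hg 0) 2
    have g2 := congrFun (congrFun hg 0) 3
    simp [hB', sdForm, hs0] at g0 g1 g2
    intro i
    fin_cases i <;> assumption
  refine ⟨ρ, hρ0, B, ⟨?_, ?_, ?_, ?_, ?_, ?_⟩, U, hU, ?_⟩
  · apply LinearIndependent.of_comp (frameC E)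
    have : (frameC E) ∘ B = B' := funext hBB'
    rw [this]
    exact hlin
  · intro i
    rw [h.frame_isSelfDual, hBB']
    fin_cases i <;> exact isSelfDual_sdForm _ _ _
  · intro F hF
    rw [h.frame_isSelfDual, isSelfDual_minkowski_iff] at hF
    rw [Submodule.mem_span_range_iff_exists_fun]
    refine ⟨![s⁻¹ * frameC E F 0 1, frameC E F 0 2, frameC E F 0 3], ?_⟩
    apply h.frameC_injective
    rw [map_sum, hF]
    generalize frameC E F 0 1 = u, frameC E F 0 2 = v, frameC E F 0 3 = w
    simp only [map_smul, hBB', Fin.sum_univ_three, hB']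
    change (s⁻¹ * u) • sdForm s 0 0 + v • sdForm 0 1 0 + w • sdForm 0 0 1 = sdForm u v w
    simp only [smul_sdForm, sdForm_add]
    congr 1 <;> field_simp <;> simp
  · apply h.frameC_injective
    rw [map_smul, hBB']
    refine (happ s 0 0).trans ?_
    change _ = (-2 * ρ) • sdForm s 0 0
    rw [smul_sdForm]
    simp
  · apply h.frameC_injective
    rw [map_smul, hBB']
    refine (happ 0 1 0).trans ?_
    change _ = ρ • sdForm 0 1 0
    rw [smul_sdForm]
    simp
  · apply h.frameC_injective
    rw [map_smul, hBB']
    refine (happ 0 0 1).trans ?_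
    change _ = ρ • sdForm 0 0 1
    rw [smul_sdForm]
    simp
  · apply h.frameC_injective
    rw [hBB']
    have h1 : canonicalSD A U = (1 / (Real.sqrt 2 : ℂ)) •
        (toC U - Complex.I • toC (hodge A U)) := by
      ext a b
      simp [canonicalSD, toC]
    rw [h1, map_smul, map_sub, map_smul, frameC_toC, frameC_toC, h.frame_hodge, hσU,
      hodge_adaptedForm]
    ext a b
    fin_cases a <;> fin_cases b <;> simp [hB', sdForm, toC, adaptedForm, hs] <;> ring

end

section

/-! ### The volume elements of the two planes -/

lemma conj_mul_inv_mul {A E : Mat4} (h : IsOrientedFrame A E) (X Y : Mat4) :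
    Eᵀ * (X * A⁻¹ * Y) * E = (Eᵀ * X * E) * minkowski * (Eᵀ * Y * E) := by
  rw [h.inv_eq]; noncomm_ring

lemma adaptedForm_transpose (α β : ℝ) : (adaptedForm α β)ᵀ = -adaptedForm α β := by
  ext i j
  fin_cases i <;> fin_cases j <;> simp [adaptedForm]

/-- In an adapted frame `U = σ θ⁰∧θ¹` and `*U = -σ θ²∧θ³`. The square of `*U` is minus the projector
on `H` since `H` is space-like, whereas `U² = v` on the time-like `V`. -/
lemma hodge_volumeElement {A P E U : Mat4} (h : IsAdaptedFrame A P E)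
    (hU : IsVolumeElement A P U) : (hodge A U)ᵀ = -hodge A U ∧ U * A⁻¹ * hodge A U = 0 ∧
      hodge A U * A⁻¹ * hodge A U = A * (P - 1) ∧ hodge A (hodge A U) = -U := by
  obtain ⟨σ, hσ, hσU⟩ := h.volumeElement hU
  have hV : Eᵀ * hodge A U * E = adaptedForm 0 (-σ) := by
    rw [h.frame_hodge, hσU, hodge_adaptedForm]
  refine ⟨?_, ?_, ?_, ?_⟩
  · apply conj_injective h.isUnit_det
    have : Eᵀ * (hodge A U)ᵀ * E = (Eᵀ * hodge A U * E)ᵀ := by simp [Matrix.mul_assoc]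
    rw [this, hV, adaptedForm_transpose, Matrix.mul_neg, Matrix.neg_mul, hV]
  · apply conj_injective h.isUnit_det
    rw [conj_mul_inv_mul h.toIsOrientedFrame, hσU, hV]
    ext i j
    rw [mul_minkowski_mul]
    fin_cases i <;> fin_cases j <;> simp [adaptedForm]
  · apply conj_injective h.isUnit_det
    have e : Eᵀ * (A * (P - 1)) * E = minkowski * (planeProj - 1) := by
      calc Eᵀ * (A * (P - 1)) * E = Eᵀ * A * (P * E) - Eᵀ * A * E := by noncomm_ring
        _ = (Eᵀ * A * E) * (planeProj - 1) := by rw [h.proj]; noncomm_ring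
        _ = _ := by rw [h.orthonormal]
    rw [conj_mul_inv_mul h.toIsOrientedFrame, hV, e]
    ext i j
    rw [mul_minkowski_mul]
    have hσ' : σ * σ = 1 := by rw [← hσ]; ring
    fin_cases i <;> fin_cases j <;>
      simp [adaptedForm, minkowski, planeProj, hσ']
  · apply conj_injective h.isUnit_det
    rw [h.frame_hodge, hV, hodge_adaptedForm, Matrix.mul_neg, Matrix.neg_mul, hσU]
    ext i j
    fin_cases i <;> fin_cases j <;> simp [adaptedForm]

lemma hodge_add (A F F' : Mat4) : hodge A (F + F') = hodge A F + hodge A F' := by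
  ext a b
  simp only [hodge, Matrix.add_apply, smul_add, Finset.sum_add_distrib]

lemma hodge_smul (A F : Mat4) (r : ℝ) : hodge A (r • F) = r • hodge A F := by
  ext a b
  simp only [hodge, Matrix.smul_apply, Finset.mul_sum, smul_eq_mul]
  refine Finset.sum_congr rfl fun c _ => Finset.sum_congr rfl fun d _ => Finset.sum_congr rfl
    fun e _ => Finset.sum_congr rfl fun f _ => by ring

lemma smoothMat_hodge {G U : E4 → Mat4} {y : E4} (hG : SmoothMat G y) (hU : SmoothMat U y)
    (hdet : 0 < -(G y).det) : SmoothMat (fun z => hodge (G z) (U z)) y := by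
  intro a b
  have hinv := hG.inv (by linarith : (G y).det < 0).ne
  have hsq : ContDiffAt ℝ ∞ (fun z => Real.sqrt (-(G z).det)) y := hG.det.neg.sqrt hdet.ne'
  simp only [hodge, volForm, smul_eq_mul]
  refine ContDiffAt.sum fun c _ => ContDiffAt.sum fun d _ => ContDiffAt.sum fun e _ =>
    ContDiffAt.sum fun f _ => ?_
  exact (((contDiffAt_const.mul (hsq.mul contDiffAt_const)).mul (hinv c e)).mul (hinv d f)).mul
    (hU e f)

section Structure

variable {G P U : E4 → Mat4} {y : E4}

/-- The relations between the covariant derivatives of the volume elements `U`, `*U` and of the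
projector `P`. -/
lemma cov_relations (hG : SmoothMat G y) (hs : ∀ᶠ z in 𝓝 y, (G z)ᵀ = G z)
    (hfr : ∀ᶠ z in 𝓝 y, ∃ E, IsAdaptedFrame (G z) (P z) E) (hU : SmoothMat U y)
    (hvol : ∀ᶠ z in 𝓝 y, IsVolumeElement (G z) (P z) (U z)) (e : Fin 4) :
    covF G U e y * (G y)⁻¹ * U y + U y * (G y)⁻¹ * covF G U e y = G y * covE G P e y ∧
    covF G U e y * (G y)⁻¹ * hodge (G y) (U y)
      + U y * (G y)⁻¹ * covF G (fun z => hodge (G z) (U z)) e y = 0 ∧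
    covF G (fun z => hodge (G z) (U z)) e y * (G y)⁻¹ * hodge (G y) (U y)
      + hodge (G y) (U y) * (G y)⁻¹ * covF G (fun z => hodge (G z) (U z)) e y
      = G y * covE G P e y := by
  set V : E4 → Mat4 := fun z => hodge (G z) (U z) with hVdef
  obtain ⟨E, hE⟩ := hfr.self_of_nhds
  have hdet : (G y).det ≠ 0 := hE.det_ne_zero
  have hV : SmoothMat V y := smoothMat_hodge hG hU hE.det_neg
  have hinv := hG.inv hdet
  have hu := hinv.mul hU
  have hGi : ∀ᶠ z in 𝓝 y, G z * (G z)⁻¹ = 1 ∧ (G z)⁻¹ * G z = 1 := hfr.mono fun z ⟨E, hz⟩ =>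
    ⟨Matrix.mul_nonsing_inv _ (isUnit_iff_ne_zero.mpr hz.det_ne_zero),
      Matrix.nonsing_inv_mul _ (isUnit_iff_ne_zero.mpr hz.det_ne_zero)⟩
  have hGy := hGi.self_of_nhds
  -- Raising an index commutes with `∇`, so each algebraic relation can be differentiated as a
  -- product of endomorphism fields `G⁻¹ F`.
  have hcov : ∀ F : E4 → Mat4, SmoothMat F y →
      covE G (fun z => (G z)⁻¹ * F z) e y = (G y)⁻¹ * covF G F e y := by
    intro F hF
    have h1 : covF G F e y = covF G (fun z => G z * ((G z)⁻¹ * F z)) e y :=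
      covF_congr (hGi.mono fun z hz => by rw [← mul_assoc, hz.1, one_mul]) e
    rw [h1, covF_mul hG (hinv.mul hF), covF_metric hs hdet, Matrix.zero_mul, zero_add, ← mul_assoc,
      hGy.2, one_mul]
  have hprod : ∀ F F' : E4 → Mat4, SmoothMat F y → SmoothMat F' y →
      G y * covE G (fun z => ((G z)⁻¹ * F z) * ((G z)⁻¹ * F' z)) e y
        = covF G F e y * (G y)⁻¹ * F' y + F y * (G y)⁻¹ * covF G F' e y := by
    intro F F' hF hF'
    rw [covE_mul (hinv.mul hF) (hinv.mul hF'), hcov F hF, hcov F' hF']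
    calc G y * ((G y)⁻¹ * covF G F e y * ((G y)⁻¹ * F' y)
          + (G y)⁻¹ * F y * ((G y)⁻¹ * covF G F' e y))
        = (G y * (G y)⁻¹) * (covF G F e y * (G y)⁻¹ * F' y + F y * (G y)⁻¹ * covF G F' e y) := by
          noncomm_ring
      _ = _ := by rw [hGy.1, one_mul]
  have hcan : ∀ z, (G z)⁻¹ * G z = 1 → ∀ X Y Z : Mat4, X * (G z)⁻¹ * Y = G z * Z →
      ((G z)⁻¹ * X) * ((G z)⁻¹ * Y) = Z := by
    intro z hz X Y Z h
    calc ((G z)⁻¹ * X) * ((G z)⁻¹ * Y) = (G z)⁻¹ * (X * (G z)⁻¹ * Y) := by noncomm_ring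
      _ = Z := by rw [h, ← mul_assoc, hz, one_mul]
  have hall := (hfr.and hvol).and hGi
  have huu : (fun z => ((G z)⁻¹ * U z) * ((G z)⁻¹ * U z)) =ᶠ[𝓝 y] P :=
    hall.mono fun z ⟨⟨_, h⟩, hz⟩ => hcan z hz.2 _ _ _ h.2
  have huv : (fun z => ((G z)⁻¹ * U z) * ((G z)⁻¹ * V z)) =ᶠ[𝓝 y] fun _ => 0 :=
    hall.mono fun z ⟨⟨⟨E, hz⟩, h⟩, hi⟩ =>
      hcan z hi.2 _ _ _ (by rw [Matrix.mul_zero]; exact (hodge_volumeElement hz h).2.1)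
  have hvv : (fun z => ((G z)⁻¹ * V z) * ((G z)⁻¹ * V z))
      =ᶠ[𝓝 y] fun z => ((G z)⁻¹ * U z) * ((G z)⁻¹ * U z) - 1 :=
    hall.mono fun z ⟨⟨⟨E, hz⟩, h⟩, hi⟩ => by
      simp only
      rw [hcan z hi.2 _ _ _ (hodge_volumeElement hz h).2.2.1, hcan z hi.2 _ _ _ h.2]
  have hone : SmoothMat (fun _ => (1 : Mat4)) y := fun a b => contDiffAt_const
  refine ⟨?_, ?_, ?_⟩
  · rw [← hprod U U hU hU, covE_congr huu]
  · have := hprod U V hU hV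
    rw [covE_congr huv, covE_zero, Matrix.mul_zero] at this
    exact this.symm
  · have := hprod V V hV hV
    rw [covE_congr hvv, covE_sub (hu.mul hu) hone, covE_const_one, sub_zero, covE_congr huu] at this
    exact this.symm

end Structure

/-! ### Umbilicity in a frame -/

/-- Contract the condition with `E`, `E` on the arguments and `E⁻¹` on the value. The projector
becomes the diagonal matrix `D`, so the sums over projected indices reduce to single terms. `D` is
kept general in order to treat both `V` and `H`. -/
lemma UmbilicalPlaneAt.frame {G P : E4 → Mat4} {y : E4} {E D : Mat4}
    (hE : IsOrientedFrame (G y) E) (hP : P y * E = E * D) (hD : ∀ i j, i ≠ j → D i j = 0)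
    (h : UmbilicalPlaneAt G P y) :
    FrameUmbilical D (fun i => ∑ e, E e i • (E⁻¹ * covE G P e y * E)) := by
  set S : Fin 4 → Mat4 := fun a => (1 - P y) * ∑ e, P y e a • covE G P e y with hS
  have hsf : ∀ a b c, secondFund G P y c a b = S a c b := by
    intro a b c
    simp only [secondFund, hS, Matrix.mul_apply, Matrix.sum_apply, Matrix.smul_apply, smul_eq_mul,
      Finset.mul_sum, mul_assoc]
    rw [Finset.sum_comm]
    rfl
  set Q : Fin 4 → Mat4 := fun i => ∑ e, E e i • (E⁻¹ * covE G P e y * E) with hQ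
  have hPi : E⁻¹ * (1 - P y) = (1 - D) * E⁻¹ := by
    have h1 : E⁻¹ * (P y * E) * E⁻¹ = D * E⁻¹ := by
      rw [hP, ← mul_assoc, hE.inv_mul, one_mul]
    have h2 : E⁻¹ * (P y * E) * E⁻¹ = E⁻¹ * P y := by
      rw [mul_assoc, mul_assoc, hE.mul_inv, mul_one]
    rw [mul_sub, sub_mul, ← h2, h1, mul_one, one_mul]
  have hfr : ∀ i, ∑ a, E a i • (E⁻¹ * S a * E) = (1 - D) * (D i i • Q i) := by
    intro i
    have h1 : ∀ a, E⁻¹ * S a * E = (1 - D) * ∑ e, P y e a • (E⁻¹ * covE G P e y * E) := by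
      intro a
      rw [hS]
      simp only
      rw [← mul_assoc, hPi, Finset.mul_sum, Finset.mul_sum, Finset.sum_mul]
      refine Finset.sum_congr rfl fun e _ => ?_
      simp only [Matrix.mul_smul, Matrix.smul_mul, mul_assoc]
    have h3 : ∀ a, E a i • ((1 - D) * ∑ e, P y e a • (E⁻¹ * covE G P e y * E))
        = (1 - D) * (E a i • ∑ e, P y e a • (E⁻¹ * covE G P e y * E)) :=
      fun a => (Matrix.mul_smul _ _ _).symm
    simp only [h1, h3, ← Finset.mul_sum]
    congr 1
    simp only [hQ, Finset.smul_sum, smul_smul]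
    rw [Finset.sum_comm]
    simp only [← Finset.sum_smul]
    refine Finset.sum_congr rfl fun e _ => ?_
    congr 1
    have h2 : (P y * E) e i = (E * D) e i := by rw [hP]
    rw [Matrix.mul_apply, Matrix.mul_apply] at h2
    have h4 : ∑ j, E e j * D j i = E e i * D i i :=
      Finset.sum_eq_single i (fun b _ hb => by rw [hD b i hb, mul_zero]) (by simp)
    rw [mul_comm (D i i), ← h4, ← h2]
    exact Finset.sum_congr rfl fun a _ => mul_comm _ _
  have hq : ∀ i j c, ∑ a, ∑ b, ∑ c', E⁻¹ c c' * E a i * E b j * S a c' b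
      = (1 - D) c c * D i i * Q i c j := by
    intro i j c
    have h1 := congrFun (congrFun (hfr i) c) j
    have h2 : ((1 - D) * D i i • Q i) c j = (1 - D) c c * (D i i • Q i) c j := by
      rw [Matrix.mul_apply]
      exact Finset.sum_eq_single c (fun b _ hb => by
        rw [Matrix.sub_apply, Matrix.one_apply_ne' hb, hD c b hb.symm]; simp) (by simp)
    rw [h2, Matrix.smul_apply, smul_eq_mul, ← mul_assoc] at h1
    rw [← h1]
    simp only [Matrix.sum_apply, Matrix.smul_apply, smul_eq_mul, Matrix.mul_apply,
      Finset.mul_sum, Finset.sum_mul]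
    refine Finset.sum_congr rfl fun a _ => Finset.sum_congr rfl fun b _ => Finset.sum_congr rfl
      fun c' _ => by ring
  intro i j c
  have hGP : minkowski * D = Eᵀ * (G y * P y) * E := by
    rw [show Eᵀ * (G y * P y) * E = Eᵀ * G y * (P y * E) by noncomm_ring, hP, ← mul_assoc,
      hE.orthonormal]
  have htr : ∀ c', ∑ m, ∑ n, (G y)⁻¹ m n * S m c' n
      = ∑ m, minkowski m m * ∑ a, ∑ b, E a m * E b m * S a c' b := by
    intro c'
    have := hE.contract (Matrix.of fun n m => S m c' n)
    simp only [Matrix.of_apply] at this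
    rw [this]
    refine Finset.sum_congr rfl fun m _ => ?_
    congr 1
    simp only [Matrix.mul_apply, Finset.sum_mul, Matrix.transpose_apply, Matrix.of_apply]
    refine Finset.sum_congr rfl fun a _ => Finset.sum_congr rfl fun b _ => by ring
  have hsum : ∑ m, minkowski m m * ((1 - D) c c * D m m * Q m c m)
      = ∑ c', E⁻¹ c c' * ∑ m, ∑ n, (G y)⁻¹ m n * S m c' n := by
    simp only [← hq, htr, Finset.mul_sum]
    symm
    rw [Finset.sum_comm]
    refine Finset.sum_congr rfl fun m _ => ?_
    rw [Finset.sum_comm]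
    refine Finset.sum_congr rfl fun a _ => ?_
    rw [Finset.sum_comm]
    refine Finset.sum_congr rfl fun b _ => Finset.sum_congr rfl fun c' _ => by ring
  have hsymm : ∑ a, ∑ b, ∑ c', E⁻¹ c c' * E a i * E b j
      * ((1 / 2) * (S a c' b + S b c' a)) = (1 / 2) * ((1 - D) c c * D i i * Q i c j
        + (1 - D) c c * D j j * Q j c i) := by
    rw [← hq, ← hq]
    rw [Finset.sum_comm (f := fun a b => ∑ c', E⁻¹ c c' * E a j * E b i * S a c' b)]
    simp only [← Finset.sum_add_distrib, Finset.mul_sum]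
    refine Finset.sum_congr rfl fun a _ => Finset.sum_congr rfl fun b _ => Finset.sum_congr rfl
      fun c' _ => by ring
  have hh : ∀ a b c', (1 / 2) * (S a c' b + S b c' a) = (1 / 2) * (G y * P y) a b
      * ∑ m, ∑ n, (G y)⁻¹ m n * S m c' n := by
    intro a b c'
    have := h a b c'
    simp only [hsf] at this
    exact this
  obtain ⟨t, ht⟩ : ∃ t : Fin 4 → ℝ, ∀ c', ∑ m, ∑ n, (G y)⁻¹ m n * S m c' n = t c' :=
    ⟨_, fun _ => rfl⟩
  rw [← hsymm, hsum, hGP]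
  simp only [hh, ht]
  generalize G y * P y = K
  simp only [Matrix.mul_apply, Matrix.transpose_apply, Fin.sum_univ_four]
  ring

end

section

/-! ### The conformal Killing-Yano form of an umbilical Maxwellian structure -/

lemma frame3_add (E : Mat4) (S T : Fin 4 → Mat4) (i : Fin 4) :
    frame3 E (fun a => S a + T a) i = frame3 E S i + frame3 E T i := by
  simp only [frame3, Matrix.mul_add, Matrix.add_mul, smul_add, Finset.sum_add_distrib]

lemma frame3_smul (E : Mat4) (r : ℝ) (T : Fin 4 → Mat4) (i : Fin 4) :
    frame3 E (fun a => r • T a) i = r • frame3 E T i := by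
  simp only [frame3, Matrix.mul_smul, Matrix.smul_mul, Finset.smul_sum, smul_comm r]

lemma frame3_sub (E : Mat4) (S T : Fin 4 → Mat4) (i : Fin 4) :
    frame3 E (fun a => S a - T a) i = frame3 E S i - frame3 E T i := by
  simp only [frame3, Matrix.mul_sub, Matrix.sub_mul, smul_sub, Finset.sum_sub_distrib]

lemma frame3_smul_const (E : Mat4) (φ : Fin 4 → ℝ) (U : Mat4) (i : Fin 4) :
    frame3 E (fun a => φ a • U) i = (∑ a, E a i * φ a) • (Eᵀ * U * E) := by
  simp only [frame3, Matrix.mul_smul, Matrix.smul_mul, smul_smul, Finset.sum_smul]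

lemma divergence_frame {A E : Mat4} (h : IsOrientedFrame A E) (X : Fin 4 → Mat4) (j : Fin 4) :
    ∑ b, E b j * ∑ e, ∑ a, A⁻¹ e a * X e a b = ∑ m, minkowski m m * frame3 E X m m j := by
  have h1 : ∀ b, ∑ e, ∑ a, A⁻¹ e a * X e a b
      = ∑ m, minkowski m m * ∑ e, ∑ a, E e m * E a m * X e a b := by
    intro b
    have := h.contract (Matrix.of fun a e => X e a b)
    simp only [Matrix.of_apply] at this
    rw [this]
    refine Finset.sum_congr rfl fun m _ => ?_
    congr 1
    simp only [Matrix.mul_apply, Finset.sum_mul, Matrix.transpose_apply, Matrix.of_apply]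
    refine Finset.sum_congr rfl fun a _ => Finset.sum_congr rfl fun b _ => by ring
  simp only [h1, frame3_apply, Finset.mul_sum]
  rw [Finset.sum_comm]
  refine Finset.sum_congr rfl fun m _ => ?_
  rw [Finset.sum_comm]
  refine Finset.sum_congr rfl fun e _ => ?_
  rw [Finset.sum_comm]
  exact Finset.sum_congr rfl fun a _ => Finset.sum_congr rfl fun b _ => by ring

/-- The condition is linear. Constant `r`, `s` suffice: by then the derivatives of the coefficients
in `Y` have already been absorbed into `S` and `T`. -/
lemma FrameKillingYano.combine {S T : Fin 4 → Mat4} (hS : FrameKillingYano S)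
    (hT : FrameKillingYano T) (r s : ℝ) : FrameKillingYano (fun i => r • S i + s • T i) := by
  intro a b c
  have h1 := hS a b c
  have h2 := hT a b c
  have e : ∀ c, ∑ m, minkowski m m * (r • S m + s • T m) m c
      = r * ∑ m, minkowski m m * S m m c + s * ∑ m, minkowski m m * T m m c := by
    intro c
    rw [Finset.mul_sum, Finset.mul_sum, ← Finset.sum_add_distrib]
    refine Finset.sum_congr rfl fun m _ => ?_
    simp only [Matrix.add_apply, Matrix.smul_apply, smul_eq_mul]
    ring
  simp only [e]
  simp only [Matrix.add_apply, Matrix.smul_apply, smul_eq_mul]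
  linear_combination r * h1 + s * h2

/-- The difference of the two sides is a 3-tensor with vanishing frame components, and `E` is
invertible. The factor `1/3` in `ξ` is what tracing the equation over `a, b` imposes. -/
lemma FrameKillingYano.of_frame {A E : Mat4} (h : IsOrientedFrame A E) {S : Fin 4 → Mat4}
    (hS : FrameKillingYano (frame3 E S)) {ξ : Fin 4 → ℝ}
    (hξ : ∀ b, ξ b = (1 / 3) * ∑ e, ∑ a, A⁻¹ e a * S e a b) (a b c : Fin 4) :
    S a b c + S b a c = 2 * A a b * ξ c - A a c * ξ b - A b c * ξ a := by
  set Z : Fin 4 → Mat4 := fun a => Matrix.of fun b c =>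
    S a b c + S b a c - (2 * (A a b * ξ c) - A a c * ξ b - A b c * ξ a) with hZ
  have hξ' : ∀ k, ∑ c, E c k * ξ c = (1 / 3) * ∑ m, minkowski m m * frame3 E S m m k := by
    intro k
    rw [← divergence_frame h, Finset.mul_sum]
    refine Finset.sum_congr rfl fun c _ => ?_
    rw [hξ]; ring
  have hsw : ∀ i j k, frame3 E S j i k = ∑ a, ∑ b, ∑ c, E a i * E b j * E c k * S b a c := by
    intro i j k
    rw [frame3_apply, Finset.sum_comm]
    refine Finset.sum_congr rfl fun a _ => Finset.sum_congr rfl fun b _ => Finset.sum_congr rfl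
      fun c _ => by ring
  have hprod : ∀ i j k, ∑ a, ∑ b, ∑ c, E a i * E b j * E c k * (A a b * ξ c)
      = minkowski i j * ∑ c, E c k * ξ c := by
    intro i j k
    rw [← h.orthonormal]
    simp only [Matrix.mul_apply, Matrix.transpose_apply, Fin.sum_univ_four]
    ring
  have hprod2 : ∀ i j k, ∑ a, ∑ b, ∑ c, E a i * E b j * E c k * (A a c * ξ b)
      = minkowski i k * ∑ c, E c j * ξ c := by
    intro i j k
    rw [← hprod]
    refine Finset.sum_congr rfl fun a _ => ?_
    rw [Finset.sum_comm]
    refine Finset.sum_congr rfl fun b _ => Finset.sum_congr rfl fun c _ => by ring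
  have hprod3 : ∀ i j k, ∑ a, ∑ b, ∑ c, E a i * E b j * E c k * (A b c * ξ a)
      = minkowski j k * ∑ c, E c i * ξ c := by
    intro i j k
    rw [← hprod2, Finset.sum_comm]
    refine Finset.sum_congr rfl fun a _ => Finset.sum_congr rfl fun b _ => Finset.sum_congr rfl
      fun c _ => by ring
  have hZ0 : ∀ i, frame3 E Z i = 0 := by
    intro i
    ext j k
    have e : frame3 E Z i j k = frame3 E S i j k + frame3 E S j i k
        - (2 * (minkowski i j * ∑ c, E c k * ξ c) - minkowski i k * ∑ c, E c j * ξ c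
          - minkowski j k * ∑ c, E c i * ξ c) := by
      rw [hsw i j k, ← hprod i j k, ← hprod2 i j k, ← hprod3 i j k, frame3_apply, frame3_apply]
      simp only [Finset.mul_sum, ← Finset.sum_add_distrib, ← Finset.sum_sub_distrib]
      refine Finset.sum_congr rfl fun a _ => Finset.sum_congr rfl fun b _ => Finset.sum_congr rfl
        fun c _ => ?_
      simp only [hZ, Matrix.of_apply]
      ring
    rw [e, hS i j k, hξ', hξ', hξ', Matrix.zero_apply]
    ring
  have := congrFun (congrFun (frame3_eq_zero h.isUnit_det hZ0 a) b) c
  simp only [hZ, Matrix.of_apply, Matrix.zero_apply] at this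
  linarith

/-! ### From Maxwell's equations to the Killing-Yano equation -/

section Maxwell

variable {G P U : E4 → Mat4} {φ ψ : E4 → ℝ} {y : E4}

/-- The source-free Maxwell equations for `e^φ (cos ψ U + sin ψ *U)`, in terms of the derivatives
of `U`, `*U`, `φ` and `ψ`. -/
lemma MaxwellAt.divergence {V : E4 → Mat4} (hU : SmoothMat U y) (hV : SmoothMat V y)
    (hVU : ∀ᶠ z in 𝓝 y, hodge (G z) (U z) = V z ∧ hodge (G z) (V z) = -U z)
    (hφ : ContDiffAt ℝ ∞ φ y) (hψ : ContDiffAt ℝ ∞ ψ y)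
    (hM : MaxwellAt G (fun z => Real.exp (φ z) •
        (Real.cos (ψ z) • U z + Real.sin (ψ z) • hodge (G z) (U z))) y) (b : Fin 4) :
    ∑ e, ∑ a, (G y)⁻¹ e a * (covF G U e y + pderiv e φ y • U y + pderiv e ψ y • V y) a b = 0 ∧
    ∑ e, ∑ a, (G y)⁻¹ e a * (covF G V e y + pderiv e φ y • V y - pderiv e ψ y • U y) a b = 0 := by
  have hdφ : DifferentiableAt ℝ φ y := hφ.differentiableAt (by simp)
  have hdψ : DifferentiableAt ℝ ψ y := hψ.differentiableAt (by simp)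
  -- Used for the pair `(U, V)`, which gives `F`, and for `(V, -U)`, which gives `*F` because `** =
  -- -1` on these forms.
  have key : ∀ A B : E4 → Mat4, SmoothMat A y → SmoothMat B y → ∀ e,
      covF G (fun z => Real.exp (φ z) • (Real.cos (ψ z) • A z + Real.sin (ψ z) • B z)) e y
      = Real.exp (φ y) • (Real.cos (ψ y) • (covF G A e y + pderiv e φ y • A y + pderiv e ψ y • B y)
        + Real.sin (ψ y) • (covF G B e y + pderiv e φ y • B y - pderiv e ψ y • A y)) := by
    intro A B hA hB e
    have s1 := hA.smul hψ.cos
    have s2 := hB.smul hψ.sin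
    rw [covF_smul hφ.exp (s1.add s2), covF_add s1 s2, covF_smul hψ.cos hA, covF_smul hψ.sin hB,
      pderiv_comp (Real.hasDerivAt_exp _) hdφ, pderiv_comp (Real.hasDerivAt_cos _) hdψ,
      pderiv_comp (Real.hasDerivAt_sin _) hdψ]
    module
  have hF1 : (fun z => Real.exp (φ z) •
      (Real.cos (ψ z) • U z + Real.sin (ψ z) • hodge (G z) (U z))) =ᶠ[𝓝 y]
      fun z => Real.exp (φ z) • (Real.cos (ψ z) • U z + Real.sin (ψ z) • V z) :=
    hVU.mono fun z hz => by simp only [hz.1]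
  have hF2 : (fun z => hodge (G z) (Real.exp (φ z) •
      (Real.cos (ψ z) • U z + Real.sin (ψ z) • hodge (G z) (U z)))) =ᶠ[𝓝 y]
      fun z => Real.exp (φ z) • (Real.cos (ψ z) • V z + Real.sin (ψ z) • (fun z => -U z) z) :=
    hVU.mono fun z hz => by simp only [hz.1, hodge_smul, hodge_add, hz.2]
  have hU' : SmoothMat (fun z => -U z) y := fun a b => (hU a b).neg
  have hcU : ∀ e, covF G (fun z => -U z) e y = -covF G U e y := by
    intro e
    have : mderiv e (fun z => -U z) y = -mderiv e U y := by
      ext a b; exact pderiv_neg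
    rw [covF_eq, covF_eq, this]
    noncomm_ring
  obtain ⟨m1, m2⟩ := hM b
  have d1 : divForm G (fun z => Real.exp (φ z) •
      (Real.cos (ψ z) • U z + Real.sin (ψ z) • hodge (G z) (U z))) y b
      = ∑ e, ∑ a, (G y)⁻¹ e a * covF G (fun z => Real.exp (φ z) •
        (Real.cos (ψ z) • U z + Real.sin (ψ z) • V z)) e y a b := by
    simp only [← covF_congr hF1]; rfl
  have d2 : divForm G (fun z => hodge (G z) (Real.exp (φ z) •
      (Real.cos (ψ z) • U z + Real.sin (ψ z) • hodge (G z) (U z)))) y b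
      = ∑ e, ∑ a, (G y)⁻¹ e a * covF G (fun z => Real.exp (φ z) •
        (Real.cos (ψ z) • V z + Real.sin (ψ z) • (fun z => -U z) z)) e y a b := by
    simp only [← covF_congr hF2]; rfl
  rw [d1] at m1
  rw [d2] at m2
  simp only [key _ _ hU hV] at m1
  simp only [key _ _ hV hU', hcU] at m2
  set p := ∑ e, ∑ a, (G y)⁻¹ e a
    * (covF G U e y + pderiv e φ y • U y + pderiv e ψ y • V y) a b with hp
  set q := ∑ e, ∑ a, (G y)⁻¹ e a
    * (covF G V e y + pderiv e φ y • V y - pderiv e ψ y • U y) a b with hq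
  have n1 : Real.exp (φ y) * (Real.cos (ψ y) * p + Real.sin (ψ y) * q) = 0 := by
    rw [← m1, hp, hq]
    simp only [Finset.mul_sum, ← Finset.sum_add_distrib]
    refine Finset.sum_congr rfl fun e _ => Finset.sum_congr rfl fun a _ => ?_
    simp only [Matrix.add_apply, Matrix.sub_apply, Matrix.smul_apply, smul_eq_mul]
    ring
  have n2 : Real.exp (φ y) * (Real.cos (ψ y) * q - Real.sin (ψ y) * p) = 0 := by
    rw [← m2, hp, hq]
    simp only [Finset.mul_sum, ← Finset.sum_sub_distrib]
    refine Finset.sum_congr rfl fun e _ => Finset.sum_congr rfl fun a _ => ?_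
    simp only [Matrix.add_apply, Matrix.sub_apply, Matrix.smul_apply, Matrix.neg_apply,
      smul_eq_mul]
    ring
  have hexp := (Real.exp_pos (φ y)).ne'
  have n1' := (mul_eq_zero.mp n1).resolve_left hexp
  have n2' := (mul_eq_zero.mp n2).resolve_left hexp
  have hcs := Real.cos_sq_add_sin_sq (ψ y)
  -- After division by `e^φ`, the two Maxwell equations are the unknown divergences `p, q` rotated
  -- by the angle `ψ`; the rotation is invertible.
  refine eq_zero_of_rotation (α := Real.sin (ψ y)) (β := Real.cos (ψ y)) ?_ n1' ?_
  · rw [add_comm, hcs]; exact one_ne_zero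
  · linarith

/-- The 2-form `e^{-φ/2} (cos (ψ/2) U - sin (ψ/2) *U)`. -/
def killingYanoForm (G U : E4 → Mat4) (φ ψ : E4 → ℝ) (z : E4) : Mat4 :=
  Real.exp (-φ z / 2) • (Real.cos (ψ z / 2) • U z - Real.sin (ψ z / 2) • hodge (G z) (U z))

lemma covF_killingYanoForm (hU : SmoothMat U y) (hV : SmoothMat (fun z => hodge (G z) (U z)) y)
    (hφ : ContDiffAt ℝ ∞ φ y) (hψ : ContDiffAt ℝ ∞ ψ y) (e : Fin 4) :
    covF G (killingYanoForm G U φ ψ) e y =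
      (Real.exp (-φ y / 2) * Real.cos (ψ y / 2)) • (covF G U e y - (pderiv e φ y / 2) • U y
        - (pderiv e ψ y / 2) • hodge (G y) (U y))
      + (-(Real.exp (-φ y / 2) * Real.sin (ψ y / 2))) •
        (covF G (fun z => hodge (G z) (U z)) e y - (pderiv e φ y / 2) • hodge (G y) (U y)
        + (pderiv e ψ y / 2) • U y) := by
  set V : E4 → Mat4 := fun z => hodge (G z) (U z) with hVd
  have hψ2 : ContDiffAt ℝ ∞ (fun z => ψ z / 2) y := hψ.div_const 2
  have hφ2 : ContDiffAt ℝ ∞ (fun z => -φ z / 2) y := hφ.neg.div_const 2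
  have s1 := hU.smul hψ2.cos
  have s2 := hV.smul hψ2.sin
  have hdφ : DifferentiableAt ℝ φ y := hφ.differentiableAt (by simp)
  have hdψ : DifferentiableAt ℝ ψ y := hψ.differentiableAt (by simp)
  have p1 : pderiv e (fun z => ψ z / 2) y = pderiv e ψ y / 2 := by
    rw [pderiv_comp ((hasDerivAt_id' (ψ y)).div_const 2) hdψ]; ring
  have p2 : pderiv e (fun z => -φ z / 2) y = -pderiv e φ y / 2 := by
    have h : HasDerivAt (fun t : ℝ => -t / 2) (-1 / 2) (φ y) :=
      (hasDerivAt_neg (φ y)).div_const 2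
    rw [pderiv_comp h hdφ]; ring
  have e0 : killingYanoForm G U φ ψ = fun z => Real.exp (-φ z / 2) •
      (Real.cos (ψ z / 2) • U z - Real.sin (ψ z / 2) • V z) := rfl
  rw [e0, covF_smul hφ2.exp (s1.sub s2), covF_sub s1 s2, covF_smul hψ2.cos hU,
    covF_smul hψ2.sin hV, pderiv_comp (f := fun z => -φ z / 2) (Real.hasDerivAt_exp _)
      (hφ2.differentiableAt (by simp)),
    pderiv_comp (f := fun z => ψ z / 2) (Real.hasDerivAt_cos _) (hψ2.differentiableAt (by simp)),
    pderiv_comp (f := fun z => ψ z / 2) (Real.hasDerivAt_sin _) (hψ2.differentiableAt (by simp)),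
    p1, p2]
  module

/-- The algebraic relations, umbilicity and Maxwell's equations at `y` are rewritten in an adapted
frame at `y`, where `frame_killingYano` applies. Its two conclusions, combined with the pointwise
coefficients of `∇Y`, give the Killing-Yano equation back in coordinates. -/
lemma killingYanoAt_of_maxwell (hG : SmoothMat G y) (hs : ∀ᶠ z in 𝓝 y, (G z)ᵀ = G z)
    (hfr : ∀ᶠ z in 𝓝 y, ∃ E, IsAdaptedFrame (G z) (P z) E) (hP : SmoothMat P y)
    (hU : SmoothMat U y)
    (hvol : ∀ᶠ z in 𝓝 y, IsVolumeElement (G z) (P z) (U z))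
    (hφ : ContDiffAt ℝ ∞ φ y) (hψ : ContDiffAt ℝ ∞ ψ y)
    (hu : UmbilicalPlaneAt G P y) (hu' : UmbilicalPlaneAt G (fun z => 1 - P z) y)
    (hM : MaxwellAt G (fun z => Real.exp (φ z) •
        (Real.cos (ψ z) • U z + Real.sin (ψ z) • hodge (G z) (U z))) y) :
    KillingYanoAt G (killingYanoForm G U φ ψ)
      (fun c z => (1 / 3) * divForm G (killingYanoForm G U φ ψ) z c) y := by
  obtain ⟨E, hE⟩ := hfr.self_of_nhds
  have hE' := hE.toIsOrientedFrame
  set V : E4 → Mat4 := fun z => hodge (G z) (U z) with hVd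
  have hV : SmoothMat V y := smoothMat_hodge hG hU hE'.det_neg
  have hVU : ∀ᶠ z in 𝓝 y, hodge (G z) (U z) = V z ∧ hodge (G z) (V z) = -U z :=
    (hfr.and hvol).mono fun z ⟨⟨_, hz⟩, h⟩ => ⟨rfl, (hodge_volumeElement hz h).2.2.2⟩
  have hVanti : ∀ᶠ z in 𝓝 y, (V z)ᵀ = -V z :=
    (hfr.and hvol).mono fun z ⟨⟨_, hz⟩, h⟩ => (hodge_volumeElement hz h).1
  have hMd := MaxwellAt.divergence hU hV hVU hφ hψ hM
  have hrel := cov_relations hG hs hfr hU hvol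
  obtain ⟨σ, hσ, hσU⟩ := hE.volumeElement hvol.self_of_nhds
  have hσV : Eᵀ * V y * E = adaptedForm 0 (-σ) := by
    simp only [hVd]
    rw [hE'.frame_hodge, hσU, hodge_adaptedForm]
  set T : Fin 4 → Mat4 := fun e => covF G U e y with hT
  set W : Fin 4 → Mat4 := fun e => covF G V e y with hW
  set Q : Fin 4 → Mat4 := fun i => ∑ e, E e i • (E⁻¹ * covE G P e y * E) with hQ
  have hanti : ∀ X : Fin 4 → Mat4, (∀ e, (X e)ᵀ = -X e) → ∀ i, (frame3 E X i)ᵀ = -frame3 E X i := by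
    intro X hX i
    simp only [frame3, Matrix.transpose_sum, Matrix.transpose_smul, Matrix.transpose_mul,
      Matrix.transpose_transpose, hX, ← Finset.sum_neg_distrib]
    refine Finset.sum_congr rfl fun e _ => ?_
    simp [Matrix.mul_assoc]
  have hleft : ∀ (X : Fin 4 → Mat4) (Y : Mat4) (i : Fin 4),
      frame3 E X i * minkowski * (Eᵀ * Y * E) = frame3 E (fun e => X e * (G y)⁻¹ * Y) i := by
    intro X Y i
    simp only [frame3, Finset.sum_mul, Matrix.smul_mul, conj_mul_inv_mul hE']
  have hright : ∀ (X : Fin 4 → Mat4) (Y : Mat4) (i : Fin 4),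
      (Eᵀ * Y * E) * minkowski * frame3 E X i = frame3 E (fun e => Y * (G y)⁻¹ * X e) i := by
    intro X Y i
    simp only [frame3, Finset.mul_sum, Matrix.mul_smul, conj_mul_inv_mul hE']
  have hQ' : ∀ i, minkowski * Q i = frame3 E (fun e => G y * covE G P e y) i := by
    intro i
    simp only [hQ, frame3, Finset.mul_sum, Matrix.mul_smul]
    refine Finset.sum_congr rfl fun e _ => ?_
    congr 1
    rw [← hE'.orthonormal]
    calc Eᵀ * G y * E * (E⁻¹ * covE G P e y * E)
        = Eᵀ * G y * (E * E⁻¹) * covE G P e y * E := by noncomm_ring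
      _ = _ := by rw [hE'.mul_inv]; noncomm_ring
  have hone : SmoothMat (fun _ => (1 : Mat4)) y := fun a b => contDiffAt_const
  have hD : ∀ i j : Fin 4, i ≠ j → planeProj i j = 0 := fun i j hij =>
    Matrix.diagonal_apply_ne _ hij
  have hu1 : FrameUmbilical planeProj Q := hu.frame hE' hE.proj hD
  have hu2 : FrameUmbilical (1 - planeProj) (fun i => -Q i) := by
    have h1 := hu'.frame hE' (D := 1 - planeProj) (by
      simp only [sub_mul, mul_sub, hE.proj, one_mul, mul_one])
      (fun i j hij => by rw [Matrix.sub_apply, Matrix.one_apply_ne hij, hD i j hij, sub_zero])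
    have h2 : (fun i => -Q i) = fun i => ∑ e, E e i •
        (E⁻¹ * covE G (fun z => 1 - P z) e y * E) := by
      funext i
      simp only [hQ, ← Finset.sum_neg_distrib, covE_sub hone hP, covE_const_one, zero_sub,
        Matrix.mul_neg, Matrix.neg_mul, smul_neg]
    rw [h2]
    exact h1
  have hdiv : ∀ X : Fin 4 → Mat4, (∀ b, ∑ e, ∑ a, (G y)⁻¹ e a * X e a b = 0) →
      ∀ j, ∑ m, minkowski m m * frame3 E X m m j = 0 := by
    intro X hX j
    rw [← divergence_frame hE']
    simp [hX]
  have hfk := frame_killingYano (σ := σ) hσ (T := frame3 E T) (W := frame3 E W) (Q := Q)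
    (φ := fun i => ∑ a, E a i * pderiv a φ y) (ψ := fun i => ∑ a, E a i * pderiv a ψ y)
    (hanti T fun e => covF_antisymm (hvol.mono fun z h => h.1) e)
    (hanti W fun e => covF_antisymm hVanti e)
    (fun i => by
      rw [← hσU, hleft, hright, hQ', ← frame3_add]
      congr 1
      funext e
      exact (hrel e).1)
    (fun i => by
      rw [← hσU, ← hσV, hleft, hright, ← frame3_add]
      have : (fun e => T e * (G y)⁻¹ * V y + U y * (G y)⁻¹ * W e) = fun _ => 0 := by
        funext e
        exact (hrel e).2.1
      rw [this]
      simp [frame3])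
    (fun i => by
      rw [← hσV, hleft, hright, hQ', ← frame3_add]
      congr 1
      funext e
      exact (hrel e).2.2)
    hu1 hu2
    (fun b => by
      have := hdiv _ (fun b => (hMd b).1) b
      simpa only [frame3_add, frame3_smul_const, hσU, hσV] using this)
    (fun b => by
      have := hdiv _ (fun b => (hMd b).2) b
      simpa only [frame3_add, frame3_sub, frame3_smul_const, hσU, hσV] using this)
  set r := Real.exp (-φ y / 2) * Real.cos (ψ y / 2)
  set s := -(Real.exp (-φ y / 2) * Real.sin (ψ y / 2))
  have hcov : ∀ e, covF G (killingYanoForm G U φ ψ) e y = _ :=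
    covF_killingYanoForm hU hV hφ hψ
  have hS : FrameKillingYano (frame3 E fun e => covF G (killingYanoForm G U φ ψ) e y) := by
    have h1 := hfk.1.combine hfk.2 r s
    convert h1 using 1
    funext i
    simp only [hcov]
    have c1 : ∀ (f : E4 → ℝ) (X : Mat4), frame3 E (fun e => (pderiv e f y / 2) • X) i
        = ((∑ a, E a i * pderiv a f y) / 2) • (Eᵀ * X * E) := by
      intro f X
      rw [frame3_smul_const, Finset.sum_div]
      congr 1
      exact Finset.sum_congr rfl fun a _ => by ring
    rw [frame3_add, frame3_smul, frame3_smul, frame3_add, frame3_sub, frame3_sub, frame3_sub, c1,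
      c1, c1, c1, hσU, show Eᵀ * hodge (G y) (U y) * E = adaptedForm 0 (-σ) from hσV]
  intro a b c
  exact hS.of_frame hE' (fun b => rfl) a b c

end Maxwell

end

section

/-! ### The Weyl tensor of an umbilical Maxwellian structure, in coordinates -/

/-- Both integrability conditions are tensorial in `H`, `X`, `Y` and `R`, so they keep their form in
the frame, where the elimination of `frame_integrability` takes place. -/
lemma frame_integrability_of_components {A E Y X : Mat4} (h : IsOrientedFrame A E) {α β : ℝ}
    (hαβ : α ^ 2 + β ^ 2 ≠ 0) {R : Fin 4 → Fin 4 → Fin 4 → Fin 4 → ℝ} (hR : IsCurvatureLike R)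
    {H : Fin 4 → Fin 4 → Mat4} (hY : Eᵀ * Y * E = adaptedForm α β)
    (hH : ∀ d a, (H d a)ᵀ = -H d a)
    (hZ : ∀ d a b c, H d a b c + H d b a c =
      2 * A a b * X d c - A a c * X d b - A b c * X d a)
    (hC : ∀ d a, H d a - H a d =
      Matrix.of (R d a) * A⁻¹ * Y - Y * A⁻¹ * Matrix.of (R d a)) :
    ∃ x y, TypeDComponents (weylOf minkowski (frame4 E R)) x y := by
  have hR' := hR.frame E
  set T : Fin 4 → Fin 4 → Fin 4 → Fin 4 → ℝ := fun d a => H d a with hT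
  refine typeDComponents_of_integrability hR'
    (frame_integrability hαβ hR' (H := fun i j => Matrix.of (frame4 E T i j)) (X := Eᵀ * X * E)
      ?_ ?_ ?_)
  · intro i j
    ext k l
    simp only [Matrix.transpose_apply, Matrix.of_apply, Matrix.neg_apply]
    rw [← frame4_swap34, ← frame4_neg]
    congr 2
    funext d a b c
    exact congrFun (congrFun (hH d a) b) c
  · intro i j k l
    simp only [Matrix.of_apply]
    rw [← frame4_swap23 E T i j k l, ← frame4_add]
    have e : (fun d a b c => T d a b c + T d b a c) = fun d a b c =>
        2 * (X d c * A a b) - X d b * A a c - X d a * A b c := by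
      funext d a b c
      rw [hT, hZ]
      ring
    rw [e, frame4_sub E (fun d a b c => 2 * (X d c * A a b) - X d b * A a c),
      frame4_sub E (fun d a b c => 2 * (X d c * A a b)), frame4_smul, frame4_mul12, frame4_mul13,
      frame4_mul14, h.orthonormal]
    ring
  · intro i j
    have e1 : ∀ i j, Matrix.of (frame4 E T i j)
        = ∑ d, E d i • ∑ a, E a j • (Eᵀ * H d a * E) := fun i j => rfl
    have e2 : Matrix.of (fun k l => frame4 E R k l i j)
        = ∑ d, E d i • ∑ a, E a j • (Eᵀ * Matrix.of (R d a) * E) := by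
      ext k l
      rw [Matrix.of_apply, hR'.2.2.1]
      rfl
    have e3 : ∑ d, E d j • ∑ a, E a i • (Eᵀ * H d a * E)
        = ∑ d, E d i • ∑ a, E a j • (Eᵀ * H a d * E) := by
      simp only [Finset.smul_sum, smul_smul]
      rw [Finset.sum_comm]
      simp only [mul_comm]
    rw [e1, e1, e2, e3, ← hY]
    simp only [Finset.sum_mul, Finset.mul_sum, Matrix.smul_mul, Matrix.mul_smul,
      ← conj_mul_inv_mul h, ← Finset.sum_sub_distrib, ← smul_sub, ← Matrix.mul_sub,
      ← Matrix.sub_mul, hC]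

variable {G P : E4 → Mat4} {x : E4}

lemma isCurvatureLike_riemann (hG : SmoothMat G x) (hs : ∀ᶠ y in 𝓝 x, (G y)ᵀ = G y)
    (hdet : ∀ᶠ y in 𝓝 x, (G y).det ≠ 0) : IsCurvatureLike (riemann G x) := by
  have h1 : ∀ a b c d, riemann G x a b c d = -riemann G x b a c d :=
    fun a b c d => riemann_antisymm_left hG hs hdet a b c d
  have h2 : ∀ a b c d, riemann G x a b c d = -riemann G x a b d c := riemann_antisymm_right
  have h3 : ∀ a b c d, riemann G x a b c d + riemann G x a c d b + riemann G x a d b c = 0 :=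
    riemann_bianchi hs
  refine ⟨h1, h2, fun a b c d => ?_, h3⟩
  -- Pair symmetry follows from the four cyclic identities on `a, b, c, d` together with both
  -- antisymmetries.
  linarith [h3 a b c d, h3 b c d a, h3 c d a b, h3 d a b c, h1 a b c d, h1 a c d b, h1 a d b c,
    h1 b c d a, h1 b d a c, h1 c d a b, h2 b a c d, h2 c a d b, h2 d a b c, h2 c b d a, h2 d b a c,
    h2 d c a b, h2 a b c d, h2 c d a b]

lemma weyl_eq_weylOf (hdet : (G x).det ≠ 0) : weyl G x = weylOf (G x) (riemann G x) := by
  have hr : ∀ b d, ricci G x b d = ricciOf (G x) (riemann G x) b d := by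
    intro b d
    have : ∀ c, ∑ a, (G x)⁻¹ c a * riemann G x a b c d = riemannUp G c b c d x := by
      intro c
      calc ∑ a, (G x)⁻¹ c a * riemann G x a b c d
          = ((G x)⁻¹ * (G x * curv G c d x)) c b := rfl
        _ = _ := by
          rw [← Matrix.mul_assoc, Matrix.nonsing_inv_mul _ (isUnit_iff_ne_zero.mpr hdet),
            Matrix.one_mul]
          rfl
    simp only [ricci, ricciOf, this]
  funext a b c d
  simp only [weyl, weylOf, scalarCurv, scalarOf, hr]

lemma ricci_identity_riemann (hG : SmoothMat G x) (hs : ∀ᶠ y in 𝓝 x, (G y)ᵀ = G y)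
    (hdet : ∀ᶠ y in 𝓝 x, (G y).det ≠ 0) {F : E4 → Mat4} (hF : SmoothMat F x) (d a : Fin 4) :
    covF2 G F d a x - covF2 G F a d x
      = Matrix.of (riemann G x d a) * (G x)⁻¹ * F x
        - F x * (G x)⁻¹ * Matrix.of (riemann G x d a) := by
  have hR := isCurvatureLike_riemann hG hs hdet
  have hdx := isUnit_iff_ne_zero.mpr hdet.self_of_nhds
  have e : Matrix.of (riemann G x d a) = G x * curv G d a x := by
    ext b c
    rw [Matrix.of_apply, hR.2.2.1, riemann_eq]
  have et : G x * curv G d a x = -((curv G d a x)ᵀ * G x) := by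
    rw [← e]
    have : (curv G d a x)ᵀ * G x = (G x * curv G d a x)ᵀ := by
      rw [Matrix.transpose_mul, hs.self_of_nhds]
    rw [this, ← e]
    ext b c
    exact hR.2.1 d a b c
  rw [ricci_identity hG hdet.self_of_nhds hs hF, e]
  congr 1
  · rw [et, Matrix.neg_mul, Matrix.neg_mul, Matrix.mul_assoc _ (G x),
      Matrix.mul_nonsing_inv _ hdx, Matrix.mul_one]
  · rw [← Matrix.mul_assoc, Matrix.mul_assoc (F x), Matrix.nonsing_inv_mul _ hdx, Matrix.mul_one]

/-- If an umbilical Maxwellian structure is given in coordinates near `x`, then its planes are the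
principal planes of the Weyl tensor at `x` as soon as the latter does not vanish. -/
theorem isPrincipalPlane_of_umbilical_of_maxwellian {O : Set E4} (hO : IsOpen O) (hx : x ∈ O)
    (hG : ∀ y ∈ O, SmoothMat G y) (hP : ∀ y ∈ O, SmoothMat P y)
    (hs : ∀ y ∈ O, (G y)ᵀ = G y) (hfr : ∀ y ∈ O, ∃ E, IsAdaptedFrame (G y) (P y) E)
    (hu : ∀ y ∈ O, UmbilicalPlaneAt G P y ∧ UmbilicalPlaneAt G (fun z => 1 - P z) y)
    (hM : MaxwellianNear G P x) (hW : weyl G x ≠ 0) :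
    IsPrincipalPlane (G x) (weyl G x) (P x) := by
  obtain ⟨N, hN, hxN, U, φ, ψ, hU, hφ, hψ, hUM⟩ := hM
  have ev : ∀ {p : E4 → Prop}, (∀ y ∈ O, p y) → ∀ y ∈ O, ∀ᶠ z in 𝓝 y, p z :=
    fun hp y hy => Filter.mem_of_superset (hO.mem_nhds hy) hp
  have evN : ∀ {p : E4 → Prop}, (∀ y ∈ N, p y) → ∀ y ∈ N, ∀ᶠ z in 𝓝 y, p z :=
    fun hp y hy => Filter.mem_of_superset (hN.mem_nhds hy) hp
  have hUs : ∀ y ∈ N, SmoothMat U y := fun y hy a b => (hU a b).contDiffAt (hN.mem_nhds hy)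
  have hφs : ∀ y ∈ N, ContDiffAt ℝ ∞ φ y := fun y hy => hφ.contDiffAt (hN.mem_nhds hy)
  have hψs : ∀ y ∈ N, ContDiffAt ℝ ∞ ψ y := fun y hy => hψ.contDiffAt (hN.mem_nhds hy)
  set Y := killingYanoForm G U φ ψ with hYd
  -- The equation is needed on a whole neighbourhood because it is going to be differentiated at
  -- `x`.
  have hK : ∀ᶠ y in 𝓝 x, KillingYanoAt G Y (fun c z => (1 / 3) * divForm G Y z c) y := by
    filter_upwards [hO.mem_nhds hx, hN.mem_nhds hxN] with y hy hyN
    exact killingYanoAt_of_maxwell (hG y hy) (ev hs y hy) (ev hfr y hy) (hP y hy) (hUs y hyN)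
      (evN (fun z hz => (hUM z hz).1) y hyN) (hφs y hyN) (hψs y hyN) (hu y hy).1 (hu y hy).2
      (hUM y hyN).2
  have hGx := hG x hx
  have hsx := ev hs x hx
  have hdet : ∀ᶠ y in 𝓝 x, (G y).det ≠ 0 :=
    (ev hfr x hx).mono fun y ⟨E, hE⟩ => hE.toIsOrientedFrame.det_ne_zero
  have hdx := hdet.self_of_nhds
  obtain ⟨E, hE⟩ := hfr x hx
  have hE' := hE.toIsOrientedFrame
  have hVs : SmoothMat (fun z => hodge (G z) (U z)) x := smoothMat_hodge hGx (hUs x hxN) hE'.det_neg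
  have hYs : SmoothMat Y x :=
    SmoothMat.smul ((hφs x hxN).neg.div_const 2).exp
      (((hUs x hxN).smul ((hψs x hxN).div_const 2).cos).sub
        (hVs.smul ((hψs x hxN).div_const 2).sin))
  have hYanti : ∀ᶠ y in 𝓝 x, (Y y)ᵀ = -Y y := by
    filter_upwards [ev hfr x hx, evN (fun z hz => (hUM z hz).1) x hxN] with y ⟨E', h'⟩ hvol
    simp only [hYd, killingYanoForm, Matrix.transpose_smul, Matrix.transpose_sub, hvol.1,
      (hodge_volumeElement h' hvol).1]
    module
  have hξ : ∀ c, DifferentiableAt ℝ (fun z => (1 / 3) * divForm G Y z c) x := by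
    intro c
    refine DifferentiableAt.const_mul ?_ _
    refine DifferentiableAt.fun_sum fun e _ => DifferentiableAt.fun_sum fun a _ => ?_
    exact ((hGx.inv hdx).diff e a).mul ((smoothMat_covF hGx hdx hYs e).diff a c)
  have hvol := (hUM x hxN).1
  obtain ⟨σ, hσ, hσU⟩ := hE.volumeElement hvol
  have hYE : Eᵀ * Y x * E = adaptedForm (Real.exp (-φ x / 2) * Real.cos (ψ x / 2) * σ)
      (Real.exp (-φ x / 2) * Real.sin (ψ x / 2) * σ) := by
    have : Eᵀ * Y x * E = Real.exp (-φ x / 2) • (Real.cos (ψ x / 2) • (Eᵀ * U x * E)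
        - Real.sin (ψ x / 2) • (Eᵀ * hodge (G x) (U x) * E)) := by
      simp only [hYd, killingYanoForm, Matrix.mul_smul, Matrix.smul_mul, Matrix.mul_sub,
        Matrix.sub_mul]
    rw [this, hE'.frame_hodge, hσU, hodge_adaptedForm]
    ext i j
    fin_cases i <;> fin_cases j <;> simp [adaptedForm] <;> ring
  -- Since `σ² = 1`, the sum `α² + β²` equals `e^{-φ}`: the Killing-Yano form vanishes nowhere.
  have hne : (Real.exp (-φ x / 2) * Real.cos (ψ x / 2) * σ) ^ 2
      + (Real.exp (-φ x / 2) * Real.sin (ψ x / 2) * σ) ^ 2 ≠ 0 := by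
    have : (Real.exp (-φ x / 2) * Real.cos (ψ x / 2) * σ) ^ 2
        + (Real.exp (-φ x / 2) * Real.sin (ψ x / 2) * σ) ^ 2 = Real.exp (-φ x / 2) ^ 2 := by
      linear_combination Real.exp (-φ x / 2) ^ 2 * σ ^ 2 * Real.cos_sq_add_sin_sq (ψ x / 2)
        + Real.exp (-φ x / 2) ^ 2 * hσ
    rw [this]
    positivity
  obtain ⟨w, w', hD⟩ := frame_integrability_of_components hE' hne
    (isCurvatureLike_riemann hGx hsx hdet) hYE (covF2_antisymm hYanti)
    (killingYano_deriv hGx hdx hsx hYs hξ hK) (ricci_identity_riemann hGx hsx hdet hYs)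
  have hfw : frame4 E (weyl G x) = weylOf minkowski (frame4 E (riemann G x)) := by
    funext i j k l
    rw [weyl_eq_weylOf hdx, hE'.frame_weylOf]
  exact isPrincipalPlane_of_components hE hvol hW (hfw ▸ hD)

end

section

/-! ### From the manifold to coordinates -/

/-- If the frame has the wrong orientation, reverse its last vector, which lies in `H`; neither the
metric components nor the splitting changes. -/
lemma exists_isAdaptedFrame {A P E : Mat4} (h : Eᵀ * A * E = minkowski)
    (hP : P * E = E * planeProj) : ∃ E', IsAdaptedFrame A P E' := by
  rcases lt_trichotomy E.det 0 with hd | hd | hd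
  · set S : Mat4 := Matrix.diagonal ![1, 1, 1, -1] with hS
    have hSS : Sᵀ * minkowski * S = minkowski := by
      rw [hS, Matrix.diagonal_transpose, minkowski, Matrix.diagonal_mul_diagonal,
        Matrix.diagonal_mul_diagonal]
      congr 1
      ext i
      fin_cases i <;> simp
    have hSP : planeProj * S = S * planeProj := by
      rw [hS, planeProj, Matrix.diagonal_mul_diagonal, Matrix.diagonal_mul_diagonal]
      congr 1
      ext i
      exact mul_comm _ _
    refine ⟨E * S, ⟨?_, ?_⟩, ?_⟩
    · rw [← hSS, ← h, Matrix.transpose_mul]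
      noncomm_ring
    · have : S.det = -1 := by simp [hS, Matrix.det_diagonal, Fin.prod_univ_four]
      rw [Matrix.det_mul, this]
      linarith
    · rw [← Matrix.mul_assoc, hP, Matrix.mul_assoc, hSP, Matrix.mul_assoc]
  · have := congrArg Matrix.det h
    rw [Matrix.det_mul, hd, mul_zero, det_minkowski] at this
    norm_num at this
  · exact ⟨E, ⟨h, hd⟩, hP⟩

lemma sum_smul_single (w : E4) : ∑ a, w a • (EuclideanSpace.single a 1 : E4) = w := by
  ext i
  fin_cases i <;> simp [Fin.sum_univ_four]

/-- `D` and `L` play the roles of the derivatives of the inverse chart and of the chart. The columns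
of the frame matrix are the coordinates `L (e i)`. -/
lemma exists_isAdaptedFrame_of_linear {T : Type*} [AddCommGroup T] [Module ℝ T]
    {B : LinearMap.BilinForm ℝ T} {Q : T →ₗ[ℝ] T} {D : E4 →ₗ[ℝ] T} {L : T →ₗ[ℝ] E4}
    (hDL : ∀ v, D (L v) = v) {e : Fin 4 → T} (he : IsLorentzFrame B e) (h0 : Q (e 0) = e 0)
    (h1 : Q (e 1) = e 1) (h2 : Q (e 2) = 0) (h3 : Q (e 3) = 0) :
    ∃ E, IsAdaptedFrame
      (Matrix.of fun i j => B (D (EuclideanSpace.single i 1)) (D (EuclideanSpace.single j 1)))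
      (Matrix.of fun i j => L (Q (D (EuclideanSpace.single j 1))) i) E := by
  have hexp : ∀ v, ∑ a, L v a • D (EuclideanSpace.single a 1) = v := by
    intro v
    conv_rhs => rw [← hDL v, ← sum_smul_single (L v)]
    simp only [map_sum, map_smul]
  refine exists_isAdaptedFrame (E := Matrix.of fun a i => L (e i) a) ?_ ?_
  · ext i j
    have : B (e i) (e j) = ∑ b, (∑ a, L (e i) a * B (D (EuclideanSpace.single a 1))
        (D (EuclideanSpace.single b 1))) * L (e j) b := by
      conv_lhs => rw [← hexp (e i), ← hexp (e j)]
      simp only [map_sum, map_smul, LinearMap.sum_apply, LinearMap.smul_apply, smul_eq_mul]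
      exact Finset.sum_congr rfl fun b _ => by rw [mul_comm]
    simp only [Matrix.mul_apply, Matrix.transpose_apply, Matrix.of_apply]
    rw [← this, he i j]
    fin_cases i <;> fin_cases j <;> simp [minkowski]
  · ext a i
    have : L (Q (e i)) a = ∑ b, L (Q (D (EuclideanSpace.single b 1))) a * L (e i) b := by
      conv_lhs => rw [← hexp (e i)]
      simp [Fin.sum_univ_four, mul_comm]
    simp only [Matrix.mul_apply, Matrix.of_apply]
    rw [← this]
    fin_cases i <;> simp [planeProj, Matrix.diagonal_apply, h0, h1, h2, h3]

/-! ### Adapted frames and alignment in the charts of the manifold -/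

section Charts

variable {M : Type*} [TopologicalSpace M] [ChartedSpace E4 M]

lemma mfderiv_symm_mfderiv {c : OpenPartialHomeomorph M E4}
    (hc : c ∈ IsManifold.maximalAtlas (𝓡 4) ∞ M) {x : E4} (hx : x ∈ c.target)
    (v : TangentSpace (𝓡 4) (c.symm x)) :
    mfderiv (𝓡 4) (𝓡 4) c.symm x
      (show E4 from mfderiv (𝓡 4) (𝓡 4) c (c.symm x) v) = v := by
  have hd : c.MDifferentiable (𝓡 4) (𝓡 4) :=
    ⟨(contMDiffOn_of_mem_maximalAtlas hc).mdifferentiableOn (by simp),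
      (contMDiffOn_symm_of_mem_maximalAtlas hc).mdifferentiableOn (by simp)⟩
  have h1 := hd.comp_symm_deriv hx
  set D : E4 →ₗ[ℝ] E4 := (mfderiv (𝓡 4) (𝓡 4) c.symm x : E4 →L[ℝ] E4).toLinearMap
  -- The chain rule gives `L ∘ D = id`. Both are endomorphisms of a finite-dimensional space, so `D
  -- ∘ L = id` as well.
  set L : E4 →ₗ[ℝ] E4 := (mfderiv (𝓡 4) (𝓡 4) c (c.symm x) : E4 →L[ℝ] E4).toLinearMap
  have h2 : L ∘ₗ D = LinearMap.id := by
    ext1 w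
    exact congrArg (fun f : E4 →L[ℝ] E4 => f w) h1
  have h3 : D ∘ₗ L = LinearMap.id := by
    rw [← Module.End.mul_eq_comp, ← Module.End.one_eq_id] at h2 ⊢
    exact mul_eq_one_comm.mp h2
  exact congrArg (fun f : E4 →ₗ[ℝ] E4 => f v) h3

variable [IsManifold (𝓡 4) ∞ M]

lemma AlmostProduct.exists_isAdaptedFrame {g : LorentzMetric M} (V : AlmostProduct g)
    {c : OpenPartialHomeomorph M E4} (hc : c ∈ IsManifold.maximalAtlas (𝓡 4) ∞ M) {x : E4}
    (hx : x ∈ c.target) :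
    ∃ E, IsAdaptedFrame (formComp g.form c x) (endComp V.proj c x) E := by
  obtain ⟨e, he, h0, h1, h2, h3⟩ := V.adapted (c.symm x)
  exact exists_isAdaptedFrame_of_linear
    (D := (mfderiv (𝓡 4) (𝓡 4) c.symm x : E4 →L[ℝ] TangentSpace (𝓡 4) (c.symm x)).toLinearMap)
    (L := (mfderiv (𝓡 4) (𝓡 4) c (c.symm x) : TangentSpace (𝓡 4) (c.symm x) →L[ℝ] E4).toLinearMap)
    (mfderiv_symm_mfderiv hc hx) he h0 h1 h2 h3

lemma IsPrincipalPlane.isTypeD {A P : Mat4} {W : Fin 4 → Fin 4 → Fin 4 → Fin 4 → ℝ}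
    (h : IsPrincipalPlane A W P) : IsTypeD A W := by
  obtain ⟨ρ, hρ, B, hB, -⟩ := h
  exact ⟨ρ, hρ, B, hB⟩

theorem AlmostProduct.alignedWithWeylAt {g : LorentzMetric M} (V : AlmostProduct g)
    (hU : V.IsUmbilical) (hM : V.IsMaxwellian) (p : M) (hW : g.WeylNeZeroAt p) :
    V.AlignedWithWeylAt p := by
  intro c hc hp
  have hx := c.map_source hp
  refine isPrincipalPlane_of_umbilical_of_maxwellian c.open_target hx
    (fun y hy a b => (g.smooth c hc a b).contDiffAt (c.open_target.mem_nhds hy))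
    (fun y hy a b => (V.smooth c hc a b).contDiffAt (c.open_target.mem_nhds hy))
    (fun y _ => ?_) (fun y hy => V.exists_isAdaptedFrame hc hy) (hU c hc) (hM c hc _ hx)
    (hW c hc hp)
  ext i j
  exact g.symm _ _ _

end Charts

end

end SpaceTime

end

/-! ### Main theorem: alignment already contains the type D eigenbasis -/

theorem mainTheorem7 {M : Type*} [TopologicalSpace M] [ChartedSpace SpaceTime.E4 M]
    [IsManifold (𝓡 4) ∞ M] (g : SpaceTime.LorentzMetric M) (V : SpaceTime.AlmostProduct g)
    (hUmb : V.IsUmbilical) (hMax : V.IsMaxwellian) (p : M) (hW : g.WeylNeZeroAt p) :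
    g.WeylTypeDAt p ∧ V.AlignedWithWeylAt p :=
  have h := V.alignedWithWeylAt hUmb hMax p hW
  ⟨fun c hc hp => (h c hc hp).isTypeD, h⟩
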